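/- **Setting.** Let $d=p_1+p_2$, $\mathbf y=(\theta,\alpha)\in\mathbb R^{p_1}\times\mathbb R^{p_2}=\mathbb R^d$ (Euclidean norm $\|\cdot\|$), and for a differentiable $h$ write $\nabla h=[\nabla_\theta h,-\nabla_\alpha h]$. Consider the game $\min_\theta\max_\alpha F(\theta,\alpha)$, $F(\mathbf y)=\mathbb E_{\xi\sim\mathcal D}[f(\mathbf y;\xi)]$, where $F$ is the common objective of $M$ nodes. A random point $Y$ is an $\epsilon$-stochastic first-order Nash equilibrium ($\epsilon$-SFNE) if $\mathbb E\|\nabla F(Y)\|^2\le\epsilon^2$. **Algorithm (DADAM$^3$).** Every node $i\in\{1,\dots,M\}$ starts with $\mathbf x_{i,0}=\mathbf z_{i,0}=\mathbf m_{i,0}=\mathbf v_{i,0}=\mathbf d_{i,0}=0$ and a given $\tilde{\mathbf v}_{i,0}$. With an $M\times M$ mixing matrix $W$, a number $t\ge1$ of averaging steps and $\mathbf X_k=[\mathbf x_{1,k},\dots,\mathbf x_{M,k}]$ etc., iteration $k=1,\dots,N$ is $$\mathbf Z_k=(\mathbf X_{k-1}-\eta\mathbf D_{k-1})W^t,\qquad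 \mathbf m_{i,k}=\beta_{1,k}\mathbf m_{i,k-1}+(1-\beta_{1,k})\hat{\mathbf g}_{i,k},\qquad \mathbf v_{i,k}=\beta_2\mathbf v_{i,k-1}+(1-\beta_2)\hat{\mathbf g}_{i,k}\odot\hat{\mathbf g}_{i,k},$$ $$\tilde{\mathbf v}_{i,k}=\beta_3\tilde{\mathbf v}_{i,k-1}+(1-\beta_3)\max(\tilde{\mathbf v}_{i,k-1},\mathbf v_{i,k}),\qquad \mathbf d_{i,k}=\tilde{\mathbf v}_{i,k}^{-1/2}\odot\mathbf m_{i,k},\qquad \mathbf X_k=(\mathbf X_{k-1}-\eta\mathbf D_k)W^t,$$ coordinatewise, where $\hat{\mathbf g}_{i,k}=\frac1{m_k}\sum_{j=1}^{m_k}\nabla f(\mathbf z_{i,k};\xi_{k,i}^j)$ and all samples $\xi^j_{k,i}$ (over $k$, $i$ and $j$) are independent with law $\mathcal D$. Put $\bar{\mathbf z}_k=\frac1M\sum_i\mathbf z_{i,k}$. **Assumptions.** (A) $f(\cdot;\xi)$ and $F$ are differentiable and, for all $\mathbf x,\mathbf y$: $\mathbb E_\xi\nabla f(\mathbf x;\xi)=\nabla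 F(\mathbf x)$; $\|\nabla f(\mathbf x;\xi)\|_\infty\le G_\infty$ almost surely; $\mathbb E_\xi\|\nabla f(\mathbf x;\xi)-\nabla F(\mathbf x)\|^2\le\sigma^2$; $\|\nabla F(\mathbf x)-\nabla F(\mathbf y)\|\le L\|\mathbf x-\mathbf y\|$. (B) There is $\mathbf x_*$ with $\|\mathbf x_*\|\le D/2$ and $\langle\mathbf x-\mathbf x_*,\nabla F(\mathbf x)\rangle\ge0$ for all $\mathbf x$. (C) Almost surely $\|\mathbf z_{i,k}\|\le D/2$ for all nodes $i$ and all $1\le k\le N$. (D) $W$ is symmetric and doubly stochastic, and $\rho=\max\{|\sigma_2(W)|,|\sigma_M(W)|\}<1$ for its eigenvalues $\sigma_1\ge\dots\ge\sigma_M$ ($\rho=0$ if $M=1$). (E) $\beta_{1,k}=\beta_{1,1}\lambda^{k-1}$ with $\lambda\in(0,1)$ and $0\le\beta_{1,1}\le\bigl(1+\sqrt{108G_\infty/(MG_0^3)}\bigr)^{-1}$; $\beta_2,\beta_3\in[0,1)$; $G_0,G_\infty>0$, $L\ge0$; $0<\eta\le\sqrt{G_0^3/(72L^2G_\infty)}$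 (no upper bound on $\eta$ if $L=0$); and every coordinate of every $\tilde{\mathbf v}_{i,0}$ lies in $[G_0^2,G_\infty^2]$. **Claim.** Fix $p_1,p_2,G_0,G_\infty,L,\sigma,D,\eta,\beta_{1,1},\lambda,\beta_2,\beta_3$. The constants $A$ and $K$ below are positive and depend only on these numbers and, as indicated, on a bound for $M$. They do not depend on $f$, $\mathcal D$, $W$, $\tilde{\mathbf v}_{i,0}$, $t$ or $\epsilon$. * (a) For every $M_0$ there is $K$ such that for all $0<\epsilon\le1$: if $1\le M\le M_0$, $m_k\ge K\epsilon^{-2}$ for $1\le k\le N$, $C\ge K\epsilon^{-2}$; * (b) for every $M_0$ there is $K$ such that for all $0<\epsilon\le1$: if $1\le M\le M_0$, $m_k=k+1$, $C\ge K\epsilon^{-2}$; * (c) there is $A$ such that for every $A'\ge A$ there is $K$ such that for all $0<\epsilon\le1$: if $A\epsilon^{-2}\le M\le A'\epsilon^{-2}$, $m_k\ge1$ is arbitrary (for instance $m_k=1$) for $1\le k\le N$, $C\ge K\epsilon^{-4}$; and if, in any of these cases, $N\ge K\epsilon^{-2}(1+\log(1/\epsilon))$, the integer $t\ge1$ satisfies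 $t\ge\log_{1/\rho}(1+C)$ (no further condition if $\rho=0$), and the assumptions (A)–(E) hold, then there is an iteration $k\in\{1,\dots,N\}$ for which $\bar{\mathbf z}_k$, and also each local iterate $\mathbf z_{i,k}$, is an $\epsilon$-SFNE of the game. In particular $N=\tilde{\mathcal O}(\epsilon^{-2})$ iterations suffice with (a) $m_k=\mathcal O(\epsilon^{-2})$, $M=\mathcal O(1)$, $C=\mathcal O(\epsilon^{-2})$; (b) $m_k=k+1$, $M=\mathcal O(1)$, $C=\mathcal O(\epsilon^{-2})$; (c) $m_k=\mathcal O(1)$, $M=\mathcal O(\epsilon^{-2})$, $C=\mathcal O(\epsilon^{-4})$. -/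

import Mathlib

open MeasureTheory ProbabilityTheory

universe u v

/-- The space `ℝ^{p₁} × ℝ^{p₂}` of the joint variable `y = (θ, α)` with the Euclidean norm;
the coordinates `Sum.inl _` are those of `θ`, the coordinates `Sum.inr _` those of `α`. -/
abbrev JointSpace (p₁ p₂ : ℕ) : Type := EuclideanSpace ℝ (Fin p₁ ⊕ Fin p₂)

/-- The gradient field `[∇_θ F, -∇_α F]` of the min-max game `min_θ max_α F (θ, α)`. -/
noncomputable def saddleGrad {p₁ p₂ : ℕ} (F : JointSpace p₁ p₂ → ℝ) (y : JointSpace p₁ p₂) :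
    JointSpace p₁ p₂ :=
  WithLp.toLp 2 (Sum.elim (fun i => gradient F y (Sum.inl i))
    (fun j => -(gradient F y (Sum.inr j))))

/-- The objective `F (y) = 𝔼_{ξ ∼ 𝒟} [f (y; ξ)]`. All nodes have this same local objective, so that
it is also the average of the local objectives over the nodes. -/
noncomputable def expectedLoss {p₁ p₂ : ℕ} {Ξ : Type u} [MeasurableSpace Ξ]
    (f : JointSpace p₁ p₂ → Ξ → ℝ) (𝒟 : Measure Ξ) (y : JointSpace p₁ p₂) : ℝ :=
  ∫ s, f y s ∂𝒟

/-- The random variable `Y` is an `ε`-stochastic first-order Nash equilibrium of the game with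
objective `F`: `𝔼 ‖∇F (Y)‖² ≤ ε²`. -/
def IsSFNE {p₁ p₂ : ℕ} {Ω : Type v} [MeasurableSpace Ω] (μ : Measure Ω)
    (F : JointSpace p₁ p₂ → ℝ) (Y : Ω → JointSpace p₁ p₂) (ε : ℝ) : Prop :=
  Measurable Y ∧ Integrable (fun ω => ‖saddleGrad F (Y ω)‖ ^ 2) μ ∧
    ∫ ω, ‖saddleGrad F (Y ω)‖ ^ 2 ∂μ ≤ ε ^ 2

/-- The local variables of all `M` nodes after an iteration: `x i`, `z i`, `d i`, `mom i`, `v i` and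
`vt i` are the vectors `x`, `z`, `d`, `m`, `v` and `ṽ` of node `i`. -/
structure DadamState (p₁ p₂ M : ℕ) where
  x : Fin M → JointSpace p₁ p₂
  z : Fin M → JointSpace p₁ p₂
  d : Fin M → JointSpace p₁ p₂
  mom : Fin M → JointSpace p₁ p₂
  v : Fin M → JointSpace p₁ p₂
  vt : Fin M → JointSpace p₁ p₂

/-- `t` rounds of averaging with the mixing matrix: the columns of `[X₁, …, X_M] W ^ t`. -/
def mixNodes {p₁ p₂ M : ℕ} (W : Matrix (Fin M) (Fin M) ℝ) (t : ℕ)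
    (X : Fin M → JointSpace p₁ p₂) : Fin M → JointSpace p₁ p₂ :=
  fun i => ∑ j, (W ^ t) j i • X j

/-- The mini-batch estimate of the gradient field at `y` from the first `b` of the samples `s`. -/
noncomputable def batchGrad {p₁ p₂ : ℕ} {Ξ : Type u} (f : JointSpace p₁ p₂ → Ξ → ℝ) (b : ℕ)
    (s : ℕ → Ξ) (y : JointSpace p₁ p₂) : JointSpace p₁ p₂ :=
  (b : ℝ)⁻¹ • ∑ j ∈ Finset.range b, saddleGrad (fun y' => f y' (s j)) y

/-- One iteration of DADAM³ with momentum parameter `b₁`, batch size `b`, and with the samples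
`s i 0, …, s i (b - 1)` at node `i`. Products, maxima and powers are taken coordinatewise. -/
noncomputable def dadamStep {p₁ p₂ M : ℕ} {Ξ : Type u} (f : JointSpace p₁ p₂ → Ξ → ℝ)
    (W : Matrix (Fin M) (Fin M) ℝ) (t : ℕ) (η b₁ β₂ β₃ : ℝ) (b : ℕ) (s : Fin M → ℕ → Ξ)
    (S : DadamState p₁ p₂ M) : DadamState p₁ p₂ M :=
  let z := mixNodes W t (fun i => S.x i - η • S.d i)
  let g : Fin M → JointSpace p₁ p₂ := fun i => batchGrad f b (s i) (z i)
  let mom : Fin M → JointSpace p₁ p₂ := fun i => b₁ • S.mom i + (1 - b₁) • g i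
  let v : Fin M → JointSpace p₁ p₂ := fun i =>
    WithLp.toLp 2 (fun r => β₂ * S.v i r + (1 - β₂) * (g i r * g i r))
  let vt : Fin M → JointSpace p₁ p₂ := fun i =>
    WithLp.toLp 2 (fun r => β₃ * S.vt i r + (1 - β₃) * max (S.vt i r) (v i r))
  let d : Fin M → JointSpace p₁ p₂ := fun i =>
    WithLp.toLp 2 (fun r => (√(vt i r))⁻¹ * mom i r)
  let x := mixNodes W t (fun i => S.x i - η • d i)
  { x := x, z := z, d := d, mom := mom, v := v, vt := vt }

/-- The state of DADAM³ after `k` iterations, started from `0` and from the given `ṽ₀`.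
Iteration `k ≥ 1` uses the momentum parameter `β₁ k`, the batch size `m k`, and at node `i` the
samples `s k i 0, …, s k i (m k - 1)`. -/
noncomputable def dadam {p₁ p₂ M : ℕ} {Ξ : Type u} (f : JointSpace p₁ p₂ → Ξ → ℝ)
    (W : Matrix (Fin M) (Fin M) ℝ) (t : ℕ) (η : ℝ) (β₁ : ℕ → ℝ) (β₂ β₃ : ℝ)
    (vt₀ : Fin M → JointSpace p₁ p₂) (m : ℕ → ℕ) (s : ℕ → Fin M → ℕ → Ξ) :
    ℕ → DadamState p₁ p₂ M
  | 0 => { x := 0, z := 0, d := 0, mom := 0, v := 0, vt := vt₀ }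
  | k + 1 => dadamStep f W t η (β₁ (k + 1)) β₂ β₃ (m (k + 1)) (s (k + 1))
      (dadam f W t η β₁ β₂ β₃ vt₀ m s k)

/-- The average `z̄ = (1 / M) ∑ᵢ zᵢ` of the local variables `zᵢ` over the nodes. -/
noncomputable def DadamState.zbar {p₁ p₂ M : ℕ} (S : DadamState p₁ p₂ M) : JointSpace p₁ p₂ :=
  (M : ℝ)⁻¹ • ∑ i, S.z i

/-- `ρ = max {|σ₂ (W)|, |σ_M (W)|}` for the eigenvalues `σ₁ ≥ σ₂ ≥ … ≥ σ_M` of the symmetric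
matrix `W`; for a single node there is no second eigenvalue, and `ρ = 0`. -/
noncomputable def mixingRate {M : ℕ} (W : Matrix (Fin M) (Fin M) ℝ) (hW : W.IsHermitian) : ℝ :=
  if h : 2 ≤ M then
    max |hW.eigenvalues₀ ⟨1, by rw [Fintype.card_fin]; omega⟩|
      |hW.eigenvalues₀ ⟨M - 1, by rw [Fintype.card_fin]; omega⟩|
  else 0

/-- The numerical parameters of the problem and of the algorithm. -/
structure DadamParams where
  /-- lower bound for `√ṽ₀` -/
  G₀ : ℝ
  /-- uniform bound for the coordinates of the stochastic gradients -/
  Ginf : ℝ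
  /-- Lipschitz constant of the gradient of the objective -/
  L : ℝ
  /-- `σ ^ 2` bounds the variance of the stochastic gradients -/
  σ : ℝ
  /-- `D / 2` bounds the norms of the Minty point and of the iterates -/
  D : ℝ
  /-- step size -/
  η : ℝ
  /-- first momentum parameter `β_{1,1}` -/
  β₁₁ : ℝ
  /-- decay of the momentum parameters, `β_{1,k} = β_{1,1} lam ^ (k - 1)` -/
  lam : ℝ
  β₂ : ℝ
  β₃ : ℝ

/-- The conditions on the parameters that do not involve the number of nodes. The last one is the
step size condition `η ≤ √(G₀³ / (72 L² G_∞))`, multiplied out so that it makes sense for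
`L = 0`. -/
structure DadamParams.Admissible (P : DadamParams) : Prop where
  G₀_pos : 0 < P.G₀
  Ginf_pos : 0 < P.Ginf
  L_nonneg : 0 ≤ P.L
  η_pos : 0 < P.η
  β₁₁_nonneg : 0 ≤ P.β₁₁
  lam_mem : P.lam ∈ Set.Ioo (0 : ℝ) 1
  β₂_mem : P.β₂ ∈ Set.Ico (0 : ℝ) 1
  β₃_mem : P.β₃ ∈ Set.Ico (0 : ℝ) 1
  η_le : 72 * P.L ^ 2 * P.Ginf * P.η ^ 2 ≤ P.G₀ ^ 3

/-- The momentum parameters `β_{1,k} = β_{1,1} lam ^ (k - 1)`, `k ≥ 1`. -/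
def DadamParams.β₁ (P : DadamParams) (k : ℕ) : ℝ := P.β₁₁ * P.lam ^ (k - 1)

/-- The assumptions on the loss `f (y; ξ)`, `ξ ∼ 𝒟`, and on the objective `F (y) = 𝔼 [f (y; ξ)]`. -/
structure LossAssumptions {p₁ p₂ : ℕ} (P : DadamParams) {Ξ : Type u} [MeasurableSpace Ξ]
    (f : JointSpace p₁ p₂ → Ξ → ℝ) (𝒟 : Measure Ξ) : Prop where
  /-- The loss is differentiable in `y`, its gradient is jointly measurable, and the objective is
  well defined and differentiable. -/
  differentiable_loss : ∀ s, Differentiable ℝ (fun y => f y s)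
  measurable_grad :
    Measurable (fun q : JointSpace p₁ p₂ × Ξ => saddleGrad (fun y => f y q.2) q.1)
  integrable_loss : ∀ y, Integrable (f y) 𝒟
  differentiable_objective : Differentiable ℝ (expectedLoss f 𝒟)
  /-- The stochastic gradient is unbiased. -/
  unbiased : ∀ y, ∫ s, saddleGrad (fun y' => f y' s) y ∂𝒟 = saddleGrad (expectedLoss f 𝒟) y
  /-- The stochastic gradient is bounded by `G_∞` in the maximum norm. -/
  bounded_grad : ∀ y, ∀ᵐ s ∂𝒟, ∀ r, |saddleGrad (fun y' => f y' s) y r| ≤ P.Ginf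
  /-- The variance is at most `σ²`. -/
  variance_le : ∀ y,
    ∫ s, ‖saddleGrad (fun y' => f y' s) y - saddleGrad (expectedLoss f 𝒟) y‖ ^ 2 ∂𝒟 ≤ P.σ ^ 2
  /-- The gradient field of the objective is `L`-Lipschitz. -/
  lipschitz : ∀ x y, ‖saddleGrad (expectedLoss f 𝒟) x - saddleGrad (expectedLoss f 𝒟) y‖ ≤
    P.L * ‖x - y‖
  /-- The Minty variational inequality holds for a point in the ball of radius `D / 2`. -/
  minty : ∃ xs : JointSpace p₁ p₂, ‖xs‖ ≤ P.D / 2 ∧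
    ∀ x, 0 ≤ inner ℝ (x - xs) (saddleGrad (expectedLoss f 𝒟) x)

/-- Let `M` nodes run DADAM³ for `N` iterations, with batch size `m k` at iteration `k`, and with
`t ≥ max (1, log_{1/ρ} (1 + C))` averaging steps per iteration. For all losses and sample
distributions, all mixing matrices, all starting values `ṽ₀`, and all samples that satisfy the
assumptions, there is an iteration `k ∈ {1, …, N}` for which the averaged iterate `z̄_k` and all
the local iterates `z_{i,k}` are `ε`-stochastic first-order Nash equilibria. -/
def FindsSFNE (p₁ p₂ : ℕ) (P : DadamParams) (ε : ℝ) (M N : ℕ) (m : ℕ → ℕ) (C : ℝ) : Prop :=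
  ∀ (Ξ : Type u) [MeasurableSpace Ξ] (𝒟 : Measure Ξ) [IsProbabilityMeasure 𝒟]
    (f : JointSpace p₁ p₂ → Ξ → ℝ)
    (Ω : Type v) [MeasurableSpace Ω] (μ : Measure Ω) [IsProbabilityMeasure μ]
    (s : ℕ → Fin M → ℕ → Ω → Ξ)
    (W : Matrix (Fin M) (Fin M) ℝ) (hW : W.IsHermitian) (t : ℕ)
    (vt₀ : Fin M → JointSpace p₁ p₂),
    LossAssumptions P f 𝒟 →
    -- all samples, over all iterations, nodes and batch positions, are i.i.d. with law `𝒟`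
    (∀ k i j, Measurable (s k i j)) →
    (∀ k i j, μ.map (s k i j) = 𝒟) →
    iIndepFun (fun q : ℕ × Fin M × ℕ => s q.1 q.2.1 q.2.2) μ →
    -- the mixing matrix of the undirected graph is symmetric and doubly stochastic, and `ρ < 1`
    W ∈ doublyStochastic ℝ (Fin M) →
    mixingRate W hW < 1 →
    1 ≤ t →
    Real.logb (1 / mixingRate W hW) (1 + C) ≤ t →
    -- the starting values
    (∀ i r, P.G₀ ^ 2 ≤ vt₀ i r ∧ vt₀ i r ≤ P.Ginf ^ 2) →
    P.β₁₁ ≤ 1 / (1 + √(108 * P.Ginf / (M * P.G₀ ^ 3))) →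
    -- the iterates stay in the ball of radius `D / 2`
    (∀ᵐ ω ∂μ, ∀ k ∈ Finset.Icc 1 N, ∀ i,
      ‖(dadam f W t P.η P.β₁ P.β₂ P.β₃ vt₀ m (fun k i j => s k i j ω) k).z i‖ ≤ P.D / 2) →
    ∃ k ∈ Finset.Icc 1 N,
      IsSFNE μ (expectedLoss f 𝒟)
        (fun ω => (dadam f W t P.η P.β₁ P.β₂ P.β₃ vt₀ m (fun k i j => s k i j ω) k).zbar) ε ∧
      ∀ i, IsSFNE μ (expectedLoss f 𝒟)
        (fun ω => (dadam f W t P.η P.β₁ P.β₂ P.β₃ vt₀ m (fun k i j => s k i j ω) k).z i) ε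

/-! Averaging over the nodes turns DADAM³ into a single inexact optimistic gradient method. A doubly
stochastic `W` preserves node averages, so `x̄ₖ₊₁ = x̄ₖ - η d̄ₖ₊₁` and `z̄ₖ₊₁ = x̄ₖ - η d̄ₖ`. With
`Φ` the gradient field of the objective and `Hₖ` the node average of `ṽₖ^(-1/2)`, the direction
splits as `d̄ₖ₊₁ = Hₖ Φ(z̄ₖ₊₁) + nₖ₊₁ + eₖ₊₁`. Here `n` is the averaged sampling noise, and `e`
collects the change of the preconditioner, the momentum and the disagreement of the nodes
(`DadamRecursion.optimisticRun`). The errors have a controlled sum: `H` decreases coordinatewise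
within `[1/G_∞, 1/G₀]`, so its changes telescope; the momentum parameters form a geometric series;
and `t` rounds of mixing shrink the spread by `1/(1+C)`, which leaves a disagreement of order `√M /
C` per iteration (`DadamRecursion.spread_le`).

Along almost every path, the `H⁻¹`-weighted squared distance to the Minty point, suitably corrected,
is a Lyapunov function up to noise and error. The Minty inequality gives the gradient term the right
sign. The Lipschitz condition and the step size let the negative term in `‖d̄ₖ‖²` absorb the
variation of the gradient. Summation bounds `∑ ‖d̄ₖ‖²`, hence `∑ ‖Φ(z̄ₖ)‖²`, by a constant, the
errors, the squared noise and a term linear in the noise (`exists_sum_sq_gradient_le`).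

The noise is weighted with the old preconditioner `Hₖ` and evaluated at `zₖ₊₁`, both determined
before the samples of iteration `k+1` are drawn. The linear term therefore has mean zero, and
independence makes the second moment of order `1/(M mₖ)` (`noise_moments`, `avgNoise_moments`).
Altogether `∑ 𝔼‖Φ(z̄ₖ)‖² ≤ B (1 + N δ + ∑ 1/(M mₖ))` with `δ` of order `√M / C`
(`exists_sum_integral_sq_norm_le`). Division by `N` and pigeonhole give a good `k`, and the
Lipschitz condition transfers the bound to the local iterates (`exists_findsSFNE`). The three
regimes are three ways to make the mean of `1/(M mₖ)` of order `ε²`. -/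

/-! ### Spectral contraction by the mixing matrix. -/

section Mixing

open Matrix

variable {M : ℕ} {W : Matrix (Fin M) (Fin M) ℝ}

theorem mixingRate_nonneg (hW : W.IsHermitian) : 0 ≤ mixingRate W hW := by
  unfold mixingRate
  split_ifs
  · exact le_max_of_le_left (abs_nonneg _)
  · exact le_rfl

/-- All eigenvalues but the one with the first index are bounded by the mixing rate. -/
theorem abs_eigenvalues_le_mixingRate (hW : W.IsHermitian) (h : 2 ≤ M) (i : Fin M)
    (hi : (Fintype.equivOfCardEq (Fintype.card_fin (Fintype.card (Fin M)))).symm i ≠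
      ⟨0, by rw [Fintype.card_fin]; omega⟩) :
    |hW.eigenvalues i| ≤ mixingRate W hW := by
  unfold mixingRate Matrix.IsHermitian.eigenvalues
  rw [dif_pos h]
  generalize (Fintype.equivOfCardEq (Fintype.card_fin (Fintype.card (Fin M)))).symm i = j at hi
  have hj : j.1 < M := lt_of_lt_of_eq j.2 (Fintype.card_fin M)
  have hj0 : j.1 ≠ 0 := fun h0 => hi (Fin.ext h0)
  -- The index lies between `1` and `M - 1`, so the eigenvalue lies between `σ_M` and `σ₂`.
  rw [max_comm]
  apply abs_le_max_abs_abs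
  · exact hW.eigenvalues₀_antitone (Fin.mk_le_mk.2 (by omega))
  · exact hW.eigenvalues₀_antitone (Fin.mk_le_mk.2 (by omega))

/-- Parseval's identity in an orthonormal eigenbasis of `W`. -/
theorem sum_sq_eigenvectorBasis (hW : W.IsHermitian) (u : Fin M → ℝ) :
    ∑ i, ((hW.eigenvectorBasis i).ofLp ⬝ᵥ u) ^ 2 = ∑ i, u i ^ 2 := by
  have h := hW.eigenvectorBasis.sum_sq_norm_inner_right (WithLp.toLp 2 u)
  rw [EuclideanSpace.real_norm_sq_eq] at h
  simpa [EuclideanSpace.inner_eq_star_dotProduct, dotProduct_comm] using h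

theorem eigenvectorBasis_dotProduct_mulVec (hW : W.IsHermitian) (i : Fin M) (u : Fin M → ℝ) :
    (hW.eigenvectorBasis i).ofLp ⬝ᵥ (W *ᵥ u) =
      hW.eigenvalues i * ((hW.eigenvectorBasis i).ofLp ⬝ᵥ u) := by
  have hT : Wᵀ = W := (conjTranspose_eq_transpose_of_trivial W).symm.trans hW
  rw [dotProduct_mulVec, ← mulVec_transpose, hT, hW.mulVec_eigenvectorBasis, smul_dotProduct,
    smul_eq_mul]

/-- Mixing contracts vectors with mean zero at the mixing rate. -/
theorem sum_sq_mulVec_le (hW : W.IsHermitian) (hd : W ∈ doublyStochastic ℝ (Fin M))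
    (hρ : mixingRate W hW < 1) (u : Fin M → ℝ) (hu : ∑ i, u i = 0) :
    ∑ i, (W *ᵥ u) i ^ 2 ≤ mixingRate W hW ^ 2 * ∑ i, u i ^ 2 := by
  rcases lt_or_ge M 2 with h | h
  · have hu0 : u = 0 := by
      ext i
      have : Subsingleton (Fin M) := Fin.subsingleton_iff_le_one.2 (by omega)
      rw [Fintype.sum_subsingleton _ i] at hu
      simpa using hu
    simp [hu0]
  set b := fun i => (hW.eigenvectorBasis i).ofLp with hb
  set i₀ : Fin M := Fintype.equivOfCardEq (Fintype.card_fin (Fintype.card (Fin M)))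
    ⟨0, by rw [Fintype.card_fin]; omega⟩ with hi₀
  have hle : ∀ i, i ≠ i₀ → |hW.eigenvalues i| ≤ mixingRate W hW := by
    intro i hi
    refine abs_eigenvalues_le_mixingRate hW h i fun h' => hi ?_
    rw [hi₀, ← h', Equiv.apply_symm_apply]
  -- As `W 1 = 1`, pairing with the eigenvector gives `⟨b i, 1⟩ = λᵢ ⟨b i, 1⟩` with `λᵢ ≤ ρ < 1`.
  have hone : ∀ i, i ≠ i₀ → b i ⬝ᵥ 1 = 0 := by
    intro i hi
    have h1 := eigenvectorBasis_dotProduct_mulVec hW i 1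
    rw [mulVec_one_of_mem_doublyStochastic hd] at h1
    have h2 : hW.eigenvalues i < 1 := (le_abs_self _).trans_lt ((hle i hi).trans_lt hρ)
    have h3 : (1 - hW.eigenvalues i) * (b i ⬝ᵥ 1) = 0 := by linarith
    exact (mul_eq_zero.1 h3).resolve_left (by linarith)
  -- the constant vector is a multiple of `b i₀`
  have horth : b i₀ ⬝ᵥ u = 0 := by
    have h1 : ∀ i, (b i ⬝ᵥ 1) * (b i ⬝ᵥ u) = if i = i₀ then (b i₀ ⬝ᵥ 1) * (b i₀ ⬝ᵥ u) else 0 := by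
      intro i
      split_ifs with hi
      · rw [hi]
      · rw [hone i hi, zero_mul]
    -- Parseval polarized: the sum is `⟨1, u⟩`, which vanishes because `u` has mean zero.
    have h2 : ∑ i, (b i ⬝ᵥ 1) * (b i ⬝ᵥ u) = 0 := by
      have e1 := sum_sq_eigenvectorBasis hW (1 + u)
      have e2 := sum_sq_eigenvectorBasis hW 1
      have e3 := sum_sq_eigenvectorBasis hW u
      simp only [dotProduct_add, add_sq, Finset.sum_add_distrib, Pi.add_apply, Pi.one_apply,
        mul_assoc, ← Finset.mul_sum, one_mul, hu] at e1 e2 e3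
      simp only [hb]
      linarith
    rw [Finset.sum_congr rfl fun i _ => h1 i, Finset.sum_ite_eq' Finset.univ i₀] at h2
    rw [if_pos (Finset.mem_univ _)] at h2
    -- If `b i₀` were also orthogonal to `1`, then `1` would be orthogonal to the whole basis, which
    -- forces `M = 0`.
    rcases mul_eq_zero.1 h2 with h3 | h3
    · have e2 := sum_sq_eigenvectorBasis hW 1
      rw [Finset.sum_eq_zero] at e2
      · have : (M : ℝ) = 0 := by simpa using e2.symm
        norm_cast at this
        omega
      · intro i _
        by_cases hi : i = i₀
        · rw [hi, sq_eq_zero_iff]; exact h3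
        · rw [sq_eq_zero_iff]; exact hone i hi
    · exact h3
  rw [← sum_sq_eigenvectorBasis hW (W *ᵥ u), ← sum_sq_eigenvectorBasis hW u, Finset.mul_sum]
  refine Finset.sum_le_sum fun i _ => ?_
  rw [eigenvectorBasis_dotProduct_mulVec, mul_pow]
  by_cases hi : i = i₀
  · have : (hW.eigenvectorBasis i).ofLp ⬝ᵥ u = 0 := by rw [hi]; exact horth
    simp [this]
  · rw [← sq_abs (hW.eigenvalues i)]
    have := hle i hi
    gcongr

theorem sum_pow_mulVec (hd : W ∈ doublyStochastic ℝ (Fin M)) (t : ℕ) (u : Fin M → ℝ) :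
    ∑ i, (W ^ t *ᵥ u) i = ∑ i, u i :=
  sum_mulVec_of_mem_doublyStochastic (pow_mem hd t)

theorem sum_sq_pow_mulVec_le (hW : W.IsHermitian) (hd : W ∈ doublyStochastic ℝ (Fin M))
    (hρ : mixingRate W hW < 1) (t : ℕ) (u : Fin M → ℝ) (hu : ∑ i, u i = 0) :
    ∑ i, (W ^ t *ᵥ u) i ^ 2 ≤ (mixingRate W hW ^ t) ^ 2 * ∑ i, u i ^ 2 := by
  induction t with
  | zero => simp
  | succ t ih =>
    rw [pow_succ' W, ← mulVec_mulVec]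
    refine (sum_sq_mulVec_le hW hd hρ _ ((sum_pow_mulVec hd t u).trans hu)).trans ?_
    calc _ ≤ mixingRate W hW ^ 2 * ((mixingRate W hW ^ t) ^ 2 * ∑ i, u i ^ 2) := by gcongr
      _ = _ := by ring

/-- The average of the vectors `X i` over the nodes. -/
noncomputable def nodeAvg {p₁ p₂ M : ℕ} (X : Fin M → JointSpace p₁ p₂) : JointSpace p₁ p₂ :=
  (M : ℝ)⁻¹ • ∑ i, X i

/-- The root of the sum of the squared distances of the vectors `X i` from their average. -/
noncomputable def spread {p₁ p₂ M : ℕ} (X : Fin M → JointSpace p₁ p₂) : ℝ :=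
  √(∑ i, ‖X i - nodeAvg X‖ ^ 2)

variable {p₁ p₂ : ℕ}

theorem nodeAvg_apply (X : Fin M → JointSpace p₁ p₂) (r : Fin p₁ ⊕ Fin p₂) :
    nodeAvg X r = (M : ℝ)⁻¹ * ∑ i, X i r := by
  simp [nodeAvg]

theorem mixNodes_apply (hW : W.IsHermitian) (t : ℕ) (X : Fin M → JointSpace p₁ p₂) (i : Fin M)
    (r : Fin p₁ ⊕ Fin p₂) : mixNodes W t X i r = (W ^ t *ᵥ fun j => X j r) i := by
  have hT : (W ^ t)ᵀ = W ^ t := by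
    rw [transpose_pow, (conjTranspose_eq_transpose_of_trivial W).symm.trans hW]
  simp only [mixNodes, WithLp.ofLp_sum, Finset.sum_apply, PiLp.smul_apply, smul_eq_mul, mulVec,
    dotProduct]
  refine Finset.sum_congr rfl fun j _ => ?_
  rw [← transpose_apply (W ^ t), hT]

theorem nodeAvg_mixNodes (hW : W.IsHermitian) (hd : W ∈ doublyStochastic ℝ (Fin M)) (t : ℕ)
    (X : Fin M → JointSpace p₁ p₂) : nodeAvg (mixNodes W t X) = nodeAvg X := by
  ext r
  simp only [nodeAvg_apply, mixNodes_apply hW, sum_pow_mulVec hd]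

theorem sum_sub_nodeAvg (X : Fin M → JointSpace p₁ p₂) : ∑ i, (X i - nodeAvg X) = 0 := by
  rcases Nat.eq_zero_or_pos M with rfl | hM
  · simp
  · have : (M : ℝ) ≠ 0 := by positivity
    rw [Finset.sum_sub_distrib, Finset.sum_const, Finset.card_univ, Fintype.card_fin, nodeAvg,
      ← Nat.cast_smul_eq_nsmul ℝ, smul_smul, mul_inv_cancel₀ this, one_smul, sub_self]

/-- Mixing acts on each coordinate separately and fixes constant vectors, so it acts on the
deviations from the node average. These sum to zero over the nodes, and the contraction on mean-zero
vectors applies. -/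
theorem spread_mixNodes_le (hW : W.IsHermitian) (hd : W ∈ doublyStochastic ℝ (Fin M))
    (hρ : mixingRate W hW < 1) (t : ℕ) (X : Fin M → JointSpace p₁ p₂) :
    spread (mixNodes W t X) ≤ mixingRate W hW ^ t * spread X := by
  have h0 := pow_nonneg (mixingRate_nonneg hW) t
  unfold spread
  refine Real.sqrt_le_iff.2 ⟨by positivity, ?_⟩
  rw [mul_pow, Real.sq_sqrt (by positivity), nodeAvg_mixNodes hW hd]
  simp only [EuclideanSpace.real_norm_sq_eq]
  rw [Finset.sum_comm, Finset.sum_comm (f := fun i r => (X i - nodeAvg X).ofLp r ^ 2),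
    Finset.mul_sum]
  refine Finset.sum_le_sum fun r _ => ?_
  have hs : ∑ i, (X i - nodeAvg X) r = 0 := by
    have := congrArg (fun v : JointSpace p₁ p₂ => v r) (sum_sub_nodeAvg X)
    simpa using this
  have key := sum_sq_pow_mulVec_le hW hd hρ t (fun i => (X i - nodeAvg X) r) hs
  refine le_of_eq_of_le (Finset.sum_congr rfl fun i _ => ?_) key
  congr 1
  have hc : (W ^ t *ᵥ fun _ => nodeAvg X r) i = nodeAvg X r := by
    have h1 := sum_row_of_mem_doublyStochastic (pow_mem hd t) i
    simp only [mulVec, dotProduct, ← Finset.sum_mul, h1, one_mul]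
  have : (fun i => (X i - nodeAvg X) r) = (fun i => X i r) - fun _ => nodeAvg X r := by
    ext; simp
  rw [this, mulVec_sub, Pi.sub_apply, hc, PiLp.sub_apply, mixNodes_apply hW]

theorem norm_sub_nodeAvg_le_spread (X : Fin M → JointSpace p₁ p₂) (i : Fin M) :
    ‖X i - nodeAvg X‖ ≤ spread X := by
  refine Real.le_sqrt_of_sq_le ?_
  exact Finset.single_le_sum (f := fun i => ‖X i - nodeAvg X‖ ^ 2) (fun _ _ => by positivity)
    (Finset.mem_univ i)

/-- The spread is the distance from the diagonal in the Euclidean norm of the product. -/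
theorem spread_eq_norm (X : Fin M → JointSpace p₁ p₂) :
    spread X = ‖(WithLp.toLp 2 fun i => X i - nodeAvg X : PiLp 2 fun _ : Fin M =>
      JointSpace p₁ p₂)‖ := by
  rw [PiLp.norm_eq_of_L2]; rfl

/-- Subtracting the node average is linear, so the spread is a seminorm. -/
theorem spread_sub_smul_le (X Y : Fin M → JointSpace p₁ p₂) (c : ℝ) :
    spread (fun i => X i - c • Y i) ≤ spread X + |c| * spread Y := by
  simp only [spread_eq_norm]
  rw [← Real.norm_eq_abs, ← norm_smul]
  refine le_of_eq_of_le ?_ (norm_sub_le _ _)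
  congr 1
  ext i : 1
  simp only [nodeAvg, Finset.sum_sub_distrib, ← Finset.smul_sum, PiLp.sub_apply, PiLp.smul_apply]
  module

/-- The spread is at most the Euclidean norm of the product. -/
theorem spread_sq_le (X : Fin M → JointSpace p₁ p₂) : spread X ^ 2 ≤ ∑ i, ‖X i‖ ^ 2 := by
  rw [spread, Real.sq_sqrt (by positivity)]
  have h : ∑ i, inner ℝ (X i - nodeAvg X) (nodeAvg X) = 0 := by
    rw [← sum_inner, sum_sub_nodeAvg, inner_zero_left]
  have h2 : ∀ i, ‖X i‖ ^ 2 = ‖X i - nodeAvg X‖ ^ 2 + 2 * inner ℝ (X i - nodeAvg X) (nodeAvg X) +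
      ‖nodeAvg X‖ ^ 2 := by
    intro i
    rw [← norm_add_sq_real, sub_add_cancel]
  rw [Finset.sum_congr rfl fun i _ => h2 i, Finset.sum_add_distrib, Finset.sum_add_distrib,
    ← Finset.mul_sum, h, mul_zero, add_zero]
  exact le_add_of_nonneg_right (by positivity)

/-- Enough rounds of averaging contract the spread by the factor `1 / (1 + C)`. -/
theorem mixingRate_pow_le (hW : W.IsHermitian) (hρ : mixingRate W hW < 1) {t : ℕ} (ht : 1 ≤ t)
    {C : ℝ} (hC : 0 < C) (h : Real.logb (1 / mixingRate W hW) (1 + C) ≤ t) :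
    mixingRate W hW ^ t ≤ 1 / (1 + C) := by
  -- For `ρ = 0` the logarithm to base `1 / 0 = 0` carries no information; `1 ≤ t` already gives `ρ
  -- ^ t = 0`.
  rcases (mixingRate_nonneg hW).eq_or_lt with h0 | h0
  · rw [← h0, zero_pow (by omega)]; positivity
  · rw [Real.logb_le_iff_le_rpow (by rw [one_div]; exact (one_lt_inv₀ h0).2 hρ) (by positivity),
      Real.rpow_natCast, _root_.one_div_pow] at h
    rw [le_div_iff₀ (by positivity), mul_comm, ← le_div_iff₀ (by positivity)]
    exact h

end Mixing

/-! ### Lyapunov analysis of the inexact optimistic gradient method along one path. -/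

section Pathwise

/-- A run of the optimistic gradient method with a decreasing diagonal preconditioner `H`, a noise
`n` and a further error `e` in the directions `d`: the recursions and bounds that the node averages
of DADAM³ satisfy along a sample path, over iterations `1, …, N`. -/
structure OptimisticRun {ι : Type*} [Fintype ι] (g Γ L η D T : ℝ) (N : ℕ)
    (x z d n e G H : ℕ → ι → ℝ) (τ : ℕ → ℝ) (xs : ι → ℝ) : Prop where
  x_succ : ∀ k r, x (k + 1) r = x k r - η * d (k + 1) r
  z_succ : ∀ k r, z (k + 1) r = x k r - η * d k r
  d_zero : ∀ r, d 0 r = 0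
  d_succ : ∀ k < N, ∀ r, d (k + 1) r = H k r * G (k + 1) r + n (k + 1) r + e (k + 1) r
  le_H : ∀ k ≤ N, ∀ r, 1 / Γ ≤ H k r
  H_le : ∀ k ≤ N, ∀ r, H k r ≤ 1 / g
  H_anti : ∀ k < N, ∀ r, H (k + 1) r ≤ H k r
  e_le : ∀ k < N, ∀ r, |e (k + 1) r| ≤ τ (k + 1)
  H_sub_le : ∀ k < N, ∀ r, Γ * (H k r - H (k + 1) r) ≤ τ (k + 1)
  G_le : ∀ k < N, ∀ r, |G (k + 1) r| ≤ Γ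
  d_le : ∀ k ≤ N, ∀ r, |d k r| ≤ Γ / g
  lipschitz : ∀ k, k + 1 < N →
    ∑ r, (G (k + 2) r - G (k + 1) r) ^ 2 ≤ L ^ 2 * ∑ r, (z (k + 2) r - z (k + 1) r) ^ 2
  minty : ∀ k < N, 0 ≤ ∑ r, (z (k + 1) r - xs r) * G (k + 1) r
  z_le : ∀ k < N, ∀ r, |z (k + 1) r - xs r| ≤ D
  τ_nonneg : ∀ k < N, 0 ≤ τ (k + 1)
  τ_le : ∀ k < N, τ (k + 1) ≤ T

/-- Change of the weighted squared distance of one coordinate in one step. -/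
theorem optimistic_step_identity {H G n e d d' x xs η : ℝ} (hH : H ≠ 0)
    (hd' : d' = H * G + n + e) :
    H⁻¹ * (x - η * d' - xs) ^ 2 = H⁻¹ * (x - xs) ^ 2 - 2 * η * ((x - η * d - xs) * G)
      - 2 * η * (n * (x - η * d - xs) * H⁻¹) - 2 * η * (e * (x - η * d - xs) * H⁻¹)
      + η ^ 2 * (H⁻¹ * (d' - d) ^ 2) - η ^ 2 * (H⁻¹ * d ^ 2) := by
  have hG : G = H⁻¹ * (d' - n - e) := by
    rw [hd']; field_simp; ring
  rw [hG]
  ring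

theorem weighted_sq_add_le {H Δ w g Γ : ℝ} (hH : 0 < H) (hHg : H ≤ 1 / g) (hΓ : H⁻¹ ≤ Γ) :
    H⁻¹ * (H * Δ + w) ^ 2 ≤ 2 / g * Δ ^ 2 + 2 * Γ * w ^ 2 := by
  have h1 : H⁻¹ * (H * Δ + w) ^ 2 ≤ 2 * H * Δ ^ 2 + 2 * H⁻¹ * w ^ 2 := by
    have h2 : 2 * H * Δ ^ 2 + 2 * H⁻¹ * w ^ 2 - H⁻¹ * (H * Δ + w) ^ 2 =
        H⁻¹ * (H * Δ - w) ^ 2 := by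
      field_simp; ring
    have h3 : 0 ≤ H⁻¹ * (H * Δ - w) ^ 2 := by positivity
    linarith
  have h4 : 2 * H * Δ ^ 2 ≤ 2 / g * Δ ^ 2 := by
    rw [show 2 / g = 2 * (1 / g) by ring]; gcongr
  have h5 : 2 * H⁻¹ * w ^ 2 ≤ 2 * Γ * w ^ 2 := by gcongr
  linarith

theorem sq_noise_add_le {a b u s t : ℝ} (hu : |u| ≤ s + 2 * t) :
    (a - b + u) ^ 2 ≤ 3 * (a ^ 2 + b ^ 2) + 6 * s ^ 2 + 24 * t ^ 2 := by
  have h1 : u ^ 2 ≤ (s + 2 * t) ^ 2 := sq_le_sq' (by linarith [abs_le.1 hu]) (abs_le.1 hu).2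
  nlinarith [sq_nonneg (a + b), sq_nonneg (a - u), sq_nonneg (b + u), sq_nonneg (s - 2 * t)]

namespace OptimisticRun

variable {ι : Type*} [Fintype ι] {g Γ L η D T : ℝ} {N : ℕ}
  {x z d n e G H : ℕ → ι → ℝ} {τ : ℕ → ℝ} {xs : ι → ℝ}

theorem H_pos (R : OptimisticRun g Γ L η D T N x z d n e G H τ xs) (hΓ : 0 < Γ) {k : ℕ}
    (hk : k ≤ N) (r : ι) : 0 < H k r := (by positivity : 0 < 1 / Γ).trans_le (R.le_H k hk r)

theorem inv_H_le (R : OptimisticRun g Γ L η D T N x z d n e G H τ xs) (hΓ : 0 < Γ) {k : ℕ}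
    (hk : k ≤ N) (r : ι) : (H k r)⁻¹ ≤ Γ := by
  rw [inv_le_comm₀ (R.H_pos hΓ hk r) hΓ, ← one_div]; exact R.le_H k hk r

theorem le_inv_H (R : OptimisticRun g Γ L η D T N x z d n e G H τ xs) (hΓ : 0 < Γ) (hg : 0 < g)
    {k : ℕ} (hk : k ≤ N) (r : ι) : g ≤ (H k r)⁻¹ := by
  rw [le_inv_comm₀ hg (R.H_pos hΓ hk r), ← one_div]; exact R.H_le k hk r

/-- Only `z` is assumed bounded; `x` follows because the two differ by `η (d k - d (k + 1))`. -/
theorem abs_x_sub_le (R : OptimisticRun g Γ L η D T N x z d n e G H τ xs) (hη : 0 < η) {k : ℕ}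
    (hk : k < N) (r : ι) : |x (k + 1) r - xs r| ≤ D + 2 * η * (Γ / g) := by
  have h1 : x (k + 1) r - xs r = (z (k + 1) r - xs r) + η * (d k r - d (k + 1) r) := by
    rw [R.x_succ, R.z_succ]; ring
  have h2 : |d k r - d (k + 1) r| ≤ 2 * (Γ / g) :=
    (abs_sub _ _).trans (by linarith [R.d_le k hk.le r, R.d_le (k + 1) hk r])
  rw [h1]
  refine (abs_add_le _ _).trans ?_
  rw [abs_mul, abs_of_pos hη]
  nlinarith [R.z_le k hk r]

/-- Since `H⁻¹` grows, the weighted squared distance could grow with the weight alone. Subtracting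
`(D + 2ηΓ/g)² H⁻¹`, where the factor bounds `(x - xs)²`, makes any increase of the weight harmless.
The rest of the step is the expansion identity, with `(d (k + 2) - d (k + 1))²` split into gradient
variation, noise and error. Squared errors become linear in `τ` through `τ ≤ T`. -/
theorem coord_step (R : OptimisticRun g Γ L η D T N x z d n e G H τ xs) (hg : 0 < g) (hΓ : 0 < Γ)
    (hη : 0 < η) {k : ℕ} (hk : k + 1 < N) (r : ι) :
    (H (k + 2) r)⁻¹ * (x (k + 2) r - xs r) ^ 2
        - (D + 2 * η * (Γ / g)) ^ 2 * (H (k + 2) r)⁻¹ ≤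
      (H (k + 1) r)⁻¹ * (x (k + 1) r - xs r) ^ 2
        - (D + 2 * η * (Γ / g)) ^ 2 * (H (k + 1) r)⁻¹
        - 2 * η * ((z (k + 2) r - xs r) * G (k + 2) r)
        - 2 * η * (n (k + 2) r * (z (k + 2) r - xs r) * (H (k + 1) r)⁻¹)
        + 2 * η * (Γ * D) * τ (k + 2)
        + η ^ 2 * (2 / g * (G (k + 2) r - G (k + 1) r) ^ 2
          + 6 * Γ * (n (k + 2) r ^ 2 + n (k + 1) r ^ 2)
          + 12 * Γ * T * τ (k + 2) + 48 * Γ * T * τ (k + 1))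
        - η ^ 2 * g * d (k + 1) r ^ 2 := by
  have hH := R.H_pos hΓ hk.le r
  have hH2 := R.H_pos hΓ (Nat.succ_le_of_lt hk) r
  have hid := optimistic_step_identity (η := η) (d := d (k + 1) r) (x := x (k + 1) r)
    (xs := xs r) hH.ne' (R.d_succ (k + 1) hk r)
  rw [← R.z_succ (k + 1) r, ← R.x_succ (k + 1) r] at hid
  have hA : (H (k + 1) r)⁻¹ ≤ (H (k + 2) r)⁻¹ := inv_anti₀ hH2 (R.H_anti (k + 1) hk r)
  have hxb := R.abs_x_sub_le hη hk r
  have hx2 : (x (k + 2) r - xs r) ^ 2 ≤ (D + 2 * η * (Γ / g)) ^ 2 := by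
    rw [← sq_abs]; gcongr
  have h1 : (H (k + 2) r)⁻¹ * (x (k + 2) r - xs r) ^ 2
      - (D + 2 * η * (Γ / g)) ^ 2 * (H (k + 2) r)⁻¹ ≤
      (H (k + 1) r)⁻¹ * (x (k + 2) r - xs r) ^ 2
      - (D + 2 * η * (Γ / g)) ^ 2 * (H (k + 1) r)⁻¹ := by
    have := mul_le_mul_of_nonneg_left hx2 (sub_nonneg.2 hA)
    linarith
  have hτ1 := R.τ_nonneg k (by omega)
  have hτ2 := R.τ_nonneg (k + 1) hk
  have hD : 0 ≤ D := (abs_nonneg _).trans (R.z_le k (by omega) r)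
  have hΓ' := R.inv_H_le hΓ hk.le r
  have h2 : -(2 * η * (e (k + 2) r * (z (k + 2) r - xs r) * (H (k + 1) r)⁻¹)) ≤
      2 * η * (Γ * D) * τ (k + 2) := by
    have h3 : |e (k + 2) r * (z (k + 2) r - xs r) * (H (k + 1) r)⁻¹| ≤ τ (k + 2) * D * Γ := by
      rw [abs_mul, abs_mul, abs_of_pos (inv_pos.2 hH)]
      have := R.e_le (k + 1) hk r
      have := R.z_le (k + 1) hk r
      gcongr
    have h15 := mul_le_mul_of_nonneg_left ((neg_le_abs _).trans h3) (by positivity : 0 ≤ 2 * η)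
    linarith
  have h4 : (H (k + 1) r)⁻¹ * (d (k + 2) r - d (k + 1) r) ^ 2 ≤
      2 / g * (G (k + 2) r - G (k + 1) r) ^ 2 + 6 * Γ * (n (k + 2) r ^ 2 + n (k + 1) r ^ 2)
          + 12 * Γ * T * τ (k + 2) + 48 * Γ * T * τ (k + 1) := by
    -- The part of the change of direction that is neither gradient variation nor noise. Its first
    -- summand costs a second copy of `τ (k + 1)`.
    set u := (H (k + 1) r - H k r) * G (k + 1) r + e (k + 2) r - e (k + 1) r with hu
    have hdd : d (k + 2) r - d (k + 1) r = H (k + 1) r * (G (k + 2) r - G (k + 1) r) +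
        (n (k + 2) r - n (k + 1) r + u) := by
      rw [R.d_succ (k + 1) hk, R.d_succ k (by omega), hu]; ring
    have hu' : |u| ≤ τ (k + 2) + 2 * τ (k + 1) := by
      have a1 := R.e_le (k + 1) hk r
      have a2 := R.e_le k (by omega) r
      have a3 : |(H (k + 1) r - H k r) * G (k + 1) r| ≤ τ (k + 1) := by
        rw [abs_mul, abs_sub_comm, abs_of_nonneg (sub_nonneg.2 (R.H_anti k (by omega) r))]
        refine le_trans ?_ ((mul_comm _ _).trans_le (R.H_sub_le k (by omega) r))
        exact mul_le_mul_of_nonneg_left (R.G_le k (by omega) r)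
          (sub_nonneg.2 (R.H_anti k (by omega) r))
      rw [abs_le] at *
      constructor <;> linarith
    have h5 := weighted_sq_add_le (Δ := G (k + 2) r - G (k + 1) r)
      (w := n (k + 2) r - n (k + 1) r + u) hH (R.H_le (k + 1) hk.le r) hΓ'
    have h6 := sq_noise_add_le (a := n (k + 2) r) (b := n (k + 1) r) hu'
    have h7 : τ (k + 2) ^ 2 ≤ T * τ (k + 2) := by
      rw [sq]; exact mul_le_mul_of_nonneg_right (R.τ_le (k + 1) hk) hτ2
    have h8 : τ (k + 1) ^ 2 ≤ T * τ (k + 1) := by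
      rw [sq]; exact mul_le_mul_of_nonneg_right (R.τ_le k (by omega)) hτ1
    have h12 := mul_le_mul_of_nonneg_left h6 (by positivity : 0 ≤ 2 * Γ)
    have h13 := mul_le_mul_of_nonneg_left h7 (by positivity : 0 ≤ 12 * Γ)
    have h14 := mul_le_mul_of_nonneg_left h8 (by positivity : 0 ≤ 48 * Γ)
    rw [hdd]
    linarith
  have h9 : g * d (k + 1) r ^ 2 ≤ (H (k + 1) r)⁻¹ * d (k + 1) r ^ 2 := by
    have := R.le_inv_H hΓ hg hk.le r
    gcongr
  have h10 := mul_le_mul_of_nonneg_left h4 (sq_nonneg η)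
  have h11 := mul_le_mul_of_nonneg_left h9 (sq_nonneg η)
  linarith

/-- The Lyapunov function of the run. -/
noncomputable def lyapunov (g Γ η D : ℝ) (x d H : ℕ → ι → ℝ) (xs : ι → ℝ) (k : ℕ) : ℝ :=
  ∑ r, ((H (k + 1) r)⁻¹ * (x (k + 1) r - xs r) ^ 2
    - (D + 2 * η * (Γ / g)) ^ 2 * (H (k + 1) r)⁻¹) + η ^ 2 * (g / 18) * ∑ r, d k r ^ 2

/-- The Minty inequality discards the gradient term. The gradient variation costs at most `η² (g/36)
(8 ‖d (k + 1)‖² + 2 ‖d k‖²)` against the gain `η² g ‖d (k + 1)‖²`. The part with `d k` is paid by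
the summand `η² (g/18) ‖d k‖²` of the Lyapunov function. Renewing that summand at `k + 1` leaves `1
- 8/36 - 1/18 = 13/18` of the gain. -/
theorem lyapunov_step (R : OptimisticRun g Γ L η D T N x z d n e G H τ xs) (hg : 0 < g)
    (hΓ : g ≤ Γ) (hη : 0 < η) (hηL : 72 * L ^ 2 * Γ * η ^ 2 ≤ g ^ 3) {k : ℕ} (hk : k + 1 < N) :
    lyapunov g Γ η D x d H xs (k + 1) + η ^ 2 * g * (13 / 18) * ∑ r, d (k + 1) r ^ 2 ≤
      lyapunov g Γ η D x d H xs k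
        - 2 * η * ∑ r, n (k + 2) r * (z (k + 2) r - xs r) * (H (k + 1) r)⁻¹
        + 6 * Γ * η ^ 2 * (∑ r, n (k + 2) r ^ 2 + ∑ r, n (k + 1) r ^ 2)
        + Fintype.card ι * (2 * η * (Γ * D) + 12 * Γ * T * η ^ 2) * τ (k + 2)
        + Fintype.card ι * (48 * Γ * T * η ^ 2) * τ (k + 1) := by
  have hΓ0 : 0 < Γ := hg.trans_le hΓ
  have h1 := Finset.sum_le_sum fun r (_ : r ∈ Finset.univ) => R.coord_step hg hΓ0 hη hk r
  simp only [Finset.sum_add_distrib, Finset.sum_sub_distrib, ← Finset.mul_sum, mul_add,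
    Finset.sum_const, Finset.card_univ, nsmul_eq_mul] at h1
  have h2 := R.minty (k + 1) hk
  have h3 : ∑ r, (G (k + 2) r - G (k + 1) r) ^ 2 ≤
      L ^ 2 * η ^ 2 * (8 * ∑ r, d (k + 1) r ^ 2 + 2 * ∑ r, d k r ^ 2) := by
    refine (R.lipschitz k hk).trans ?_
    rw [mul_assoc]
    refine mul_le_mul_of_nonneg_left ?_ (sq_nonneg L)
    rw [Finset.mul_sum, Finset.mul_sum, ← Finset.sum_add_distrib, Finset.mul_sum]
    refine Finset.sum_le_sum fun r _ => ?_
    have : z (k + 2) r - z (k + 1) r = η * (d k r - 2 * d (k + 1) r) := by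
      rw [R.z_succ (k + 1), R.z_succ k, R.x_succ k]; ring
    rw [this, mul_pow]
    refine mul_le_mul_of_nonneg_left ?_ (sq_nonneg η)
    nlinarith [sq_nonneg (d k r + 2 * d (k + 1) r)]
  -- This is where the constant `72` of the step size condition enters; `g ≤ Γ` reduces that
  -- condition to `72 L² η² ≤ g²`.
  have h4 : 2 / g * (L ^ 2 * η ^ 2) ≤ g / 36 := by
    have : L ^ 2 * η ^ 2 * 72 ≤ g ^ 2 := by
      by_contra! hc
      have := mul_lt_mul_of_pos_right hc hΓ0
      nlinarith [sq_nonneg g]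
    rw [div_mul_eq_mul_div, div_le_iff₀ hg]
    nlinarith
  have hX1 : 0 ≤ ∑ r, d (k + 1) r ^ 2 := by positivity
  have hX0 : 0 ≤ ∑ r, d k r ^ 2 := by positivity
  have h5 : 2 / g * ∑ r, (G (k + 2) r - G (k + 1) r) ^ 2 ≤
      g / 36 * (8 * ∑ r, d (k + 1) r ^ 2 + 2 * ∑ r, d k r ^ 2) := by
    refine (mul_le_mul_of_nonneg_left h3 (by positivity)).trans ?_
    rw [← mul_assoc]
    exact mul_le_mul_of_nonneg_right h4 (by positivity)
  have h6 := mul_le_mul_of_nonneg_left h5 (sq_nonneg η)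
  have h7 : 0 ≤ 2 * η * ∑ r, (z (k + 2) r - xs r) * G (k + 2) r := by positivity
  simp only [lyapunov, Finset.sum_sub_distrib, ← Finset.mul_sum]
  linarith

theorem sum_sq_d_le (R : OptimisticRun g Γ L η D T N x z d n e G H τ xs) (hg : 0 < g)
    (hΓ : g ≤ Γ) (hη : 0 < η) (hηL : 72 * L ^ 2 * Γ * η ^ 2 ≤ g ^ 3) {m : ℕ} (hm : m < N) :
    lyapunov g Γ η D x d H xs m
        + η ^ 2 * g * (13 / 18) * ∑ k ∈ Finset.range m, ∑ r, d (k + 1) r ^ 2 ≤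
      lyapunov g Γ η D x d H xs 0
        - 2 * η * ∑ k ∈ Finset.range m, ∑ r, n (k + 2) r * (z (k + 2) r - xs r) * (H (k + 1) r)⁻¹
        + 6 * Γ * η ^ 2 * (∑ k ∈ Finset.range m, ∑ r, n (k + 2) r ^ 2 +
          ∑ k ∈ Finset.range m, ∑ r, n (k + 1) r ^ 2)
        + Fintype.card ι * (2 * η * (Γ * D) + 12 * Γ * T * η ^ 2) *
          ∑ k ∈ Finset.range m, τ (k + 2)
        + Fintype.card ι * (48 * Γ * T * η ^ 2) * ∑ k ∈ Finset.range m, τ (k + 1) := by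
  induction m with
  | zero => simp
  | succ m ih =>
    have h1 := R.lyapunov_step hg hΓ hη hηL hm
    have h2 := ih (by omega)
    simp only [Finset.sum_range_succ, mul_add] at *
    linarith

/-- The initial value is nonpositive because `d 0 = 0` and each squared distance is at most its
correction. Later values are bounded below by the correction alone, as `H⁻¹ ≤ Γ`. -/
theorem lyapunov_zero_sub_le (R : OptimisticRun g Γ L η D T N x z d n e G H τ xs) (hg : 0 < g)
    (hΓ : g ≤ Γ) (hη : 0 < η) {m : ℕ} (hm : m < N) :
    lyapunov g Γ η D x d H xs 0 - lyapunov g Γ η D x d H xs m ≤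
      Fintype.card ι * ((D + 2 * η * (Γ / g)) ^ 2 * Γ) := by
  have hΓ0 : 0 < Γ := hg.trans_le hΓ
  have h1 : lyapunov g Γ η D x d H xs 0 ≤ 0 := by
    simp only [lyapunov, R.d_zero, zero_add]
    have : ∑ r, ((H 1 r)⁻¹ * (x 1 r - xs r) ^ 2
        - (D + 2 * η * (Γ / g)) ^ 2 * (H 1 r)⁻¹) ≤ 0 := by
      refine Finset.sum_nonpos fun r _ => ?_
      have hx := R.abs_x_sub_le hη (by omega : 0 < N) r
      have hx2 : (x 1 r - xs r) ^ 2 ≤ (D + 2 * η * (Γ / g)) ^ 2 := by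
        rw [← sq_abs]; gcongr
      have := inv_pos.2 (R.H_pos hΓ0 (by omega : 1 ≤ N) r)
      nlinarith
    simpa using this
  have h2 : -(Fintype.card ι * ((D + 2 * η * (Γ / g)) ^ 2 * Γ)) ≤ lyapunov g Γ η D x d H xs m := by
    have h3 : 0 ≤ η ^ 2 * (g / 18) * ∑ r, d m r ^ 2 := by positivity
    have h4 : ∑ r : ι, -((D + 2 * η * (Γ / g)) ^ 2 * Γ) ≤
        ∑ r, ((H (m + 1) r)⁻¹ * (x (m + 1) r - xs r) ^ 2
        - (D + 2 * η * (Γ / g)) ^ 2 * (H (m + 1) r)⁻¹) := by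
      refine Finset.sum_le_sum fun r _ => ?_
      have a := inv_pos.2 (R.H_pos hΓ0 (Nat.succ_le_of_lt hm) r)
      have b := R.inv_H_le hΓ0 (Nat.succ_le_of_lt hm) r
      have c : 0 ≤ (H (m + 1) r)⁻¹ * (x (m + 1) r - xs r) ^ 2 := by positivity
      nlinarith [sq_nonneg (D + 2 * η * (Γ / g))]
    rw [Finset.sum_neg_distrib, Finset.sum_const, Finset.card_univ, nsmul_eq_mul] at h4
    simp only [lyapunov]
    linarith
  linarith

/-- Solve the decomposition of the direction for the gradient: `G = H⁻¹ (d - n - e)` with `H⁻¹ ≤ Γ`.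
-/
theorem sq_G_le (R : OptimisticRun g Γ L η D T N x z d n e G H τ xs) (hΓ : 0 < Γ) {k : ℕ}
    (hk : k < N) (r : ι) :
    G (k + 1) r ^ 2 ≤ 3 * Γ ^ 2 * (d (k + 1) r ^ 2 + n (k + 1) r ^ 2 + T * τ (k + 1)) := by
  have hH := R.H_pos hΓ hk.le r
  have hG : G (k + 1) r = (H k r)⁻¹ * (d (k + 1) r - n (k + 1) r - e (k + 1) r) := by
    rw [R.d_succ k hk]; field_simp; ring
  have h1 : (H k r)⁻¹ ^ 2 ≤ Γ ^ 2 := by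
    have := R.inv_H_le hΓ hk.le r
    gcongr
  have h2 : e (k + 1) r ^ 2 ≤ T * τ (k + 1) := by
    rw [← sq_abs]
    nlinarith [R.e_le k hk r, R.τ_le k hk, abs_nonneg (e (k + 1) r)]
  have h3 : (d (k + 1) r - n (k + 1) r - e (k + 1) r) ^ 2 ≤
      3 * (d (k + 1) r ^ 2 + n (k + 1) r ^ 2 + T * τ (k + 1)) := by
    nlinarith [sq_nonneg (d (k + 1) r + n (k + 1) r), sq_nonneg (d (k + 1) r + e (k + 1) r),
      sq_nonneg (n (k + 1) r - e (k + 1) r)]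
  rw [hG, mul_pow]
  calc _ ≤ Γ ^ 2 * (3 * (d (k + 1) r ^ 2 + n (k + 1) r ^ 2 + T * τ (k + 1))) := by gcongr
    _ = _ := by ring

end OptimisticRun

/-- Bound for the sum of the squared gradients along an optimistic run. -/
theorem exists_sum_sq_gradient_le (ι : Type*) [Fintype ι] (g Γ L η D T : ℝ) (hg : 0 < g)
    (hΓ : g ≤ Γ) (hη : 0 < η) (hηL : 72 * L ^ 2 * Γ * η ^ 2 ≤ g ^ 3) (hD : 0 ≤ D) (hT : 0 ≤ T) :
    ∃ K K' : ℝ, 0 ≤ K ∧ ∀ (m : ℕ) (x z d n e G H : ℕ → ι → ℝ) (τ : ℕ → ℝ) (xs : ι → ℝ),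
      OptimisticRun g Γ L η D T (m + 1) x z d n e G H τ xs →
      ∑ k ∈ Finset.range (m + 1), ∑ r, G (k + 1) r ^ 2 ≤
        K + K * ∑ k ∈ Finset.range (m + 1), τ (k + 1)
        + K * ∑ k ∈ Finset.range (m + 1), ∑ r, n (k + 1) r ^ 2
        + K' * ∑ k ∈ Finset.range m, ∑ r,
          n (k + 2) r * ((z (k + 2) r - xs r) * (H (k + 1) r)⁻¹) := by
  have hΓ0 : 0 < Γ := hg.trans_le hΓ
  set q : ℝ := 3 * Γ ^ 2 * (18 / (13 * η ^ 2 * g)) with hq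
  have hq0 : 0 < q := by positivity
  set c : ℝ := (Fintype.card ι : ℝ) with hc
  have hc0 : 0 ≤ c := by positivity
  set K₀ := c * Γ ^ 2 + q * (c * ((D + 2 * η * (Γ / g)) ^ 2 * Γ)) with hK₀
  set K₁ := q * (c * (2 * η * (Γ * D) + 60 * Γ * T * η ^ 2)) + 3 * Γ ^ 2 * c * T with hK₁
  set K₂ := q * (12 * Γ * η ^ 2) + 3 * Γ ^ 2 with hK₂
  have h0 : 0 ≤ K₀ := by positivity
  have h1 : 0 ≤ K₁ := by positivity
  have h2 : 0 ≤ K₂ := by positivity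
  -- The coefficient of the linear noise term may have any sign, since that term has mean zero in
  -- the application.
  refine ⟨K₀ + K₁ + K₂, -(q * (2 * η)), by positivity, ?_⟩
  intro m x z d n e G H τ xs R
  set S := ∑ k ∈ Finset.range (m + 1), τ (k + 1) with hS
  set V := ∑ k ∈ Finset.range (m + 1), ∑ r, n (k + 1) r ^ 2 with hV
  set Y := ∑ k ∈ Finset.range m, ∑ r, n (k + 2) r * ((z (k + 2) r - xs r) * (H (k + 1) r)⁻¹) with hY
  set X := ∑ k ∈ Finset.range m, ∑ r, d (k + 1) r ^ 2 with hX
  have hτ : ∀ k ∈ Finset.range (m + 1), 0 ≤ τ (k + 1) := fun k hk =>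
    R.τ_nonneg k (Finset.mem_range.1 hk)
  have hS0 : 0 ≤ S := Finset.sum_nonneg hτ
  have hV0 : 0 ≤ V := by positivity
  have hV1 : ∑ k ∈ Finset.range m, ∑ r, n (k + 1) r ^ 2 ≤ V := by
    rw [hV, Finset.sum_range_succ]
    exact le_add_of_nonneg_right (by positivity)
  have hV2 : ∑ k ∈ Finset.range m, ∑ r, n (k + 2) r ^ 2 ≤ V := by
    rw [hV, Finset.sum_range_succ']
    exact le_add_of_nonneg_right (by positivity)
  have hS1 : ∑ k ∈ Finset.range m, τ (k + 1) ≤ S := by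
    rw [hS, Finset.sum_range_succ]
    exact le_add_of_nonneg_right (hτ m (by simp))
  have hS2 : ∑ k ∈ Finset.range m, τ (k + 2) ≤ S := by
    rw [hS, Finset.sum_range_succ']
    exact le_add_of_nonneg_right (hτ 0 (by simp))
  have hd := R.sum_sq_d_le hg hΓ hη hηL (Nat.lt_succ_self m)
  have hl := R.lyapunov_zero_sub_le hg hΓ hη (Nat.lt_succ_self m)
  have hXb : X ≤ 18 / (13 * η ^ 2 * g) * (c * ((D + 2 * η * (Γ / g)) ^ 2 * Γ) - 2 * η * Y +
      12 * Γ * η ^ 2 * V + c * (2 * η * (Γ * D) + 60 * Γ * T * η ^ 2) * S) := by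
    rw [div_mul_eq_mul_div, le_div_iff₀ (by positivity)]
    simp only [mul_assoc (n _ _), ← hc, ← hX, ← hY] at hd hl
    have a1 := mul_le_mul_of_nonneg_left hS2
      (by positivity : 0 ≤ c * (2 * η * (Γ * D) + 12 * Γ * T * η ^ 2))
    have a2 := mul_le_mul_of_nonneg_left hS1 (by positivity : 0 ≤ c * (48 * Γ * T * η ^ 2))
    have a3 := mul_le_mul_of_nonneg_left (add_le_add hV2 hV1)
      (by positivity : 0 ≤ 6 * Γ * η ^ 2)
    linarith
  -- The Lyapunov steps gain only `d 1, …, d m`; the last gradient is bounded trivially.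
  have hGl : ∑ r, G (m + 1) r ^ 2 ≤ c * Γ ^ 2 := by
    refine (Finset.sum_le_card_nsmul _ _ (Γ ^ 2) fun r _ => ?_).trans (by simp [hc])
    rw [← sq_abs]
    have := R.G_le m (Nat.lt_succ_self m) r
    gcongr
  have hGs : ∑ k ∈ Finset.range m, ∑ r, G (k + 1) r ^ 2 ≤ 3 * Γ ^ 2 * (X + V + c * T * S) := by
    have a : ∑ k ∈ Finset.range m, ∑ r, G (k + 1) r ^ 2 ≤ ∑ k ∈ Finset.range m, ∑ r,
        3 * Γ ^ 2 * (d (k + 1) r ^ 2 + n (k + 1) r ^ 2 + T * τ (k + 1)) :=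
      Finset.sum_le_sum fun k hk => Finset.sum_le_sum fun r _ =>
        R.sq_G_le hΓ0 (by have := Finset.mem_range.1 hk; omega) r
    simp only [← Finset.mul_sum, Finset.sum_add_distrib, Finset.sum_const, Finset.card_univ,
      nsmul_eq_mul, ← hc, ← hX] at a
    refine a.trans (mul_le_mul_of_nonneg_left ?_ (by positivity))
    have := mul_le_mul_of_nonneg_left hS1 (by positivity : 0 ≤ c * T)
    linarith
  rw [Finset.sum_range_succ]
  have hXq : 3 * Γ ^ 2 * X ≤ q * (c * ((D + 2 * η * (Γ / g)) ^ 2 * Γ) - 2 * η * Y +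
      12 * Γ * η ^ 2 * V + c * (2 * η * (Γ * D) + 60 * Γ * T * η ^ 2) * S) := by
    rw [hq, mul_assoc (3 * Γ ^ 2)]
    exact mul_le_mul_of_nonneg_left hXb (by positivity)
  have b1 : K₁ * S ≤ (K₀ + K₁ + K₂) * S := by gcongr; linarith
  have b2 : K₂ * V ≤ (K₀ + K₁ + K₂) * V := by gcongr; linarith
  have b3 : K₀ + K₁ * S + K₂ * V - q * (2 * η) * Y = c * Γ ^ 2 +
      q * (c * ((D + 2 * η * (Γ / g)) ^ 2 * Γ) - 2 * η * Y +
      12 * Γ * η ^ 2 * V + c * (2 * η * (Γ * D) + 60 * Γ * T * η ^ 2) * S) +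
      3 * Γ ^ 2 * (V + c * T * S) := by
    rw [hK₀, hK₁, hK₂]; ring
  linarith

end Pathwise

/-! ### Deterministic bounds for the states, consensus, and reduction to the node averages. -/

section StateBounds

/-- The recursions of DADAM³ for the states `S k` with the gradient estimates `ĝ k i`. -/
structure DadamRecursion {p₁ p₂ M : ℕ} (W : Matrix (Fin M) (Fin M) ℝ) (t : ℕ) (η : ℝ)
    (β₁ : ℕ → ℝ) (β₂ β₃ : ℝ) (S : ℕ → DadamState p₁ p₂ M)
    (ĝ : ℕ → Fin M → JointSpace p₁ p₂) : Prop where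
  x_zero : (S 0).x = 0
  d_zero : (S 0).d = 0
  mom_zero : (S 0).mom = 0
  v_zero : (S 0).v = 0
  z_succ : ∀ k, (S (k + 1)).z = mixNodes W t fun i => (S k).x i - η • (S k).d i
  x_succ : ∀ k, (S (k + 1)).x = mixNodes W t fun i => (S k).x i - η • (S (k + 1)).d i
  mom_succ : ∀ k i r, (S (k + 1)).mom i r =
    β₁ (k + 1) * (S k).mom i r + (1 - β₁ (k + 1)) * ĝ (k + 1) i r
  v_succ : ∀ k i r, (S (k + 1)).v i r =
    β₂ * (S k).v i r + (1 - β₂) * (ĝ (k + 1) i r * ĝ (k + 1) i r)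
  vt_succ : ∀ k i r, (S (k + 1)).vt i r =
    β₃ * (S k).vt i r + (1 - β₃) * max ((S k).vt i r) ((S (k + 1)).v i r)
  d_succ : ∀ k i r, (S (k + 1)).d i r = (√((S (k + 1)).vt i r))⁻¹ * (S (k + 1)).mom i r

theorem dadamRecursion_dadam {p₁ p₂ M : ℕ} {Ξ : Type*} (f : JointSpace p₁ p₂ → Ξ → ℝ)
    (W : Matrix (Fin M) (Fin M) ℝ) (t : ℕ) (η : ℝ) (β₁ : ℕ → ℝ) (β₂ β₃ : ℝ)
    (vt₀ : Fin M → JointSpace p₁ p₂) (m : ℕ → ℕ) (s : ℕ → Fin M → ℕ → Ξ) :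
    DadamRecursion W t η β₁ β₂ β₃ (dadam f W t η β₁ β₂ β₃ vt₀ m s) fun k i =>
      batchGrad f (m k) (s k i) ((dadam f W t η β₁ β₂ β₃ vt₀ m s k).z i) where
  x_zero := rfl
  d_zero := rfl
  mom_zero := rfl
  v_zero := rfl
  z_succ _ := rfl
  x_succ _ := rfl
  mom_succ _ _ _ := rfl
  v_succ _ _ _ := rfl
  vt_succ _ _ _ := rfl
  d_succ _ _ _ := rfl

theorem abs_convex_comb_le {b x y c : ℝ} (hb0 : 0 ≤ b) (hb1 : b ≤ 1) (hx : |x| ≤ c)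
    (hy : |y| ≤ c) : |b * x + (1 - b) * y| ≤ c := by
  refine (abs_add_le _ _).trans ?_
  rw [abs_mul, abs_mul, abs_of_nonneg hb0, abs_of_nonneg (sub_nonneg.2 hb1)]
  nlinarith

/-- The inverse square roots of `ṽ`, averaged over the nodes. -/
noncomputable def avgPrecond {p₁ p₂ M : ℕ} (S : ℕ → DadamState p₁ p₂ M) (k : ℕ)
    (r : Fin p₁ ⊕ Fin p₂) : ℝ :=
  (M : ℝ)⁻¹ * ∑ i, (√((S k).vt i r))⁻¹

/-- The preconditioned noise of the gradient estimates, averaged over the nodes. -/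
noncomputable def avgNoise {p₁ p₂ M : ℕ} (Φ : JointSpace p₁ p₂ → JointSpace p₁ p₂)
    (S : ℕ → DadamState p₁ p₂ M) (ĝ : ℕ → Fin M → JointSpace p₁ p₂) (k : ℕ)
    (r : Fin p₁ ⊕ Fin p₂) : ℝ :=
  (M : ℝ)⁻¹ * ∑ i, (√((S (k - 1)).vt i r))⁻¹ * (ĝ k i r - Φ ((S k).z i) r)

/-- A bound for the part of the averaged direction that is neither gradient nor noise. -/
noncomputable def errorBound {p₁ p₂ M : ℕ} (g Γ L δ : ℝ) (β₁ : ℕ → ℝ)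
    (S : ℕ → DadamState p₁ p₂ M) (k : ℕ) : ℝ :=
  Γ * ∑ r, (avgPrecond S (k - 1) r - avgPrecond S k r) + 2 * β₁ k * Γ / g + L * δ / g

theorem avg_le_of_le {M : ℕ} (hM : 1 ≤ M) {a : Fin M → ℝ} {c : ℝ} (h : ∀ i, a i ≤ c) :
    (M : ℝ)⁻¹ * ∑ i, a i ≤ c := by
  have hM0 : (0 : ℝ) < M := by exact_mod_cast hM
  rw [inv_mul_le_iff₀ hM0]
  refine (Finset.sum_le_sum fun i _ => h i).trans ?_
  simp

theorem le_avg_of_le {M : ℕ} (hM : 1 ≤ M) {a : Fin M → ℝ} {c : ℝ} (h : ∀ i, c ≤ a i) :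
    c ≤ (M : ℝ)⁻¹ * ∑ i, a i := by
  have := avg_le_of_le hM (a := fun i => -a i) (c := -c) fun i => neg_le_neg (h i)
  rw [Finset.sum_neg_distrib] at this
  linarith

theorem abs_avg_le_avg_abs {M : ℕ} (a : Fin M → ℝ) :
    |(M : ℝ)⁻¹ * ∑ i, a i| ≤ (M : ℝ)⁻¹ * ∑ i, |a i| := by
  rw [abs_mul, abs_of_nonneg (by positivity : (0 : ℝ) ≤ (M : ℝ)⁻¹)]
  exact mul_le_mul_of_nonneg_left (Finset.abs_sum_le_sum_abs _ _) (by positivity)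

namespace DadamRecursion

variable {p₁ p₂ M : ℕ} {W : Matrix (Fin M) (Fin M) ℝ} {t : ℕ} {η : ℝ}
    {β₁ : ℕ → ℝ} {β₂ β₃ : ℝ} {S : ℕ → DadamState p₁ p₂ M}
    {ĝ : ℕ → Fin M → JointSpace p₁ p₂} {g Γ : ℝ} {N : ℕ}

/-- The new `ṽ` is a convex combination of the old one with something no smaller. Hence the
preconditioners decrease, and their changes telescope. -/
theorem vt_mono_succ (R : DadamRecursion W t η β₁ β₂ β₃ S ĝ) (h3 : β₃ ∈ Set.Ico (0 : ℝ) 1)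
    (k : ℕ) (i : Fin M) (r : Fin p₁ ⊕ Fin p₂) : (S k).vt i r ≤ (S (k + 1)).vt i r := by
  rw [R.vt_succ]
  nlinarith [le_max_left ((S k).vt i r) ((S (k + 1)).v i r), h3.1, h3.2]

theorem le_vt (R : DadamRecursion W t η β₁ β₂ β₃ S ĝ) (h3 : β₃ ∈ Set.Ico (0 : ℝ) 1)
    (h0 : ∀ i r, g ^ 2 ≤ (S 0).vt i r) (k : ℕ) (i : Fin M) (r : Fin p₁ ⊕ Fin p₂) :
    g ^ 2 ≤ (S k).vt i r := by
  induction k with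
  | zero => exact h0 i r
  | succ k ih => exact ih.trans (R.vt_mono_succ h3 k i r)

theorem le_sqrt_vt (R : DadamRecursion W t η β₁ β₂ β₃ S ĝ) (h3 : β₃ ∈ Set.Ico (0 : ℝ) 1)
    (h0 : ∀ i r, g ^ 2 ≤ (S 0).vt i r) (k : ℕ) (i : Fin M) (r : Fin p₁ ⊕ Fin p₂) :
    g ≤ √((S k).vt i r) := Real.le_sqrt_of_sq_le (R.le_vt h3 h0 k i r)

theorem inv_sqrt_vt_le (R : DadamRecursion W t η β₁ β₂ β₃ S ĝ) (h3 : β₃ ∈ Set.Ico (0 : ℝ) 1)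
    (hg : 0 < g) (h0 : ∀ i r, g ^ 2 ≤ (S 0).vt i r) (k : ℕ) (i : Fin M) (r : Fin p₁ ⊕ Fin p₂) :
    (√((S k).vt i r))⁻¹ ≤ 1 / g := by
  rw [one_div]; exact inv_anti₀ hg (R.le_sqrt_vt h3 h0 k i r)

theorem inv_sqrt_vt_anti (R : DadamRecursion W t η β₁ β₂ β₃ S ĝ) (h3 : β₃ ∈ Set.Ico (0 : ℝ) 1)
    (hg : 0 < g) (h0 : ∀ i r, g ^ 2 ≤ (S 0).vt i r) (k : ℕ) (i : Fin M) (r : Fin p₁ ⊕ Fin p₂) :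
    (√((S (k + 1)).vt i r))⁻¹ ≤ (√((S k).vt i r))⁻¹ :=
  inv_anti₀ (hg.trans_le (R.le_sqrt_vt h3 h0 k i r)) (Real.sqrt_le_sqrt (R.vt_mono_succ h3 k i r))

theorem abs_mom_le (R : DadamRecursion W t η β₁ β₂ β₃ S ĝ) (hΓ : 0 ≤ Γ)
    (h1 : ∀ k, β₁ k ∈ Set.Icc (0 : ℝ) 1) (hĝ : ∀ k < N, ∀ i r, |ĝ (k + 1) i r| ≤ Γ)
    {k : ℕ} (hk : k ≤ N) (i : Fin M) (r : Fin p₁ ⊕ Fin p₂) : |(S k).mom i r| ≤ Γ := by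
  induction k with
  | zero => simpa [R.mom_zero] using hΓ
  | succ k ih =>
    rw [R.mom_succ]
    exact abs_convex_comb_le (h1 _).1 (h1 _).2 (ih (by omega)) (hĝ k hk i r)

theorem abs_v_le (R : DadamRecursion W t η β₁ β₂ β₃ S ĝ)
    (h2 : β₂ ∈ Set.Ico (0 : ℝ) 1) (hĝ : ∀ k < N, ∀ i r, |ĝ (k + 1) i r| ≤ Γ)
    {k : ℕ} (hk : k ≤ N) (i : Fin M) (r : Fin p₁ ⊕ Fin p₂) : |(S k).v i r| ≤ Γ ^ 2 := by
  induction k with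
  | zero => simpa [R.v_zero] using sq_nonneg Γ
  | succ k ih =>
    rw [R.v_succ]
    refine abs_convex_comb_le h2.1 h2.2.le (ih (by omega)) ?_
    rw [← sq, abs_pow]
    have := hĝ k hk i r
    gcongr

theorem vt_le (R : DadamRecursion W t η β₁ β₂ β₃ S ĝ) (h2 : β₂ ∈ Set.Ico (0 : ℝ) 1)
    (h3 : β₃ ∈ Set.Ico (0 : ℝ) 1) (h0 : ∀ i r, (S 0).vt i r ≤ Γ ^ 2)
    (hĝ : ∀ k < N, ∀ i r, |ĝ (k + 1) i r| ≤ Γ)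
    {k : ℕ} (hk : k ≤ N) (i : Fin M) (r : Fin p₁ ⊕ Fin p₂) : (S k).vt i r ≤ Γ ^ 2 := by
  induction k with
  | zero => exact h0 i r
  | succ k ih =>
    rw [R.vt_succ]
    have h4 := max_le (ih (by omega)) ((le_abs_self _).trans (R.abs_v_le h2 hĝ hk i r))
    nlinarith [h3.1, h3.2, ih (by omega)]

theorem le_inv_sqrt_vt (R : DadamRecursion W t η β₁ β₂ β₃ S ĝ) (h2 : β₂ ∈ Set.Ico (0 : ℝ) 1)
    (h3 : β₃ ∈ Set.Ico (0 : ℝ) 1) (hg : 0 < g) (hΓ : 0 < Γ)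
    (h0 : ∀ i r, g ^ 2 ≤ (S 0).vt i r ∧ (S 0).vt i r ≤ Γ ^ 2)
    (hĝ : ∀ k < N, ∀ i r, |ĝ (k + 1) i r| ≤ Γ)
    {k : ℕ} (hk : k ≤ N) (i : Fin M) (r : Fin p₁ ⊕ Fin p₂) :
    1 / Γ ≤ (√((S k).vt i r))⁻¹ := by
  rw [one_div]
  refine inv_anti₀ (hg.trans_le (R.le_sqrt_vt h3 (fun i r => (h0 i r).1) k i r)) ?_
  exact Real.sqrt_le_iff.2 ⟨hΓ.le, R.vt_le h2 h3 (fun i r => (h0 i r).2) hĝ hk i r⟩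

theorem abs_d_le (R : DadamRecursion W t η β₁ β₂ β₃ S ĝ) (h3 : β₃ ∈ Set.Ico (0 : ℝ) 1)
    (hg : 0 < g) (hΓ : 0 < Γ) (h0 : ∀ i r, g ^ 2 ≤ (S 0).vt i r)
    (h1 : ∀ k, β₁ k ∈ Set.Icc (0 : ℝ) 1) (hĝ : ∀ k < N, ∀ i r, |ĝ (k + 1) i r| ≤ Γ)
    {k : ℕ} (hk : k ≤ N) (i : Fin M) (r : Fin p₁ ⊕ Fin p₂) : |(S k).d i r| ≤ Γ / g := by
  cases k with
  | zero => simp only [R.d_zero]; simpa using (by positivity : 0 ≤ Γ / g)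
  | succ k =>
    rw [R.d_succ, abs_mul, abs_of_nonneg (by positivity : 0 ≤ (√((S (k + 1)).vt i r))⁻¹)]
    calc _ ≤ 1 / g * Γ := by
          have := R.inv_sqrt_vt_le h3 hg h0 (k + 1) i r
          have := R.abs_mom_le hΓ.le h1 hĝ hk i r
          gcongr
      _ = Γ / g := by ring

/-- The spread of the directions over the nodes. -/
theorem spread_d_le (R : DadamRecursion W t η β₁ β₂ β₃ S ĝ) (h3 : β₃ ∈ Set.Ico (0 : ℝ) 1)
    (hg : 0 < g) (hΓ : 0 < Γ) (h0 : ∀ i r, g ^ 2 ≤ (S 0).vt i r)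
    (h1 : ∀ k, β₁ k ∈ Set.Icc (0 : ℝ) 1) (hĝ : ∀ k < N, ∀ i r, |ĝ (k + 1) i r| ≤ Γ)
    {k : ℕ} (hk : k ≤ N) :
    spread (S k).d ≤ √(M * (p₁ + p₂ : ℕ)) * (Γ / g) := by
  refine le_of_sq_le_sq ((spread_sq_le _).trans ?_) (by positivity)
  rw [mul_pow, Real.sq_sqrt (by positivity)]
  have h : ∀ i, ‖(S k).d i‖ ^ 2 ≤ (p₁ + p₂ : ℕ) * (Γ / g) ^ 2 := by
    intro i
    rw [EuclideanSpace.real_norm_sq_eq]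
    refine (Finset.sum_le_card_nsmul _ _ ((Γ / g) ^ 2) fun r _ => ?_).trans (by simp)
    rw [← sq_abs]
    have := R.abs_d_le h3 hg hΓ h0 h1 hĝ hk i r
    gcongr
  refine (Finset.sum_le_card_nsmul _ _ _ fun i _ => h i).trans (by simp [mul_assoc])

/-- One mixing step sends a spread `s` to at most `(s + ηκ) / (1 + C)`, where `κ` bounds the spread
of the directions. The value `ηκ / C` is the fixed point of this map, so it persists from the
initial spread `0`. -/
theorem spread_le (R : DadamRecursion W t η β₁ β₂ β₃ S ĝ) (h3 : β₃ ∈ Set.Ico (0 : ℝ) 1)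
    (hη : 0 < η) (hg : 0 < g) (hΓ : 0 < Γ) (h0 : ∀ i r, g ^ 2 ≤ (S 0).vt i r)
    (h1 : ∀ k, β₁ k ∈ Set.Icc (0 : ℝ) 1) (hĝ : ∀ k < N, ∀ i r, |ĝ (k + 1) i r| ≤ Γ)
    (hW : W.IsHermitian) (hd : W ∈ doublyStochastic ℝ (Fin M)) (hρ : mixingRate W hW < 1)
    {C : ℝ} (hC : 0 < C) (hρC : mixingRate W hW ^ t ≤ 1 / (1 + C)) {k : ℕ} (hk : k ≤ N) :
    spread (S k).x ≤ η * (√(M * (p₁ + p₂ : ℕ)) * (Γ / g)) / C ∧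
      (k + 1 ≤ N → spread (S (k + 1)).z ≤ η * (√(M * (p₁ + p₂ : ℕ)) * (Γ / g)) / C) := by
  set κ := √(M * (p₁ + p₂ : ℕ)) * (Γ / g) with hκ
  have hκ0 : 0 ≤ κ := by positivity
  have key : ∀ X Y : Fin M → JointSpace p₁ p₂, spread X ≤ η * κ / C → spread Y ≤ κ →
      spread (mixNodes W t fun i => X i - η • Y i) ≤ η * κ / C := by
    intro X Y hX hY
    refine (spread_mixNodes_le hW hd hρ t _).trans ?_
    have h4 : spread (fun i => X i - η • Y i) ≤ η * κ / C + η * κ := by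
      refine (spread_sub_smul_le X Y η).trans ?_
      rw [abs_of_pos hη]
      gcongr
    calc _ ≤ 1 / (1 + C) * (η * κ / C + η * κ) := by
          have : 0 ≤ spread (fun i => X i - η • Y i) := Real.sqrt_nonneg _
          gcongr
      _ = η * κ / C := by field_simp
  have hx : spread (S k).x ≤ η * κ / C := by
    induction k with
    | zero =>
      have : spread (0 : Fin M → JointSpace p₁ p₂) = 0 := by simp [spread, nodeAvg]
      rw [R.x_zero, this]; positivity
    | succ k ih =>
      rw [R.x_succ]
      exact key _ _ (ih (by omega)) (R.spread_d_le h3 hg hΓ h0 h1 hĝ hk)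
  refine ⟨hx, fun _ => ?_⟩
  rw [R.z_succ]
  exact key _ _ hx (R.spread_d_le h3 hg hΓ h0 h1 hĝ hk)

/-- The preconditioner part telescopes; only the consensus part grows with `N`. -/
theorem sum_errorBound (L δ : ℝ) (N : ℕ) :
    ∑ k ∈ Finset.range N, errorBound g Γ L δ β₁ S (k + 1) =
      Γ * ∑ r, (avgPrecond S 0 r - avgPrecond S N r)
        + 2 * Γ / g * ∑ k ∈ Finset.range N, β₁ (k + 1) + N * (L * δ / g) := by
  simp only [errorBound, Nat.add_sub_cancel, Finset.sum_add_distrib, ← Finset.mul_sum,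
    Finset.sum_const, Finset.card_range, nsmul_eq_mul]
  rw [Finset.sum_comm]
  congr 2
  · congr 1
    exact Finset.sum_congr rfl fun r _ => Finset.sum_range_sub' (fun k => avgPrecond S k r) N
  · rw [Finset.mul_sum]
    exact Finset.sum_congr rfl fun k _ => by ring

/-- The averages over the nodes form a run of the optimistic gradient method. -/
theorem optimisticRun (R : DadamRecursion W t η β₁ β₂ β₃ S ĝ) (h1 : ∀ k, β₁ k ∈ Set.Icc (0 : ℝ) 1)
    (h2 : β₂ ∈ Set.Ico (0 : ℝ) 1) (h3 : β₃ ∈ Set.Ico (0 : ℝ) 1)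
    (hM : 1 ≤ M) (hg : 0 < g) (hΓ : 0 < Γ)
    (h0 : ∀ i r, g ^ 2 ≤ (S 0).vt i r ∧ (S 0).vt i r ≤ Γ ^ 2)
    (hĝ : ∀ k < N, ∀ i r, |ĝ (k + 1) i r| ≤ Γ) (hW : W.IsHermitian)
    (hd : W ∈ doublyStochastic ℝ (Fin M))
    {L D δ : ℝ} (hL : 0 ≤ L) (hδ : 0 ≤ δ) (hδ1 : δ ≤ 1)
    (hsp : ∀ k < N, spread (S (k + 1)).z ≤ δ)
    {Φ : JointSpace p₁ p₂ → JointSpace p₁ p₂} (hΦL : ∀ x y, ‖Φ x - Φ y‖ ≤ L * ‖x - y‖)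
    (hΦ : ∀ x r, |Φ x r| ≤ Γ) {xs : JointSpace p₁ p₂} (hxs : ‖xs‖ ≤ D / 2)
    (hm : ∀ x, 0 ≤ inner ℝ (x - xs) (Φ x)) (hz : ∀ k < N, ∀ i, ‖(S (k + 1)).z i‖ ≤ D / 2) :
    OptimisticRun g Γ L η D ((p₁ + p₂ : ℕ) * (Γ / g) + 2 * Γ / g + L / g) N
      (fun k r => nodeAvg (S k).x r) (fun k r => nodeAvg (S k).z r) (fun k r => nodeAvg (S k).d r)
      (avgNoise Φ S ĝ)
      (fun k r => nodeAvg (S k).d r - avgPrecond S (k - 1) r * Φ (nodeAvg (S k).z) r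
        - avgNoise Φ S ĝ k r)
      (fun k r => Φ (nodeAvg (S k).z) r) (avgPrecond S) (errorBound g Γ L δ β₁ S)
      (fun r => xs r) := by
  have hM0 : (M : ℝ) ≠ 0 := by positivity
  have h0l : ∀ i r, g ^ 2 ≤ (S 0).vt i r := fun i r => (h0 i r).1
  have havg_sub : ∀ (X Y : Fin M → JointSpace p₁ p₂) r,
      nodeAvg (fun i => X i - η • Y i) r = nodeAvg X r - η * nodeAvg Y r := by
    intro X Y r
    simp only [nodeAvg_apply, PiLp.sub_apply, PiLp.smul_apply, smul_eq_mul,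
      Finset.sum_sub_distrib, ← Finset.mul_sum]
    ring
  have hHle : ∀ k r, avgPrecond S k r ≤ 1 / g := fun k r =>
    avg_le_of_le hM fun i => R.inv_sqrt_vt_le h3 hg h0l k i r
  have hHge : ∀ k ≤ N, ∀ r, 1 / Γ ≤ avgPrecond S k r := fun k hk r =>
    le_avg_of_le hM fun i => R.le_inv_sqrt_vt h2 h3 hg hΓ h0 hĝ hk i r
  have hHanti : ∀ k r, avgPrecond S (k + 1) r ≤ avgPrecond S k r := fun k r =>
    mul_le_mul_of_nonneg_left (Finset.sum_le_sum fun i _ => R.inv_sqrt_vt_anti h3 hg h0l k i r)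
      (by positivity)
  have hβ : ∀ k, 0 ≤ 2 * β₁ k * Γ / g := fun k => by have := (h1 k).1; positivity
  have hβ' : ∀ k, 2 * β₁ k * Γ / g ≤ 2 * Γ / g := fun k => by
    have := (h1 k).2
    calc _ ≤ 2 * 1 * Γ / g := by gcongr
      _ = _ := by ring
  have hLδ : 0 ≤ L * δ / g := by positivity
  have hLδ' : L * δ / g ≤ L / g := by
    calc _ ≤ L * 1 / g := by gcongr
      _ = _ := by ring
  have hsum : ∀ k, 0 ≤ ∑ r, (avgPrecond S k r - avgPrecond S (k + 1) r) := fun k =>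
    Finset.sum_nonneg fun r _ => sub_nonneg.2 (hHanti k r)
  have hcoord : ∀ k r, avgPrecond S k r - avgPrecond S (k + 1) r ≤
      ∑ r, (avgPrecond S k r - avgPrecond S (k + 1) r) := fun k r =>
    Finset.single_le_sum (f := fun r => avgPrecond S k r - avgPrecond S (k + 1) r)
      (fun r _ => sub_nonneg.2 (hHanti k r)) (Finset.mem_univ r)
  have hHnn : ∀ k r, 0 ≤ avgPrecond S k r := fun k r => by unfold avgPrecond; positivity
  have hzavg : ∀ k < N, ‖nodeAvg (S (k + 1)).z‖ ≤ D / 2 := by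
    intro k hk
    rw [nodeAvg, norm_smul, norm_inv, RCLike.norm_natCast]
    refine (mul_le_mul_of_nonneg_left (norm_sum_le _ _) (by positivity)).trans ?_
    exact avg_le_of_le hM (hz k hk)
  constructor
  · intro k r
    simp only
    rw [R.x_succ k, nodeAvg_mixNodes hW hd, havg_sub]
  · intro k r
    simp only
    rw [R.z_succ k, nodeAvg_mixNodes hW hd, havg_sub]
  · intro r
    simp [nodeAvg_apply, R.d_zero]
  · intro k _ r
    simp
  · exact hHge
  · exact fun k _ r => hHle k r
  · exact fun k _ r => hHanti k r
  · intro k hk r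
    simp only [Nat.add_sub_cancel, errorBound, avgNoise]
    -- The remainder has three sources at each node: the new preconditioner in place of the old one,
    -- the momentum in place of the fresh gradient estimate, and the local point in place of the
    -- average.
    have hsplit : nodeAvg (S (k + 1)).d r - avgPrecond S k r * Φ (nodeAvg (S (k + 1)).z) r -
        (M : ℝ)⁻¹ * ∑ i, (√((S k).vt i r))⁻¹ * (ĝ (k + 1) i r - Φ ((S (k + 1)).z i) r) =
        (M : ℝ)⁻¹ * ∑ i, (((√((S (k + 1)).vt i r))⁻¹ - (√((S k).vt i r))⁻¹) * (S (k + 1)).mom i r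
          + (√((S k).vt i r))⁻¹ * ((S (k + 1)).mom i r - ĝ (k + 1) i r)
          + (√((S k).vt i r))⁻¹ *
            (Φ ((S (k + 1)).z i) r - Φ (nodeAvg (S (k + 1)).z) r)) := by
      rw [nodeAvg_apply, avgPrecond, mul_assoc, Finset.sum_mul, ← mul_sub, ← mul_sub,
        ← Finset.sum_sub_distrib, ← Finset.sum_sub_distrib]
      congr 1
      refine Finset.sum_congr rfl fun i _ => ?_
      rw [R.d_succ]; ring
    rw [hsplit]
    refine (abs_avg_le_avg_abs _).trans ?_
    have hterm : ∀ i, |((√((S (k + 1)).vt i r))⁻¹ - (√((S k).vt i r))⁻¹) * (S (k + 1)).mom i r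
          + (√((S k).vt i r))⁻¹ * ((S (k + 1)).mom i r - ĝ (k + 1) i r)
          + (√((S k).vt i r))⁻¹ * (Φ ((S (k + 1)).z i) r - Φ (nodeAvg (S (k + 1)).z) r)| ≤
        Γ * ((√((S k).vt i r))⁻¹ - (√((S (k + 1)).vt i r))⁻¹)
          + (2 * β₁ (k + 1) * Γ / g + L * δ / g) := by
      intro i
      have hP0 : 0 ≤ (√((S k).vt i r))⁻¹ := by positivity
      have hPg := R.inv_sqrt_vt_le h3 hg h0l k i r
      have a1 : |((√((S (k + 1)).vt i r))⁻¹ - (√((S k).vt i r))⁻¹) * (S (k + 1)).mom i r| ≤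
          Γ * ((√((S k).vt i r))⁻¹ - (√((S (k + 1)).vt i r))⁻¹) := by
        have h4 := sub_nonneg.2 (R.inv_sqrt_vt_anti h3 hg h0l k i r)
        rw [abs_mul, abs_sub_comm, abs_of_nonneg h4, mul_comm]
        exact mul_le_mul_of_nonneg_right (R.abs_mom_le hΓ.le h1 hĝ hk i r) h4
      have a2 : |(√((S k).vt i r))⁻¹ * ((S (k + 1)).mom i r - ĝ (k + 1) i r)| ≤
          2 * β₁ (k + 1) * Γ / g := by
        -- The lag of the momentum carries the factor `β₁ (k + 1)`, which makes its contribution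
        -- summable.
        have h4 : (S (k + 1)).mom i r - ĝ (k + 1) i r =
            β₁ (k + 1) * ((S k).mom i r - ĝ (k + 1) i r) := by
          rw [R.mom_succ]; ring
        have h5 : |(S k).mom i r - ĝ (k + 1) i r| ≤ 2 * Γ :=
          (abs_sub _ _).trans (by linarith [R.abs_mom_le hΓ.le h1 hĝ hk.le i r, hĝ k hk i r])
        have h6 := (h1 (k + 1)).1
        rw [h4, abs_mul, abs_mul, abs_of_nonneg hP0, abs_of_nonneg h6]
        calc _ ≤ 1 / g * (β₁ (k + 1) * (2 * Γ)) := by gcongr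
          _ = _ := by ring
      have a3 : |(√((S k).vt i r))⁻¹ * (Φ ((S (k + 1)).z i) r - Φ (nodeAvg (S (k + 1)).z) r)| ≤
          L * δ / g := by
        rw [abs_mul, abs_of_nonneg hP0]
        have h4 : |Φ ((S (k + 1)).z i) r - Φ (nodeAvg (S (k + 1)).z) r| ≤ L * δ := by
          have h5 := PiLp.norm_apply_le (Φ ((S (k + 1)).z i) - Φ (nodeAvg (S (k + 1)).z)) r
          rw [PiLp.sub_apply, Real.norm_eq_abs] at h5
          refine h5.trans ((hΦL _ _).trans ?_)
          have := (norm_sub_nodeAvg_le_spread (S (k + 1)).z i).trans (hsp k hk)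
          gcongr
        calc _ ≤ 1 / g * (L * δ) := by gcongr
          _ = _ := by ring
      exact (abs_add_three _ _ _).trans (by linarith)
    refine (mul_le_mul_of_nonneg_left (Finset.sum_le_sum fun i _ => hterm i)
      (by positivity)).trans ?_
    rw [Finset.sum_add_distrib, ← Finset.mul_sum, Finset.sum_sub_distrib]
    have h4 : (M : ℝ)⁻¹ * (Γ * (∑ i, (√((S k).vt i r))⁻¹ - ∑ i, (√((S (k + 1)).vt i r))⁻¹)) =
        Γ * (avgPrecond S k r - avgPrecond S (k + 1) r) := by
      unfold avgPrecond; ring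
    have h5 := mul_le_mul_of_nonneg_left (hcoord k r) hΓ.le
    rw [mul_add, h4, Finset.sum_const, Finset.card_univ, Fintype.card_fin, nsmul_eq_mul,
      inv_mul_cancel_left₀ hM0]
    linarith
  · intro k _ r
    simp only [Nat.add_sub_cancel, errorBound]
    have := mul_le_mul_of_nonneg_left (hcoord k r) hΓ.le
    linarith [hβ (k + 1)]
  · exact fun k _ r => hΦ _ r
  · intro k hk r
    rw [nodeAvg_apply]
    exact (abs_avg_le_avg_abs _).trans
      (avg_le_of_le hM fun i => R.abs_d_le h3 hg hΓ h0l h1 hĝ hk i r)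
  · intro k _
    have h4 := pow_le_pow_left₀ (norm_nonneg _)
      (hΦL (nodeAvg (S (k + 2)).z) (nodeAvg (S (k + 1)).z)) 2
    rwa [mul_pow, EuclideanSpace.real_norm_sq_eq, EuclideanSpace.real_norm_sq_eq] at h4
  · intro k _
    have h4 := hm (nodeAvg (S (k + 1)).z)
    rw [PiLp.inner_apply] at h4
    simpa [mul_comm] using h4
  · intro k hk r
    have h4 := PiLp.norm_apply_le (nodeAvg (S (k + 1)).z - xs) r
    rw [PiLp.sub_apply, Real.norm_eq_abs] at h4
    exact h4.trans ((norm_sub_le _ _).trans (by linarith [hzavg k hk]))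
  · intro k _
    simp only [Nat.add_sub_cancel, errorBound]
    have := mul_nonneg hΓ.le (hsum k)
    linarith [hβ (k + 1)]
  · intro k _
    simp only [Nat.add_sub_cancel, errorBound]
    have h4 : ∑ r, (avgPrecond S k r - avgPrecond S (k + 1) r) ≤ (p₁ + p₂ : ℕ) * (1 / g) := by
      refine (Finset.sum_le_card_nsmul _ _ (1 / g) fun r _ => ?_).trans (by simp)
      linarith [hHle k r, hHnn (k + 1) r]
    have h5 := mul_le_mul_of_nonneg_left h4 hΓ.le
    have h6 : Γ * ((p₁ + p₂ : ℕ) * (1 / g)) = (p₁ + p₂ : ℕ) * (Γ / g) := by ring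
    linarith [hβ' (k + 1)]

end DadamRecursion

end StateBounds

/-! ### Moments of sums over independent samples with predictable weights. -/

section Noise

/-- The σ-algebra generated by the samples with index in `A`. -/
abbrev sampleSigma {Q Ω Ξ : Type*} [MeasurableSpace Ξ] (s : Q → Ω → Ξ) (A : Set Q) :
    MeasurableSpace Ω :=
  ⨆ q ∈ A, MeasurableSpace.comap (s q) inferInstance

variable {Q Ω Ξ E : Type*} [MeasurableSpace Ξ] {s : Q → Ω → Ξ}

theorem sampleSigma_mono {A B : Set Q} (h : A ⊆ B) : sampleSigma s A ≤ sampleSigma s B :=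
  biSup_mono h

theorem measurable_sampleSigma {A : Set Q} {q : Q} (hq : q ∈ A) :
    Measurable[sampleSigma s A] (s q) :=
  Measurable.of_comap_le (le_biSup (fun q => MeasurableSpace.comap (s q) inferInstance) hq)

variable [mΩ : MeasurableSpace Ω] {μ : Measure Ω} {𝒟 : Measure Ξ}

theorem sampleSigma_le (hs : ∀ q, Measurable (s q)) (A : Set Q) : sampleSigma s A ≤ mΩ :=
  iSup₂_le fun q _ => (hs q).comap_le

theorem indepFun_of_measurable_others [MeasurableSpace E] (hs : ∀ q, Measurable (s q))
    (hi : iIndepFun s μ) (q : Q) {X : Ω → E} (hX : Measurable[sampleSigma s {q}ᶜ] X) :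
    IndepFun X (s q) μ := by
  have h1 : Indep (sampleSigma s {q}ᶜ) (sampleSigma s {q}) μ :=
    indep_iSup_of_disjoint (fun q => (hs q).comap_le) hi disjoint_compl_left
  rw [IndepFun_iff_Indep]
  exact indep_of_indep_of_le_left (indep_of_indep_of_le_right h1
    (le_biSup (fun q => MeasurableSpace.comap (s q) inferInstance) (Set.mem_singleton q)))
    hX.comap_le

variable [IsProbabilityMeasure μ] [MeasurableSpace E]

/-- A function of the other samples is independent of sample `q`, so the joint law is a product.
Fubini then replaces conditional expectations in what follows. -/
theorem map_prodMk_sample (hs : ∀ q, Measurable (s q)) (hi : iIndepFun s μ)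
    (hD : ∀ q, μ.map (s q) = 𝒟) (q : Q) {X : Ω → E} (hX : Measurable[sampleSigma s {q}ᶜ] X) :
    μ.map (fun ω => (X ω, s q ω)) = (μ.map X).prod 𝒟 := by
  have hX' : Measurable X := hX.mono (sampleSigma_le hs _) le_rfl
  rw [(indepFun_iff_map_prod_eq_prod_map_map hX'.aemeasurable (hs q).aemeasurable).1
    (indepFun_of_measurable_others hs hi q hX), hD]

variable [IsProbabilityMeasure 𝒟]

/-- An almost sure property of a fresh sample also holds at a point that depends on the other
samples. -/
theorem ae_sample (hs : ∀ q, Measurable (s q)) (hi : iIndepFun s μ)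
    (hD : ∀ q, μ.map (s q) = 𝒟) (q : Q) {X : Ω → E} (hX : Measurable[sampleSigma s {q}ᶜ] X)
    {p : E × Ξ → Prop} (hp : MeasurableSet {x | p x}) (h : ∀ z, ∀ᵐ ξ ∂𝒟, p (z, ξ)) :
    ∀ᵐ ω ∂μ, p (X ω, s q ω) := by
  have hX' : Measurable X := hX.mono (sampleSigma_le hs _) le_rfl
  have h1 : ∀ᵐ x ∂(μ.map X).prod 𝒟, p x := by
    rw [Measure.ae_prod_iff_ae_ae hp]
    exact Filter.Eventually.of_forall h
  rw [← map_prodMk_sample hs hi hD q hX] at h1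
  exact ae_of_ae_map (hX'.prodMk (hs q)).aemeasurable h1

theorem integral_sample (hs : ∀ q, Measurable (s q)) (hi : iIndepFun s μ)
    (hD : ∀ q, μ.map (s q) = 𝒟) (q : Q) {X : Ω → E} (hX : Measurable[sampleSigma s {q}ᶜ] X)
    {φ : E × Ξ → ℝ} (hφ : Measurable φ) (hint : Integrable (fun ω => φ (X ω, s q ω)) μ) :
    Integrable (fun z => ∫ ξ, φ (z, ξ) ∂𝒟) (μ.map X) ∧
      ∫ ω, φ (X ω, s q ω) ∂μ = ∫ z, ∫ ξ, φ (z, ξ) ∂𝒟 ∂(μ.map X) := by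
  have hX' : Measurable X := hX.mono (sampleSigma_le hs _) le_rfl
  have h2 := (hX'.prodMk (hs q)).aemeasurable (μ := μ)
  have h3 : Integrable φ ((μ.map X).prod 𝒟) := by
    rw [← map_prodMk_sample hs hi hD q hX]
    exact (integrable_map_measure hφ.aestronglyMeasurable h2).2 hint
  refine ⟨h3.integral_prod_left, ?_⟩
  rw [← integral_prod _ h3, ← map_prodMk_sample hs hi hD q hX,
    integral_map h2 hφ.aestronglyMeasurable]

theorem integrable_of_ae_abs_le {Y : Ω → ℝ} (hY : Measurable Y) {c : ℝ}
    (h : ∀ᵐ ω ∂μ, |Y ω| ≤ c) : Integrable Y μ :=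
  Integrable.of_bound hY.aestronglyMeasurable c h

variable {ψ : E × Ξ → ℝ} {B V : ℝ}

/-- Centred functions of a fresh sample are orthogonal to all functions of the other samples. -/
theorem integral_mul_sample_eq_zero (hs : ∀ q, Measurable (s q)) (hi : iIndepFun s μ)
    (hD : ∀ q, μ.map (s q) = 𝒟) (hψ : Measurable ψ) (hψ0 : ∀ z, ∫ ξ, ψ (z, ξ) ∂𝒟 = 0)
    (q : Q) {Z : Ω → E} (hZ : Measurable[sampleSigma s {q}ᶜ] Z) {b : Ω → ℝ}
    (hb : Measurable[sampleSigma s {q}ᶜ] b)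
    (hint : Integrable (fun ω => b ω * ψ (Z ω, s q ω)) μ) :
    ∫ ω, b ω * ψ (Z ω, s q ω) ∂μ = 0 := by
  have hX : Measurable[sampleSigma s {q}ᶜ] fun ω => (b ω, Z ω) := hb.prodMk hZ
  have h := (integral_sample hs hi hD q hX (φ := fun x => x.1.1 * ψ (x.1.2, x.2))
    (by fun_prop) hint).2
  rw [h]
  simp [integral_const_mul, hψ0]

theorem integral_sq_sample_le (hs : ∀ q, Measurable (s q)) (hi : iIndepFun s μ)
    (hD : ∀ q, μ.map (s q) = 𝒟) (hψ : Measurable ψ) (hψV : ∀ z, ∫ ξ, ψ (z, ξ) ^ 2 ∂𝒟 ≤ V)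
    (q : Q) {Z : Ω → E} (hZ : Measurable[sampleSigma s {q}ᶜ] Z)
    (hint : Integrable (fun ω => ψ (Z ω, s q ω) ^ 2) μ) :
    ∫ ω, ψ (Z ω, s q ω) ^ 2 ∂μ ≤ V := by
  have h := integral_sample hs hi hD q hZ (φ := fun x => ψ x ^ 2) (by fun_prop) hint
  have hZ' : Measurable Z := hZ.mono (sampleSigma_le hs _) le_rfl
  have := Measure.isProbabilityMeasure_map (μ := μ) hZ'.aemeasurable
  rw [h.2]
  calc _ ≤ ∫ _, V ∂(μ.map Z) := integral_mono h.1 (integrable_const V) hψV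
    _ = V := by simp

/-- The noise of a family of fresh samples with predictable weights and evaluation points. -/
theorem noise_moments (hs : ∀ q, Measurable (s q)) (hi : iIndepFun s μ)
    (hD : ∀ q, μ.map (s q) = 𝒟) (hψ : Measurable ψ) (hψ0 : ∀ z, ∫ ξ, ψ (z, ξ) ∂𝒟 = 0)
    (hψV : ∀ z, ∫ ξ, ψ (z, ξ) ^ 2 ∂𝒟 ≤ V) (hψB : ∀ z, ∀ᵐ ξ ∂𝒟, |ψ (z, ξ)| ≤ B)
    (A : Finset Q) {Z : Q → Ω → E} {c : Q → Ω → ℝ} {c₀ : ℝ} {U : Set Q}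
    (hU : ∀ q ∈ A, q ∉ U) (hZ : ∀ q ∈ A, Measurable[sampleSigma s U] (Z q))
    (hc : ∀ q ∈ A, Measurable[sampleSigma s U] (c q)) (hc₀ : ∀ q ∈ A, ∀ ω, |c q ω| ≤ c₀) :
    (∫ ω, (∑ q ∈ A, c q ω * ψ (Z q ω, s q ω)) ^ 2 ∂μ ≤ A.card * (c₀ ^ 2 * V)) ∧
    ∀ (y : Ω → ℝ) (b : ℝ), Measurable[sampleSigma s U] y → (∀ᵐ ω ∂μ, |y ω| ≤ b) →
      ∫ ω, (∑ q ∈ A, c q ω * ψ (Z q ω, s q ω)) * y ω ∂μ = 0 := by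
  have hle : ∀ q, sampleSigma s {q}ᶜ ≤ mΩ := fun q => sampleSigma_le hs _
  have h𝓕 : ∀ q ∈ A, sampleSigma s U ≤ sampleSigma s {q}ᶜ := fun q hq =>
    sampleSigma_mono (Set.subset_compl_singleton_iff.2 (hU q hq))
  have hB : ∀ q ∈ A, ∀ᵐ ω ∂μ, |ψ (Z q ω, s q ω)| ≤ B := fun q hq =>
    ae_sample hs hi hD q ((hZ q hq).mono (h𝓕 q hq) le_rfl)
      (p := fun x => |ψ x| ≤ B) (measurableSet_le (by fun_prop) (by fun_prop)) hψB
  have hmZ : ∀ q ∈ A, Measurable (Z q) := fun q hq =>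
    (hZ q hq).mono ((h𝓕 q hq).trans (hle q)) le_rfl
  have hmc : ∀ q ∈ A, Measurable (c q) := fun q hq =>
    (hc q hq).mono ((h𝓕 q hq).trans (hle q)) le_rfl
  have hmψ : ∀ q ∈ A, Measurable fun ω => ψ (Z q ω, s q ω) := fun q hq =>
    hψ.comp ((hmZ q hq).prodMk (hs q))
  have hbound : ∀ {u v w : ℝ} {x y z : ℝ}, |u| ≤ x → |v| ≤ y → |w| ≤ z → |u * v * w| ≤ x * y * z := by
    intro u v w x y z hu hv hw
    have := (abs_nonneg _).trans hu
    have := (abs_nonneg _).trans hv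
    rw [abs_mul, abs_mul]
    gcongr
  constructor
  · have hint : ∀ q ∈ A, ∀ q' ∈ A, Integrable (fun ω => (c q ω * ψ (Z q ω, s q ω)) *
        (c q' ω * ψ (Z q' ω, s q' ω))) μ := by
      intro q hq q' hq'
      refine integrable_of_ae_abs_le (c := c₀ * B * (c₀ * B)) ?_ ?_
      · exact ((hmc q hq).mul (hmψ q hq)).mul ((hmc q' hq').mul (hmψ q' hq'))
      · filter_upwards [hB q hq, hB q' hq'] with ω h1 h2
        refine hbound (hc₀ q hq ω) h1 ?_
        simpa using hbound (hc₀ q' hq' ω) h2 (abs_one.le)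
    -- Everything except the noise at `q` is measurable in the samples other than `q`, including the
    -- noise at `q'`. Centredness at `q` therefore kills the product, and only the diagonal
    -- contributes to the second moment.
    have hcross : ∀ q ∈ A, ∀ q' ∈ A, q' ≠ q → ∫ ω, (c q ω * ψ (Z q ω, s q ω)) *
        (c q' ω * ψ (Z q' ω, s q' ω)) ∂μ = 0 := by
      intro q hq q' hq' hne
      have h1 : Measurable[sampleSigma s {q}ᶜ] fun ω => ψ (Z q' ω, s q' ω) :=
        hψ.comp (((hZ q' hq').mono (h𝓕 q hq) le_rfl).prodMk
          (measurable_sampleSigma (by simpa using hne)))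
      have h2 : Measurable[sampleSigma s {q}ᶜ] fun ω =>
          c q ω * (c q' ω * ψ (Z q' ω, s q' ω)) :=
        Measurable.mul ((hc q hq).mono (h𝓕 q hq) le_rfl)
          (Measurable.mul ((hc q' hq').mono (h𝓕 q hq) le_rfl) h1)
      have h3 := integral_mul_sample_eq_zero hs hi hD hψ hψ0 q
        ((hZ q hq).mono (h𝓕 q hq) le_rfl) h2
      have h4 : (fun ω => c q ω * (c q' ω * ψ (Z q' ω, s q' ω)) * ψ (Z q ω, s q ω)) =
          fun ω => (c q ω * ψ (Z q ω, s q ω)) * (c q' ω * ψ (Z q' ω, s q' ω)) := by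
        ext ω; ring
      rw [h4] at h3
      exact h3 (hint q hq q' hq')
    have hdiag : ∀ q ∈ A, ∫ ω, (c q ω * ψ (Z q ω, s q ω)) * (c q ω * ψ (Z q ω, s q ω)) ∂μ ≤
        c₀ ^ 2 * V := by
      intro q hq
      have hi2 : Integrable (fun ω => ψ (Z q ω, s q ω) ^ 2) μ := by
        refine integrable_of_ae_abs_le (c := B ^ 2) ((hmψ q hq).pow_const 2) ?_
        filter_upwards [hB q hq] with ω h1
        rw [abs_pow]; gcongr
      calc _ ≤ ∫ ω, c₀ ^ 2 * ψ (Z q ω, s q ω) ^ 2 ∂μ := by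
            refine integral_mono (hint q hq q hq) (hi2.const_mul _) fun ω => ?_
            simp only
            rw [← sq, mul_pow, ← sq_abs (c q ω)]
            have := hc₀ q hq ω
            gcongr
        _ = c₀ ^ 2 * ∫ ω, ψ (Z q ω, s q ω) ^ 2 ∂μ := integral_const_mul _ _
        _ ≤ _ := mul_le_mul_of_nonneg_left (integral_sq_sample_le hs hi hD hψ hψV q
            ((hZ q hq).mono (h𝓕 q hq) le_rfl) hi2) (sq_nonneg _)
    simp only [sq (∑ q ∈ A, _), Finset.sum_mul_sum]
    rw [integral_finsetSum _ fun q hq => integrable_finsetSum _ fun q' hq' => hint q hq q' hq']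
    refine (Finset.sum_le_card_nsmul _ _ (c₀ ^ 2 * V) fun q hq => ?_).trans (by simp)
    rw [integral_finsetSum _ fun q' hq' => hint q hq q' hq',
      Finset.sum_eq_single_of_mem q hq fun q' hq' hne => hcross q hq q' hq' hne]
    exact hdiag q hq
  · intro y b hy hyb
    have hint : ∀ q ∈ A, Integrable (fun ω => c q ω * ψ (Z q ω, s q ω) * y ω) μ := by
      intro q hq
      refine integrable_of_ae_abs_le (c := c₀ * B * b) ?_ ?_
      · exact ((hmc q hq).mul (hmψ q hq)).mul (hy.mono ((h𝓕 q hq).trans (hle q)) le_rfl)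
      · filter_upwards [hB q hq, hyb] with ω h1 h2
        exact hbound (hc₀ q hq ω) h1 h2
    simp only [Finset.sum_mul]
    rw [integral_finsetSum _ hint]
    refine Finset.sum_eq_zero fun q hq => ?_
    have h2 : Measurable[sampleSigma s {q}ᶜ] fun ω => c q ω * y ω :=
      Measurable.mul ((hc q hq).mono (h𝓕 q hq) le_rfl) (hy.mono (h𝓕 q hq) le_rfl)
    have h3 := integral_mul_sample_eq_zero hs hi hD hψ hψ0 q ((hZ q hq).mono (h𝓕 q hq) le_rfl) h2
    have h4 : (fun ω => c q ω * y ω * ψ (Z q ω, s q ω)) =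
        fun ω => c q ω * ψ (Z q ω, s q ω) * y ω := by
      ext ω; ring
    rw [h4] at h3
    exact h3 (hint q hq)

end Noise

/-! ### Measurability of the states in the samples. -/

section Measurability

/-- The variables that are carried over to the next iteration depend measurably on `ω`. -/
structure MeasurableState {p₁ p₂ M : ℕ} {Ω : Type*} [mΩ : MeasurableSpace Ω]
    (S : Ω → DadamState p₁ p₂ M) : Prop where
  x : ∀ i, Measurable fun ω => (S ω).x i
  d : ∀ i, Measurable fun ω => (S ω).d i
  mom : ∀ i, Measurable fun ω => (S ω).mom i
  v : ∀ i, Measurable fun ω => (S ω).v i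
  vt : ∀ i, Measurable fun ω => (S ω).vt i

variable {p₁ p₂ M : ℕ} {Ω Ξ : Type*} {mΩ : MeasurableSpace Ω} [MeasurableSpace Ξ]

theorem measurable_coord {X : Ω → JointSpace p₁ p₂} (hX : Measurable X) (r : Fin p₁ ⊕ Fin p₂) :
    Measurable fun ω => X ω r := by fun_prop

theorem measurable_of_coord {X : Ω → JointSpace p₁ p₂}
    (hX : ∀ r, Measurable fun ω => X ω r) : Measurable X := by
  have h : Measurable fun ω => (X ω).ofLp := measurable_pi_lambda _ hX
  exact (WithLp.measurable_toLp 2 _).comp h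

theorem measurable_mixNodes (W : Matrix (Fin M) (Fin M) ℝ) (t : ℕ)
    {X : Ω → Fin M → JointSpace p₁ p₂} (hX : ∀ i, Measurable fun ω => X ω i) (i : Fin M) :
    Measurable fun ω => mixNodes W t (X ω) i := by
  unfold mixNodes
  fun_prop

theorem MeasurableState.mix {S : Ω → DadamState p₁ p₂ M} (hS : MeasurableState S)
    (W : Matrix (Fin M) (Fin M) ℝ) (t : ℕ) (η : ℝ) (i : Fin M) :
    Measurable fun ω => mixNodes W t (fun i => (S ω).x i - η • (S ω).d i) i :=
  measurable_mixNodes W t (fun i => (hS.x i).sub ((hS.d i).const_smul η)) i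

theorem measurable_batchGrad {f : JointSpace p₁ p₂ → Ξ → ℝ}
    (hf : Measurable fun q : JointSpace p₁ p₂ × Ξ => saddleGrad (fun y => f y q.2) q.1) (b : ℕ)
    {s : Ω → ℕ → Ξ} (hs : ∀ j, Measurable fun ω => s ω j) {y : Ω → JointSpace p₁ p₂}
    (hy : Measurable y) : Measurable fun ω => batchGrad f b (s ω) (y ω) := by
  unfold batchGrad
  have h : Measurable fun ω => ∑ j ∈ Finset.range b, saddleGrad (fun y' => f y' (s ω j)) (y ω) :=
    Finset.measurable_fun_sum _ fun j _ => hf.comp (hy.prodMk (hs j))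
  exact h.const_smul (b : ℝ)⁻¹

theorem MeasurableState.dadamStep {f : JointSpace p₁ p₂ → Ξ → ℝ}
    (hf : Measurable fun q : JointSpace p₁ p₂ × Ξ => saddleGrad (fun y => f y q.2) q.1)
    {S : Ω → DadamState p₁ p₂ M} (hS : MeasurableState S)
    (W : Matrix (Fin M) (Fin M) ℝ) (t : ℕ) (η b₁ β₂ β₃ : ℝ) (b : ℕ) {s : Ω → Fin M → ℕ → Ξ}
    (hs : ∀ i j, Measurable fun ω => s ω i j) :
    MeasurableState fun ω => dadamStep f W t η b₁ β₂ β₃ b (s ω) (S ω) := by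
  have hg : ∀ i, Measurable fun ω => batchGrad f b (s ω i)
      (mixNodes W t (fun i => (S ω).x i - η • (S ω).d i) i) := fun i =>
    measurable_batchGrad hf b (hs i) (hS.mix W t η i)
  have hmom : ∀ i, Measurable fun ω => (_root_.dadamStep f W t η b₁ β₂ β₃ b (s ω) (S ω)).mom i :=
    fun i => by
      have h := ((hS.mom i).const_smul b₁).add ((hg i).const_smul (1 - b₁))
      exact h
  have hv : ∀ i, Measurable fun ω => (_root_.dadamStep f W t η b₁ β₂ β₃ b (s ω) (S ω)).v i := by
    refine fun i => measurable_of_coord fun r => ?_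
    have h1 := measurable_coord (hS.v i) r
    have h2 := measurable_coord (hg i) r
    have h := (h1.const_mul β₂).add ((h2.mul h2).const_mul (1 - β₂))
    exact h
  have hvt : ∀ i, Measurable fun ω =>
      (_root_.dadamStep f W t η b₁ β₂ β₃ b (s ω) (S ω)).vt i := by
    refine fun i => measurable_of_coord fun r => ?_
    have h1 := measurable_coord (hS.vt i) r
    have h2 := measurable_coord (hv i) r
    have h := (h1.const_mul β₃).add ((h1.max h2).const_mul (1 - β₃))
    exact h
  have hd : ∀ i, Measurable fun ω => (_root_.dadamStep f W t η b₁ β₂ β₃ b (s ω) (S ω)).d i := by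
    refine fun i => measurable_of_coord fun r => ?_
    exact (measurable_coord (hvt i) r).sqrt.inv.mul (measurable_coord (hmom i) r)
  exact ⟨measurable_mixNodes W t fun i => (hS.x i).sub ((hd i).const_smul η), hd, hmom, hv, hvt⟩

/-- The σ-algebra on `Ω` is arbitrary and only samples up to iteration `k` are required to be
measurable. Taking the σ-algebra generated by those samples yields adaptedness. -/
theorem measurableState_dadam {f : JointSpace p₁ p₂ → Ξ → ℝ}
    (hf : Measurable fun q : JointSpace p₁ p₂ × Ξ => saddleGrad (fun y => f y q.2) q.1)
    (W : Matrix (Fin M) (Fin M) ℝ) (t : ℕ) (η : ℝ) (β₁ : ℕ → ℝ) (β₂ β₃ : ℝ)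
    (vt₀ : Fin M → JointSpace p₁ p₂) (m : ℕ → ℕ) {s : ℕ → Fin M → ℕ → Ω → Ξ} {k : ℕ}
    (hs : ∀ k' ≤ k, ∀ i j, Measurable (s k' i j)) :
    MeasurableState fun ω => dadam f W t η β₁ β₂ β₃ vt₀ m (fun k i j => s k i j ω) k := by
  induction k with
  | zero => exact ⟨fun _ => measurable_const, fun _ => measurable_const, fun _ => measurable_const,
      fun _ => measurable_const, fun _ => measurable_const⟩
  | succ k ih =>
    exact (ih fun k' hk' => hs k' (by omega)).dadamStep hf W t η _ β₂ β₃ _ (hs (k + 1) le_rfl)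

end Measurability

/-! ### Coordinatewise consequences of the assumptions on the loss. -/

section Loss

variable {p₁ p₂ : ℕ} {P : DadamParams} {Ξ : Type*} [MeasurableSpace Ξ]
  {f : JointSpace p₁ p₂ → Ξ → ℝ} {𝒟 : Measure Ξ}

/-- The `r`-th coordinate of the noise of the stochastic gradient. -/
noncomputable abbrev gradNoise (f : JointSpace p₁ p₂ → Ξ → ℝ) (𝒟 : Measure Ξ)
    (r : Fin p₁ ⊕ Fin p₂) (q : JointSpace p₁ p₂ × Ξ) : ℝ :=
  saddleGrad (fun y => f y q.2) q.1 r - saddleGrad (expectedLoss f 𝒟) q.1 r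

namespace LossAssumptions

theorem measurable_saddleGrad_apply (h : LossAssumptions P f 𝒟) (r : Fin p₁ ⊕ Fin p₂) :
    Measurable fun q : JointSpace p₁ p₂ × Ξ => saddleGrad (fun y => f y q.2) q.1 r :=
  measurable_coord h.measurable_grad r

theorem continuous_saddleGrad (h : LossAssumptions P f 𝒟) (hL : 0 ≤ P.L) :
    Continuous (saddleGrad (expectedLoss f 𝒟)) := by
  have : LipschitzWith ⟨P.L, hL⟩ (saddleGrad (expectedLoss f 𝒟)) :=
    LipschitzWith.of_dist_le_mul fun x y => by
      rw [dist_eq_norm, dist_eq_norm]; exact h.lipschitz x y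
  exact this.continuous

theorem measurable_gradNoise (h : LossAssumptions P f 𝒟) (hL : 0 ≤ P.L) (r : Fin p₁ ⊕ Fin p₂) :
    Measurable (gradNoise f 𝒟 r) := by
  have h1 : Measurable fun q : JointSpace p₁ p₂ × Ξ => saddleGrad (expectedLoss f 𝒟) q.1 r :=
    measurable_coord ((h.continuous_saddleGrad hL).measurable.comp measurable_fst) r
  exact (h.measurable_saddleGrad_apply r).sub h1

variable [IsProbabilityMeasure 𝒟]

theorem integrable_apply (h : LossAssumptions P f 𝒟) (y : JointSpace p₁ p₂)
    (r : Fin p₁ ⊕ Fin p₂) : Integrable (fun ξ => saddleGrad (fun y' => f y' ξ) y r) 𝒟 := by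
  refine integrable_of_ae_abs_le (c := P.Ginf)
    ((h.measurable_saddleGrad_apply r).comp measurable_prodMk_left) ?_
  filter_upwards [h.bounded_grad y] with ξ hξ
  exact hξ r

theorem integral_apply (h : LossAssumptions P f 𝒟) (y : JointSpace p₁ p₂)
    (r : Fin p₁ ⊕ Fin p₂) :
    ∫ ξ, saddleGrad (fun y' => f y' ξ) y r ∂𝒟 = saddleGrad (expectedLoss f 𝒟) y r := by
  rw [← h.unbiased y, eval_integral_piLp fun r => h.integrable_apply y r]

theorem abs_saddleGrad_le (h : LossAssumptions P f 𝒟) (y : JointSpace p₁ p₂)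
    (r : Fin p₁ ⊕ Fin p₂) : |saddleGrad (expectedLoss f 𝒟) y r| ≤ P.Ginf := by
  rw [← h.integral_apply y r, ← Real.norm_eq_abs]
  have h1 : ∀ᵐ ξ ∂𝒟, ‖saddleGrad (fun y' => f y' ξ) y r‖ ≤ P.Ginf := by
    filter_upwards [h.bounded_grad y] with ξ hξ
    exact hξ r
  simpa using norm_integral_le_of_norm_le_const h1

theorem integral_gradNoise (h : LossAssumptions P f 𝒟) (r : Fin p₁ ⊕ Fin p₂)
    (y : JointSpace p₁ p₂) : ∫ ξ, gradNoise f 𝒟 r (y, ξ) ∂𝒟 = 0 := by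
  simp only [gradNoise]
  rw [integral_sub (h.integrable_apply y r) (integrable_const _), h.integral_apply]
  simp

theorem ae_abs_gradNoise_le (h : LossAssumptions P f 𝒟) (r : Fin p₁ ⊕ Fin p₂)
    (y : JointSpace p₁ p₂) : ∀ᵐ ξ ∂𝒟, |gradNoise f 𝒟 r (y, ξ)| ≤ 2 * P.Ginf := by
  filter_upwards [h.bounded_grad y] with ξ hξ
  exact (abs_sub _ _).trans (by linarith [hξ r, h.abs_saddleGrad_le y r])

/-- One coordinate is dominated by the full norm. Summing over coordinates later costs a factor `p₁
+ p₂`, which the constants absorb. -/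
theorem integral_sq_gradNoise_le (h : LossAssumptions P f 𝒟) (hL : 0 ≤ P.L)
    (r : Fin p₁ ⊕ Fin p₂) (y : JointSpace p₁ p₂) :
    ∫ ξ, gradNoise f 𝒟 r (y, ξ) ^ 2 ∂𝒟 ≤ P.σ ^ 2 := by
  have hint : ∀ r, Integrable (fun ξ => gradNoise f 𝒟 r (y, ξ) ^ 2) 𝒟 := by
    intro r
    refine integrable_of_ae_abs_le (c := (2 * P.Ginf) ^ 2)
      (((h.measurable_gradNoise hL r).comp measurable_prodMk_left).pow_const 2) ?_
    filter_upwards [h.ae_abs_gradNoise_le r y] with ξ hξ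
    rw [abs_pow]; gcongr
  refine le_trans ?_ (h.variance_le y)
  simp only [EuclideanSpace.real_norm_sq_eq, PiLp.sub_apply]
  refine integral_mono (hint r) (integrable_finsetSum _ fun r _ => hint r) fun ξ => ?_
  exact Finset.single_le_sum (f := fun r => gradNoise f 𝒟 r (y, ξ) ^ 2)
    (fun _ _ => sq_nonneg _) (Finset.mem_univ r)

end LossAssumptions

end Loss

/-! ### The random path: predictability and moments of the averaged noise. -/

section Path

variable {p₁ p₂ M : ℕ} {Ω Ξ : Type*}

/-- The states of DADAM³ for the samples at `ω`. -/
noncomputable abbrev dadamPath (P : DadamParams) (f : JointSpace p₁ p₂ → Ξ → ℝ)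
    (W : Matrix (Fin M) (Fin M) ℝ) (t : ℕ) (vt₀ : Fin M → JointSpace p₁ p₂) (m : ℕ → ℕ)
    (s : ℕ → Fin M → ℕ → Ω → Ξ) (ω : Ω) : ℕ → DadamState p₁ p₂ M :=
  dadam f W t P.η P.β₁ P.β₂ P.β₃ vt₀ m fun k i j => s k i j ω

/-- The gradient estimates of DADAM³ for the samples at `ω`. -/
noncomputable abbrev pathGrad (P : DadamParams) (f : JointSpace p₁ p₂ → Ξ → ℝ)
    (W : Matrix (Fin M) (Fin M) ℝ) (t : ℕ) (vt₀ : Fin M → JointSpace p₁ p₂) (m : ℕ → ℕ)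
    (s : ℕ → Fin M → ℕ → Ω → Ξ) (ω : Ω) (k : ℕ) (i : Fin M) : JointSpace p₁ p₂ :=
  batchGrad f (m k) (fun j => s k i j ω) ((dadamPath P f W t vt₀ m s ω k).z i)

/-- The samples as a family over one index type. -/
abbrev sampleFamily (s : ℕ → Fin M → ℕ → Ω → Ξ) (q : ℕ × Fin M × ℕ) : Ω → Ξ :=
  s q.1 q.2.1 q.2.2

variable [MeasurableSpace Ξ] {P : DadamParams} {f : JointSpace p₁ p₂ → Ξ → ℝ} {𝒟 : Measure Ξ}
  {s : ℕ → Fin M → ℕ → Ω → Ξ} {W : Matrix (Fin M) (Fin M) ℝ} {t : ℕ}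
  {vt₀ : Fin M → JointSpace p₁ p₂} {m : ℕ → ℕ}

theorem measurableState_past (h : LossAssumptions P f 𝒟) (W : Matrix (Fin M) (Fin M) ℝ) (t : ℕ)
    (vt₀ : Fin M → JointSpace p₁ p₂) (m : ℕ → ℕ) (s : ℕ → Fin M → ℕ → Ω → Ξ) (k : ℕ) :
    MeasurableState (mΩ := sampleSigma (sampleFamily s) {q | q.1 ≤ k})
      fun ω => dadamPath P f W t vt₀ m s ω k :=
  measurableState_dadam h.measurable_grad W t P.η P.β₁ P.β₂ P.β₃ vt₀ m fun k' hk' i j =>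
      measurable_sampleSigma (s := sampleFamily s) (q := (k', i, j)) hk'

/-- The point `z (k + 1)` is formed from `x k` and `d k`, before the samples of iteration `k + 1`
are drawn. This predictability is what makes the gradient noise centred. -/
theorem measurable_z_past (h : LossAssumptions P f 𝒟) (W : Matrix (Fin M) (Fin M) ℝ) (t : ℕ)
    (vt₀ : Fin M → JointSpace p₁ p₂) (m : ℕ → ℕ) (s : ℕ → Fin M → ℕ → Ω → Ξ) (k : ℕ) (i : Fin M) :
    Measurable[sampleSigma (sampleFamily s) {q | q.1 ≤ k}]
      fun ω => (dadamPath P f W t vt₀ m s ω (k + 1)).z i :=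
  (measurableState_past h W t vt₀ m s k).mix W t P.η i

theorem measurable_zbar_past (h : LossAssumptions P f 𝒟) (W : Matrix (Fin M) (Fin M) ℝ) (t : ℕ)
    (vt₀ : Fin M → JointSpace p₁ p₂) (m : ℕ → ℕ) (s : ℕ → Fin M → ℕ → Ω → Ξ) (k : ℕ) :
    Measurable[sampleSigma (sampleFamily s) {q | q.1 ≤ k}]
      fun ω => nodeAvg (dadamPath P f W t vt₀ m s ω (k + 1)).z := by
  have h1 : Measurable[sampleSigma (sampleFamily s) {q | q.1 ≤ k}]
      fun ω => ∑ i, (dadamPath P f W t vt₀ m s ω (k + 1)).z i :=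
    Finset.measurable_fun_sum _ fun i _ => measurable_z_past h W t vt₀ m s k i
  exact h1.const_smul (M : ℝ)⁻¹

theorem measurable_precond_past (h : LossAssumptions P f 𝒟) (W : Matrix (Fin M) (Fin M) ℝ) (t : ℕ)
    (vt₀ : Fin M → JointSpace p₁ p₂) (m : ℕ → ℕ) (s : ℕ → Fin M → ℕ → Ω → Ξ) (k : ℕ) (i : Fin M)
    (r : Fin p₁ ⊕ Fin p₂) :
    Measurable[sampleSigma (sampleFamily s) {q | q.1 ≤ k}]
      fun ω => (√((dadamPath P f W t vt₀ m s ω k).vt i r))⁻¹ :=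
  measurable_inv.comp (Real.continuous_sqrt.measurable.comp
    (measurable_coord (@MeasurableState.vt _ _ _ _
      (sampleSigma (sampleFamily s) {q | q.1 ≤ k}) _ (measurableState_past h W t vt₀ m s k) i) r))

theorem measurable_avgPrecond_past (h : LossAssumptions P f 𝒟) (W : Matrix (Fin M) (Fin M) ℝ)
    (t : ℕ) (vt₀ : Fin M → JointSpace p₁ p₂) (m : ℕ → ℕ) (s : ℕ → Fin M → ℕ → Ω → Ξ) (k : ℕ)
    (r : Fin p₁ ⊕ Fin p₂) :
    Measurable[sampleSigma (sampleFamily s) {q | q.1 ≤ k}]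
      fun ω => avgPrecond (dadamPath P f W t vt₀ m s ω) k r :=
  (Finset.measurable_fun_sum _ fun i _ => measurable_precond_past h W t vt₀ m s k i r).const_mul _

theorem not_mem_past {k : ℕ} {i : Fin M} {j : ℕ} :
    ((k + 1, i, j) : ℕ × Fin M × ℕ) ∉ {q : ℕ × Fin M × ℕ | q.1 ≤ k} := by
  simp

/-- Node average and mini-batch average merge into one sum over individual samples. The singleton
factor makes the index set part of the index type of the sample family. -/
theorem avgNoise_eq_sum {k : ℕ} (hm : m (k + 1) ≠ 0) (r : Fin p₁ ⊕ Fin p₂) (ω : Ω) :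
    avgNoise (saddleGrad (expectedLoss f 𝒟)) (dadamPath P f W t vt₀ m s ω)
        (pathGrad P f W t vt₀ m s ω) (k + 1) r =
      ∑ q ∈ ({k + 1} : Finset ℕ) ×ˢ (Finset.univ : Finset (Fin M)) ×ˢ Finset.range (m (k + 1)),
        ((M : ℝ)⁻¹ * (m (k + 1) : ℝ)⁻¹ * (√((dadamPath P f W t vt₀ m s ω k).vt q.2.1 r))⁻¹) *
          gradNoise f 𝒟 r ((dadamPath P f W t vt₀ m s ω (k + 1)).z q.2.1, sampleFamily s q ω) := by
  have hm0 : (m (k + 1) : ℝ) ≠ 0 := by exact_mod_cast hm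
  rw [Finset.sum_product, Finset.sum_singleton, Finset.sum_product, avgNoise, Finset.mul_sum]
  refine Finset.sum_congr rfl fun i _ => ?_
  simp only [pathGrad, batchGrad, PiLp.smul_apply, WithLp.ofLp_sum, Finset.sum_apply, smul_eq_mul,
    Nat.add_sub_cancel, gradNoise, ← Finset.mul_sum, Finset.sum_sub_distrib, Finset.sum_const,
    Finset.card_range, nsmul_eq_mul]
  field_simp

variable [MeasurableSpace Ω]

/-- The samples are independent with law `𝒟`. -/
structure IIDSamples (μ : Measure Ω) (𝒟 : Measure Ξ) (s : ℕ → Fin M → ℕ → Ω → Ξ) : Prop where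
  measurable : ∀ q, Measurable (sampleFamily s q)
  map_eq : ∀ q, μ.map (sampleFamily s q) = 𝒟
  indep : iIndepFun (sampleFamily s) μ

variable {μ : Measure Ω} [IsProbabilityMeasure μ] [IsProbabilityMeasure 𝒟]

/-- The exceptional null set of the gradient bound may depend on the point, and the points here are
random. Since each is independent of the sample used there, `ae_sample` transfers the bound. -/
theorem ae_abs_pathGrad_le (h : LossAssumptions P f 𝒟) (hs : IIDSamples μ 𝒟 s) (hΓ : 0 ≤ P.Ginf) :
    ∀ᵐ ω ∂μ, ∀ k i r, |pathGrad P f W t vt₀ m s ω (k + 1) i r| ≤ P.Ginf := by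
  have h1 : ∀ᵐ ω ∂μ, ∀ k i j r, |saddleGrad (fun y => f y (s (k + 1) i j ω))
      ((dadamPath P f W t vt₀ m s ω (k + 1)).z i) r| ≤ P.Ginf := by
    simp only [ae_all_iff]
    intro k i j r
    refine ae_sample hs.measurable hs.indep hs.map_eq (k + 1, i, j)
      ((measurable_z_past h W t vt₀ m s k i).mono
        (sampleSigma_mono (Set.subset_compl_singleton_iff.2 not_mem_past)) le_rfl)
      (p := fun q => |saddleGrad (fun y => f y q.2) q.1 r| ≤ P.Ginf)
      (measurableSet_le (h.measurable_saddleGrad_apply r).abs measurable_const) ?_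
    intro z
    filter_upwards [h.bounded_grad z] with ξ hξ
    exact hξ r
  filter_upwards [h1] with ω hω k i r
  simp only [pathGrad, batchGrad, PiLp.smul_apply, WithLp.ofLp_sum, Finset.sum_apply, smul_eq_mul]
  rw [abs_mul, abs_of_nonneg (by positivity)]
  have h2 : |∑ j ∈ Finset.range (m (k + 1)), saddleGrad (fun y => f y (s (k + 1) i j ω))
      ((dadamPath P f W t vt₀ m s ω (k + 1)).z i) r| ≤ m (k + 1) * P.Ginf := by
    refine (Finset.abs_sum_le_sum_abs _ _).trans ?_
    refine (Finset.sum_le_card_nsmul _ _ P.Ginf fun j _ => hω k i j r).trans (by simp)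
  refine (mul_le_mul_of_nonneg_left h2 (by positivity)).trans ?_
  rw [← mul_assoc]
  exact mul_le_of_le_one_left hΓ (inv_mul_le_one)

/-- First and second moment of the averaged noise. -/
theorem avgNoise_moments (hP : P.Admissible) (h : LossAssumptions P f 𝒟)
    (hs : IIDSamples μ 𝒟 s) (hM : 1 ≤ M) (h0 : ∀ i r, P.G₀ ^ 2 ≤ vt₀ i r) {k : ℕ}
    (hm : 1 ≤ m (k + 1)) (r : Fin p₁ ⊕ Fin p₂) :
    (∫ ω, avgNoise (saddleGrad (expectedLoss f 𝒟)) (dadamPath P f W t vt₀ m s ω)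
        (pathGrad P f W t vt₀ m s ω) (k + 1) r ^ 2 ∂μ ≤
          P.σ ^ 2 / P.G₀ ^ 2 * (1 / (M * m (k + 1)))) ∧
    ∀ (y : Ω → ℝ) (b : ℝ), Measurable[sampleSigma (sampleFamily s) {q | q.1 ≤ k}] y →
      (∀ᵐ ω ∂μ, |y ω| ≤ b) →
      ∫ ω, avgNoise (saddleGrad (expectedLoss f 𝒟)) (dadamPath P f W t vt₀ m s ω)
        (pathGrad P f W t vt₀ m s ω) (k + 1) r * y ω ∂μ = 0 := by
  have hm0 : (0 : ℝ) < m (k + 1) := by exact_mod_cast hm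
  have hM0 : (0 : ℝ) < M := by exact_mod_cast hM
  simp only [avgNoise_eq_sum (by omega : m (k + 1) ≠ 0)]
  have key := noise_moments hs.measurable hs.indep hs.map_eq
    (h.measurable_gradNoise hP.L_nonneg r) (h.integral_gradNoise r)
    (h.integral_sq_gradNoise_le hP.L_nonneg r) (h.ae_abs_gradNoise_le r)
    (({k + 1} : Finset ℕ) ×ˢ (Finset.univ : Finset (Fin M)) ×ˢ Finset.range (m (k + 1)))
    (Z := fun q ω => (dadamPath P f W t vt₀ m s ω (k + 1)).z q.2.1)
    (c := fun q ω => (M : ℝ)⁻¹ * (m (k + 1) : ℝ)⁻¹ *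
      (√((dadamPath P f W t vt₀ m s ω k).vt q.2.1 r))⁻¹)
    (c₀ := (M : ℝ)⁻¹ * (m (k + 1) : ℝ)⁻¹ * (1 / P.G₀)) (U := {q | q.1 ≤ k})
    (fun q hq => by
      have : q.1 = k + 1 := by simpa using (Finset.mem_product.1 hq).1
      simp [this])
    (fun q _ => measurable_z_past h W t vt₀ m s k q.2.1)
    (fun q _ => (measurable_precond_past h W t vt₀ m s k q.2.1 r).const_mul _)
    (fun q _ ω => by
      rw [abs_of_nonneg (by positivity)]
      have := (dadamRecursion_dadam f W t P.η P.β₁ P.β₂ P.β₃ vt₀ m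
        fun k i j => s k i j ω).inv_sqrt_vt_le hP.β₃_mem hP.G₀_pos h0 k q.2.1 r
      gcongr)
  -- There are `M m` terms, each with squared weight at most `(M m G₀)⁻²`, which leaves the factor
  -- `1 / (M m)`.
  refine ⟨key.1.trans (le_of_eq ?_), key.2⟩
  have := hP.G₀_pos
  simp only [Finset.card_product, Finset.card_singleton, Finset.card_univ, Fintype.card_fin,
    Finset.card_range]
  push_cast
  field_simp

end Path

/-! ### Expected squared gradients at the averaged iterates. -/

section Expectation

/-- The assumptions on one use of DADAM³ over `N` iterations. -/
structure DadamSetting {p₁ p₂ M : ℕ} {Ω Ξ : Type*} [MeasurableSpace Ω] [MeasurableSpace Ξ]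
    (P : DadamParams) (f : JointSpace p₁ p₂ → Ξ → ℝ) (𝒟 : Measure Ξ) (μ : Measure Ω)
    (s : ℕ → Fin M → ℕ → Ω → Ξ) (W : Matrix (Fin M) (Fin M) ℝ) (hW : W.IsHermitian) (t : ℕ)
    (vt₀ : Fin M → JointSpace p₁ p₂) (m : ℕ → ℕ) (C : ℝ) (N : ℕ) : Prop where
  admissible : P.Admissible
  loss : LossAssumptions P f 𝒟
  iid : IIDSamples μ 𝒟 s
  stochastic : W ∈ doublyStochastic ℝ (Fin M)
  rate_lt : mixingRate W hW < 1
  rate_pow_le : mixingRate W hW ^ t ≤ 1 / (1 + C)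
  C_pos : 0 < C
  start : ∀ i r, P.G₀ ^ 2 ≤ vt₀ i r ∧ vt₀ i r ≤ P.Ginf ^ 2
  β₁₁_le : P.β₁₁ ≤ 1
  z_le : ∀ᵐ ω ∂μ, ∀ k < N, ∀ i, ‖(dadamPath P f W t vt₀ m s ω (k + 1)).z i‖ ≤ P.D / 2
  one_le_M : 1 ≤ M
  one_le_m : ∀ k < N, 1 ≤ m (k + 1)

/-- The bound for the distance of the local variables from their averages. -/
noncomputable def consensusBound (p₁ p₂ M : ℕ) (P : DadamParams) (C : ℝ) : ℝ :=
  P.η * (√(M * (p₁ + p₂ : ℕ)) * (P.Ginf / P.G₀)) / C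

theorem DadamParams.Admissible.β₁_mem {P : DadamParams} (hP : P.Admissible) (h : P.β₁₁ ≤ 1)
    (k : ℕ) : P.β₁ k ∈ Set.Icc (0 : ℝ) 1 := by
  have h0 := hP.lam_mem.1.le
  have h1 := hP.β₁₁_nonneg
  refine ⟨by unfold DadamParams.β₁; positivity, ?_⟩
  have h2 : P.lam ^ (k - 1) ≤ 1 := pow_le_one₀ h0 hP.lam_mem.2.le
  exact (mul_le_of_le_one_left (pow_nonneg h0 _) h).trans h2

theorem DadamParams.Admissible.sum_β₁_le {P : DadamParams} (hP : P.Admissible) (h : P.β₁₁ ≤ 1)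
    (N : ℕ) : ∑ k ∈ Finset.range N, P.β₁ (k + 1) ≤ (1 - P.lam)⁻¹ := by
  simp only [DadamParams.β₁, Nat.add_sub_cancel, ← Finset.mul_sum]
  have h1 : ∑ k ∈ Finset.range N, P.lam ^ k ≤ (1 - P.lam)⁻¹ := by
    rw [← one_div, le_div_iff₀ (sub_pos.2 hP.lam_mem.2), geom_sum_mul_neg]
    linarith [pow_nonneg hP.lam_mem.1.le N]
  have h2 : 0 ≤ ∑ k ∈ Finset.range N, P.lam ^ k :=
    Finset.sum_nonneg fun k _ => pow_nonneg hP.lam_mem.1.le k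
  exact (mul_le_of_le_one_left h2 h).trans h1

theorem LossAssumptions.integrable_sq_norm_comp {p₁ p₂ : ℕ} {Ω Ξ : Type*} [MeasurableSpace Ω]
    [MeasurableSpace Ξ] {P : DadamParams} {f : JointSpace p₁ p₂ → Ξ → ℝ} {𝒟 : Measure Ξ}
    {μ : Measure Ω} [IsProbabilityMeasure μ] [IsProbabilityMeasure 𝒟]
    (h : LossAssumptions P f 𝒟) (hL : 0 ≤ P.L) {Y : Ω → JointSpace p₁ p₂} (hY : Measurable Y) :
    Integrable (fun ω => ‖saddleGrad (expectedLoss f 𝒟) (Y ω)‖ ^ 2) μ := by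
  have h1 : Measurable fun ω => saddleGrad (expectedLoss f 𝒟) (Y ω) :=
    (h.continuous_saddleGrad hL).measurable.comp hY
  refine integrable_of_ae_abs_le (c := (p₁ + p₂ : ℕ) * P.Ginf ^ 2) (h1.norm.pow_const 2) ?_
  refine Filter.Eventually.of_forall fun ω => ?_
  rw [abs_of_nonneg (by positivity), EuclideanSpace.real_norm_sq_eq]
  refine (Finset.sum_le_card_nsmul _ _ (P.Ginf ^ 2) fun r _ => ?_).trans (by simp)
  rw [← sq_abs]
  have := h.abs_saddleGrad_le (Y ω) r
  gcongr

namespace DadamSetting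

variable {p₁ p₂ M : ℕ} {Ω Ξ : Type*} [MeasurableSpace Ω] [MeasurableSpace Ξ]
  {P : DadamParams} {f : JointSpace p₁ p₂ → Ξ → ℝ} {𝒟 : Measure Ξ} {μ : Measure Ω}
  {s : ℕ → Fin M → ℕ → Ω → Ξ} {W : Matrix (Fin M) (Fin M) ℝ} {hW : W.IsHermitian} {t : ℕ}
  {vt₀ : Fin M → JointSpace p₁ p₂} {m : ℕ → ℕ} {C : ℝ} {N : ℕ}

theorem G₀_le_Ginf [Nonempty (Fin p₁ ⊕ Fin p₂)]
    (h : DadamSetting P f 𝒟 μ s W hW t vt₀ m C N) : P.G₀ ≤ P.Ginf := by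
  obtain ⟨r⟩ := ‹Nonempty (Fin p₁ ⊕ Fin p₂)›
  have h1 := h.start ⟨0, h.one_le_M⟩ r
  exact le_of_sq_le_sq (h1.1.trans h1.2) h.admissible.Ginf_pos.le

theorem D_nonneg (h : DadamSetting P f 𝒟 μ s W hW t vt₀ m C N) : 0 ≤ P.D := by
  obtain ⟨xs, hxs, -⟩ := h.loss.minty
  linarith [norm_nonneg xs]

theorem consensusBound_nonneg (h : DadamSetting P f 𝒟 μ s W hW t vt₀ m C N) :
    0 ≤ consensusBound p₁ p₂ M P C := by
  have := h.admissible.η_pos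
  have := h.admissible.Ginf_pos
  have := h.admissible.G₀_pos
  have := h.C_pos
  unfold consensusBound
  positivity

theorem measurable_z (h : DadamSetting P f 𝒟 μ s W hW t vt₀ m C N) (k : ℕ) (i : Fin M) :
    Measurable fun ω => (dadamPath P f W t vt₀ m s ω (k + 1)).z i :=
  (measurable_z_past h.loss W t vt₀ m s k i).mono (sampleSigma_le h.iid.measurable _) le_rfl

theorem measurable_zbar (h : DadamSetting P f 𝒟 μ s W hW t vt₀ m C N) (k : ℕ) :
    Measurable fun ω => nodeAvg (dadamPath P f W t vt₀ m s ω (k + 1)).z :=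
  (measurable_zbar_past h.loss W t vt₀ m s k).mono (sampleSigma_le h.iid.measurable _) le_rfl

theorem measurable_avgNoise (h : DadamSetting P f 𝒟 μ s W hW t vt₀ m C N) {k : ℕ} (hk : k < N)
    (r : Fin p₁ ⊕ Fin p₂) :
    Measurable fun ω => avgNoise (saddleGrad (expectedLoss f 𝒟)) (dadamPath P f W t vt₀ m s ω)
      (pathGrad P f W t vt₀ m s ω) (k + 1) r := by
  have hm := h.one_le_m k hk
  simp only [avgNoise_eq_sum (by omega : m (k + 1) ≠ 0)]
  refine Finset.measurable_fun_sum _ fun q _ => Measurable.mul (Measurable.const_mul ?_ _) ?_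
  · exact (measurable_precond_past h.loss W t vt₀ m s k q.2.1 r).mono
      (sampleSigma_le h.iid.measurable _) le_rfl
  · exact (h.loss.measurable_gradNoise h.admissible.L_nonneg r).comp
      ((h.measurable_z k q.2.1).prodMk (h.iid.measurable q))

variable [IsProbabilityMeasure μ] [IsProbabilityMeasure 𝒟]

theorem ae_spread_le (h : DadamSetting P f 𝒟 μ s W hW t vt₀ m C N) :
    ∀ᵐ ω ∂μ, ∀ k, spread (dadamPath P f W t vt₀ m s ω (k + 1)).z ≤
      consensusBound p₁ p₂ M P C := by
  filter_upwards [ae_abs_pathGrad_le (W := W) (t := t) (vt₀ := vt₀) (m := m) h.loss h.iid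
    h.admissible.Ginf_pos.le] with ω hω k
  exact ((dadamRecursion_dadam f W t P.η P.β₁ P.β₂ P.β₃ vt₀ m fun k i j => s k i j ω).spread_le
    h.admissible.β₃_mem h.admissible.η_pos h.admissible.G₀_pos h.admissible.Ginf_pos
    (fun i r => (h.start i r).1) (h.admissible.β₁_mem h.β₁₁_le) (fun k _ => hω k) hW h.stochastic
    h.rate_lt h.C_pos h.rate_pow_le (Nat.le_succ k)).2 le_rfl

theorem ae_abs_avgNoise_le (h : DadamSetting P f 𝒟 μ s W hW t vt₀ m C N) :
    ∀ᵐ ω ∂μ, ∀ k r, |avgNoise (saddleGrad (expectedLoss f 𝒟)) (dadamPath P f W t vt₀ m s ω)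
      (pathGrad P f W t vt₀ m s ω) (k + 1) r| ≤ 1 / P.G₀ * (2 * P.Ginf) := by
  filter_upwards [ae_abs_pathGrad_le (W := W) (t := t) (vt₀ := vt₀) (m := m) h.loss h.iid
    h.admissible.Ginf_pos.le] with ω hω k r
  refine (abs_avg_le_avg_abs _).trans (avg_le_of_le h.one_le_M fun i => ?_)
  rw [abs_mul, Nat.add_sub_cancel, abs_of_nonneg (by positivity)]
  have h1 := (dadamRecursion_dadam f W t P.η P.β₁ P.β₂ P.β₃ vt₀ m
    fun k i j => s k i j ω).inv_sqrt_vt_le h.admissible.β₃_mem h.admissible.G₀_pos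
      (fun i r => (h.start i r).1) k i r
  have h2 : |pathGrad P f W t vt₀ m s ω (k + 1) i r -
      saddleGrad (expectedLoss f 𝒟) ((dadamPath P f W t vt₀ m s ω (k + 1)).z i) r| ≤
      2 * P.Ginf := by
    have h3 := h.loss.abs_saddleGrad_le ((dadamPath P f W t vt₀ m s ω (k + 1)).z i) r
    exact (abs_sub _ _).trans (by linarith [hω k i r])
  have := h.admissible.G₀_pos
  gcongr

/-- Almost every sample path gives a run of the optimistic gradient method, with a bound for the
sum of the errors. -/
theorem ae_optimisticRun (h : DadamSetting P f 𝒟 μ s W hW t vt₀ m C N)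
    (hδ : consensusBound p₁ p₂ M P C ≤ 1) {xs : JointSpace p₁ p₂} (hxs : ‖xs‖ ≤ P.D / 2)
    (hmin : ∀ x, 0 ≤ inner ℝ (x - xs) (saddleGrad (expectedLoss f 𝒟) x)) :
    ∀ᵐ ω ∂μ, ∃ (x d e : ℕ → Fin p₁ ⊕ Fin p₂ → ℝ) (τ : ℕ → ℝ),
      OptimisticRun P.G₀ P.Ginf P.L P.η P.D
        ((p₁ + p₂ : ℕ) * (P.Ginf / P.G₀) + 2 * P.Ginf / P.G₀ + P.L / P.G₀) N x
        (fun k r => nodeAvg (dadamPath P f W t vt₀ m s ω k).z r) d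
        (avgNoise (saddleGrad (expectedLoss f 𝒟)) (dadamPath P f W t vt₀ m s ω)
          (pathGrad P f W t vt₀ m s ω)) e
        (fun k r => saddleGrad (expectedLoss f 𝒟) (nodeAvg (dadamPath P f W t vt₀ m s ω k).z) r)
        (avgPrecond (dadamPath P f W t vt₀ m s ω)) τ (fun r => xs r) ∧
      ∑ k ∈ Finset.range N, τ (k + 1) ≤ (p₁ + p₂ : ℕ) * (P.Ginf / P.G₀) +
        2 * P.Ginf / P.G₀ * (1 - P.lam)⁻¹ + N * (P.L * consensusBound p₁ p₂ M P C / P.G₀) := by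
  have hP := h.admissible
  have hg := hP.G₀_pos
  have hΓ := hP.Ginf_pos
  filter_upwards [ae_abs_pathGrad_le (W := W) (t := t) (vt₀ := vt₀) (m := m) h.loss h.iid
    hΓ.le, h.ae_spread_le, h.z_le] with ω hω hsp hz
  have R := dadamRecursion_dadam f W t P.η P.β₁ P.β₂ P.β₃ vt₀ m fun k i j => s k i j ω
  refine ⟨_, _, _, _, R.optimisticRun (N := N) (hP.β₁_mem h.β₁₁_le) hP.β₂_mem hP.β₃_mem h.one_le_M
    hg hΓ h.start (fun k _ => hω k) hW h.stochastic hP.L_nonneg h.consensusBound_nonneg hδ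
    (fun k _ => hsp k) h.loss.lipschitz h.loss.abs_saddleGrad_le hxs hmin hz, ?_⟩
  rw [DadamRecursion.sum_errorBound]
  have h1 : ∑ r, (avgPrecond (dadamPath P f W t vt₀ m s ω) 0 r -
      avgPrecond (dadamPath P f W t vt₀ m s ω) N r) ≤ (p₁ + p₂ : ℕ) * (1 / P.G₀) := by
    refine (Finset.sum_le_card_nsmul _ _ (1 / P.G₀) fun r _ => ?_).trans (by simp)
    have h2 : avgPrecond (dadamPath P f W t vt₀ m s ω) 0 r ≤ 1 / P.G₀ :=
      avg_le_of_le h.one_le_M fun i =>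
        R.inv_sqrt_vt_le hP.β₃_mem hg (fun i r => (h.start i r).1) 0 i r
    have h3 : 0 ≤ avgPrecond (dadamPath P f W t vt₀ m s ω) N r := by
      unfold avgPrecond; positivity
    linarith
  have h4 := mul_le_mul_of_nonneg_left h1 hΓ.le
  have h5 : P.Ginf * ((p₁ + p₂ : ℕ) * (1 / P.G₀)) = (p₁ + p₂ : ℕ) * (P.Ginf / P.G₀) := by ring
  have h6 := mul_le_mul_of_nonneg_left (hP.sum_β₁_le h.β₁₁_le N)
    (by positivity : 0 ≤ 2 * P.Ginf / P.G₀)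
  linarith

end DadamSetting

/-- Bound for the sum of the expected squared gradients at the averaged iterates. -/
theorem exists_sum_integral_sq_norm_le (p₁ p₂ : ℕ) (P : DadamParams) (hP : P.Admissible)
    (hgΓ : P.G₀ ≤ P.Ginf) (hD : 0 ≤ P.D) :
    ∃ B : ℝ, 0 ≤ B ∧ ∀ (M n : ℕ) (Ω : Type*) (Ξ : Type*) [MeasurableSpace Ω] [MeasurableSpace Ξ]
      (f : JointSpace p₁ p₂ → Ξ → ℝ) (𝒟 : Measure Ξ) (μ : Measure Ω) [IsProbabilityMeasure μ]
      [IsProbabilityMeasure 𝒟] (s : ℕ → Fin M → ℕ → Ω → Ξ) (W : Matrix (Fin M) (Fin M) ℝ)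
      (hW : W.IsHermitian) (t : ℕ) (vt₀ : Fin M → JointSpace p₁ p₂) (m : ℕ → ℕ) (C : ℝ),
      DadamSetting P f 𝒟 μ s W hW t vt₀ m C (n + 1) → consensusBound p₁ p₂ M P C ≤ 1 →
      ∑ k ∈ Finset.range (n + 1), ∫ ω, ‖saddleGrad (expectedLoss f 𝒟)
          (nodeAvg (dadamPath P f W t vt₀ m s ω (k + 1)).z)‖ ^ 2 ∂μ ≤
        B + B * ((n + 1 : ℕ) * consensusBound p₁ p₂ M P C)
          + B * ∑ k ∈ Finset.range (n + 1), (1 / (M * m (k + 1)) : ℝ) := by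
  have hg := hP.G₀_pos
  have hΓ := hP.Ginf_pos
  have hL := hP.L_nonneg
  have hlam : 0 < 1 - P.lam := sub_pos.2 hP.lam_mem.2
  obtain ⟨K, K', hK, hpath⟩ := exists_sum_sq_gradient_le (Fin p₁ ⊕ Fin p₂) P.G₀ P.Ginf P.L P.η P.D
    ((p₁ + p₂ : ℕ) * (P.Ginf / P.G₀) + 2 * P.Ginf / P.G₀ + P.L / P.G₀) hg hgΓ hP.η_pos hP.η_le hD
    (by positivity)
  set c := (p₁ + p₂ : ℕ) * (P.Ginf / P.G₀) + 2 * P.Ginf / P.G₀ * (1 - P.lam)⁻¹ with hc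
  have hc0 : 0 ≤ c := by positivity
  set q := (p₁ + p₂ : ℕ) * (P.σ ^ 2 / P.G₀ ^ 2) with hq
  have hq0 : 0 ≤ q := by positivity
  refine ⟨K * (1 + c + P.L / P.G₀ + q), by positivity, ?_⟩
  intro M n Ω Ξ _ _ f 𝒟 μ _ _ s W hW t vt₀ m C h hδ
  obtain ⟨xs, hxs, hmin⟩ := h.loss.minty
  set δ := consensusBound p₁ p₂ M P C with hδd
  have hδ0 : 0 ≤ δ := h.consensusBound_nonneg
  set ν : ℕ → (Fin p₁ ⊕ Fin p₂) → Ω → ℝ := fun k r ω =>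
    avgNoise (saddleGrad (expectedLoss f 𝒟)) (dadamPath P f W t vt₀ m s ω)
      (pathGrad P f W t vt₀ m s ω) k r with hν
  set y : ℕ → (Fin p₁ ⊕ Fin p₂) → Ω → ℝ := fun k r ω =>
    (nodeAvg (dadamPath P f W t vt₀ m s ω (k + 2)).z r - xs r) *
      (avgPrecond (dadamPath P f W t vt₀ m s ω) (k + 1) r)⁻¹ with hy
  have hrun := h.ae_optimisticRun hδ hxs hmin
  have hνm : ∀ k < n + 1, ∀ r, Measurable (ν (k + 1) r) := fun k hk r =>
    h.measurable_avgNoise hk r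
  -- The cofactor of the noise of iteration `k + 2` involves `z (k + 2)` and the preconditioner of
  -- iteration `k + 1`, both functions of the samples up to iteration `k + 1`.
  have hymp : ∀ k r, Measurable[sampleSigma (sampleFamily s) {q | q.1 ≤ k + 1}] (y k r) :=
    fun k r => Measurable.mul (Measurable.sub_const
      (measurable_coord (measurable_zbar_past h.loss W t vt₀ m s (k + 1)) r) _)
      (measurable_inv.comp (measurable_avgPrecond_past h.loss W t vt₀ m s (k + 1) r))
  have hyb : ∀ k < n, ∀ r, ∀ᵐ ω ∂μ, |y k r ω| ≤ P.D * P.Ginf := by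
    intro k hk r
    filter_upwards [hrun] with ω ⟨x, d, e, τ, R, _⟩
    rw [hy, abs_mul]
    have h1 := R.z_le (k + 1) (by omega) r
    have h2 := R.inv_H_le hΓ (by omega : k + 1 ≤ n + 1) r
    have h3 := R.H_pos hΓ (by omega : k + 1 ≤ n + 1) r
    rw [abs_of_pos (inv_pos.2 h3)]
    exact mul_le_mul h1 h2 (inv_pos.2 h3).le hD
  have hint1 : ∀ k < n + 1, ∀ r, Integrable (fun ω => ν (k + 1) r ω ^ 2) μ := by
    intro k hk r
    refine integrable_of_ae_abs_le (c := (1 / P.G₀ * (2 * P.Ginf)) ^ 2)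
      ((hνm k hk r).pow_const 2) ?_
    filter_upwards [h.ae_abs_avgNoise_le] with ω hω
    rw [abs_pow]
    exact pow_le_pow_left₀ (abs_nonneg _) (hω k r) 2
  have hint2 : ∀ k < n, ∀ r, Integrable (fun ω => ν (k + 2) r ω * y k r ω) μ := by
    intro k hk r
    refine integrable_of_ae_abs_le (c := (1 / P.G₀ * (2 * P.Ginf)) * (P.D * P.Ginf))
      ((hνm (k + 1) (by omega) r).mul
        ((hymp k r).mono (sampleSigma_le h.iid.measurable _) le_rfl)) ?_
    filter_upwards [h.ae_abs_avgNoise_le, hyb k hk r] with ω hω h2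
    rw [abs_mul]
    exact mul_le_mul (hω (k + 1) r) h2 (abs_nonneg _) (by positivity)
  have hI1 : Integrable (fun ω => ∑ k ∈ Finset.range (n + 1), ∑ r, ν (k + 1) r ω ^ 2) μ :=
    integrable_finsetSum _ fun k hk => integrable_finsetSum _ fun r _ =>
      hint1 k (Finset.mem_range.1 hk) r
  have hI2 : Integrable (fun ω => ∑ k ∈ Finset.range n, ∑ r, ν (k + 2) r ω * y k r ω) μ :=
    integrable_finsetSum _ fun k hk => integrable_finsetSum _ fun r _ =>
      hint2 k (Finset.mem_range.1 hk) r
  have hmom := fun k (hk : k < n + 1) r =>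
    avgNoise_moments (W := W) (t := t) hP h.loss h.iid h.one_le_M (fun i r => (h.start i r).1)
      (h.one_le_m k hk) r
  have hE1 : ∫ ω, ∑ k ∈ Finset.range (n + 1), ∑ r, ν (k + 1) r ω ^ 2 ∂μ ≤
      q * ∑ k ∈ Finset.range (n + 1), (1 / (M * m (k + 1)) : ℝ) := by
    rw [integral_finsetSum _ fun k hk => integrable_finsetSum _ fun r _ =>
      hint1 k (Finset.mem_range.1 hk) r, Finset.mul_sum]
    refine Finset.sum_le_sum fun k hk => ?_
    rw [integral_finsetSum _ fun r _ => hint1 k (Finset.mem_range.1 hk) r]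
    refine (Finset.sum_le_card_nsmul _ _ _ fun r _ =>
      (hmom k (Finset.mem_range.1 hk) r).1).trans (le_of_eq ?_)
    simp [hq, mul_assoc]
  -- The linear noise term has mean zero because its cofactors are predictable and bounded.
  have hE2 : ∫ ω, ∑ k ∈ Finset.range n, ∑ r, ν (k + 2) r ω * y k r ω ∂μ = 0 := by
    rw [integral_finsetSum _ fun k hk => integrable_finsetSum _ fun r _ =>
      hint2 k (Finset.mem_range.1 hk) r]
    refine Finset.sum_eq_zero fun k hk => ?_
    have hk := Finset.mem_range.1 hk
    rw [integral_finsetSum _ fun r _ => hint2 k hk r]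
    exact Finset.sum_eq_zero fun r _ => (hmom (k + 1) (by omega) r).2 _ _ (hymp k r) (hyb k hk r)
  have hIF : ∀ k ∈ Finset.range (n + 1), Integrable (fun ω => ‖saddleGrad (expectedLoss f 𝒟)
      (nodeAvg (dadamPath P f W t vt₀ m s ω (k + 1)).z)‖ ^ 2) μ := fun k _ =>
    h.loss.integrable_sq_norm_comp hL (h.measurable_zbar k)
  rw [← integral_finsetSum _ hIF]
  set a := K + K * (c + (n + 1 : ℕ) * (P.L * δ / P.G₀)) with ha
  have hmain : ∫ ω, ∑ k ∈ Finset.range (n + 1), ‖saddleGrad (expectedLoss f 𝒟)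
      (nodeAvg (dadamPath P f W t vt₀ m s ω (k + 1)).z)‖ ^ 2 ∂μ ≤
      ∫ ω, ((a + K * ∑ k ∈ Finset.range (n + 1), ∑ r, ν (k + 1) r ω ^ 2) +
        K' * ∑ k ∈ Finset.range n, ∑ r, ν (k + 2) r ω * y k r ω) ∂μ := by
    refine integral_mono_ae (integrable_finsetSum _ hIF)
      (((integrable_const a).add (hI1.const_mul K)).add (hI2.const_mul K')) ?_
    filter_upwards [hrun] with ω ⟨x, d, e, τ, R, hτ⟩
    have h1 := hpath n _ _ _ _ _ _ _ _ _ R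
    have h2 := mul_le_mul_of_nonneg_left hτ hK
    simp only [EuclideanSpace.real_norm_sq_eq]
    refine h1.trans ?_
    simp only [ha, hν, hy]
    linarith
  have hI3 : Integrable (fun ω => a + K * ∑ k ∈ Finset.range (n + 1), ∑ r, ν (k + 1) r ω ^ 2) μ :=
    (integrable_const a).add (hI1.const_mul K)
  rw [integral_add hI3 (hI2.const_mul K'),
    integral_add (integrable_const a) (hI1.const_mul K), integral_const_mul, integral_const_mul,
    hE2] at hmain
  simp only [integral_const, probReal_univ, one_smul, mul_zero, add_zero] at hmain
  refine hmain.trans ?_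
  have h1 := mul_le_mul_of_nonneg_left hE1 hK
  set V := ∑ k ∈ Finset.range (n + 1), (1 / (M * m (k + 1)) : ℝ) with hV
  have hV0 : 0 ≤ V := Finset.sum_nonneg fun k _ => by positivity
  have h2 : 0 ≤ (1 + c + P.L / P.G₀) * V := by positivity
  have h3 : 0 ≤ (1 + c + q) * ((n + 1 : ℕ) * δ) := by positivity
  have h4 : 0 ≤ P.L / P.G₀ + q := by positivity
  have h5 : K * (1 + c + P.L / P.G₀ + q) + K * (1 + c + P.L / P.G₀ + q) * ((n + 1 : ℕ) * δ) +
      K * (1 + c + P.L / P.G₀ + q) * V - (a + K * (q * V)) =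
      K * ((P.L / P.G₀ + q) + (1 + c + q) * ((n + 1 : ℕ) * δ) +
        (1 + c + P.L / P.G₀) * V) := by
    rw [ha]; ring
  have h6 : 0 ≤ K * ((P.L / P.G₀ + q) + (1 + c + q) * ((n + 1 : ℕ) * δ) +
        (1 + c + P.L / P.G₀) * V) := by positivity
  linarith

end Expectation

/-! ### From the summed bound to equilibria and rates. -/

section Rates

/-- The degenerate case of dimension zero. It is separate because `G₀ ≤ G_∞` is deduced from a
coordinate of the starting values. -/
theorem findsSFNE_of_isEmpty (p₁ p₂ : ℕ) [IsEmpty (Fin p₁ ⊕ Fin p₂)] (P : DadamParams) (ε : ℝ)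
    (M N : ℕ) (m : ℕ → ℕ) (C : ℝ) (hN : 1 ≤ N) : FindsSFNE.{u, v} p₁ p₂ P ε M N m C := by
  intro Ξ _ 𝒟 _ f Ω _ μ _ s W hW t vt₀ _ _ _ _ _ _ _ _ _ _ _
  have hsub : Subsingleton (JointSpace p₁ p₂) := ⟨fun a b => by ext i; exact isEmptyElim i⟩
  have h : ∀ Y : Ω → JointSpace p₁ p₂, IsSFNE μ (expectedLoss f 𝒟) Y ε := by
    intro Y
    have h0 : ∀ ω, saddleGrad (expectedLoss f 𝒟) (Y ω) = 0 := fun ω => Subsingleton.elim _ _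
    refine ⟨measurable_of_subsingleton_codomain Y, ?_, ?_⟩ <;> simp [h0, sq_nonneg]
  exact ⟨1, by simpa using hN, h _, fun i => h _⟩

/-- The three smallness conditions match the three terms of the summed bound: consensus, initial
constant and variance. The regimes of the theorem only have to verify them. -/
theorem exists_findsSFNE (p₁ p₂ : ℕ) (P : DadamParams) (hP : P.Admissible) :
    ∃ B : ℝ, 0 < B ∧ ∀ (ε : ℝ), 0 < ε → ε ≤ 1 → ∀ (M N : ℕ) (m : ℕ → ℕ) (C : ℝ),
      1 ≤ M → 1 ≤ N → 0 < C → (∀ k ∈ Finset.Icc 1 N, 1 ≤ m k) →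
      B * (√M / C) ≤ ε ^ 2 → B ≤ ε ^ 2 * N →
      B * ∑ k ∈ Finset.range N, (1 / (M * m (k + 1)) : ℝ) ≤ ε ^ 2 * N →
      FindsSFNE.{u, v} p₁ p₂ P ε M N m C := by
  rcases isEmpty_or_nonempty (Fin p₁ ⊕ Fin p₂) with hE | hE
  · exact ⟨1, one_pos, fun ε _ _ M N m C _ hN _ _ _ _ _ =>
      findsSFNE_of_isEmpty p₁ p₂ P ε M N m C hN⟩
  have hg := hP.G₀_pos
  have hΓ := hP.Ginf_pos
  have hL := hP.L_nonneg
  have hη := hP.η_pos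
  obtain ⟨B, hB0, hB⟩ : ∃ B : ℝ, 0 ≤ B ∧ ∀ (M n : ℕ) (Ω : Type v) (Ξ : Type u) [MeasurableSpace Ω]
      [MeasurableSpace Ξ]
      (f : JointSpace p₁ p₂ → Ξ → ℝ) (𝒟 : Measure Ξ) (μ : Measure Ω) [IsProbabilityMeasure μ]
      [IsProbabilityMeasure 𝒟] (s : ℕ → Fin M → ℕ → Ω → Ξ) (W : Matrix (Fin M) (Fin M) ℝ)
      (hW : W.IsHermitian) (t : ℕ) (vt₀ : Fin M → JointSpace p₁ p₂) (m : ℕ → ℕ) (C : ℝ),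
      DadamSetting P f 𝒟 μ s W hW t vt₀ m C (n + 1) → consensusBound p₁ p₂ M P C ≤ 1 →
      ∑ k ∈ Finset.range (n + 1), ∫ ω, ‖saddleGrad (expectedLoss f 𝒟)
          (nodeAvg (dadamPath P f W t vt₀ m s ω (k + 1)).z)‖ ^ 2 ∂μ ≤
        B + B * ((n + 1 : ℕ) * consensusBound p₁ p₂ M P C)
          + B * ∑ k ∈ Finset.range (n + 1), (1 / (M * m (k + 1)) : ℝ) := by
    -- The constant is chosen before any instance is given. If these inequalities fail, no instance
    -- satisfies the assumptions, and any constant works.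
    by_cases h : P.G₀ ≤ P.Ginf ∧ 0 ≤ P.D
    · exact exists_sum_integral_sq_norm_le p₁ p₂ P hP h.1 h.2
    · refine ⟨0, le_rfl, ?_⟩
      intro M n Ω Ξ _ _ f 𝒟 μ _ _ s W hW t vt₀ m C hS
      exact absurd ⟨hS.G₀_le_Ginf, hS.D_nonneg⟩ h
  set q := P.η * √(p₁ + p₂ : ℕ) * (P.Ginf / P.G₀) with hq
  have hq0 : 0 ≤ q := by positivity
  -- The factor `12` gives each of the three terms a share `ε² / 12`, in total `ε² / 4` on average.
  -- The summand `2 L q` gives `L δ ≤ ε² / 2`. For the local iterates this yields `2 · ε²/4 + 2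
  -- (ε²/2)² ≤ ε²`.
  refine ⟨12 * (B + 1) * (q + 1) + 2 * P.L * q, by positivity, ?_⟩
  intro ε hε hε1 M N m C hM hN hC hm hMC hBN hsum
  obtain ⟨n, rfl⟩ : ∃ n, N = n + 1 := ⟨N - 1, by omega⟩
  intro Ξ _ 𝒟 _ f Ω _ μ _ s W hW t vt₀ hloss hsm hsD hsi hd hρ ht hlog hvt hβ hz
  have hε2 : ε ^ 2 ≤ 1 := pow_le_one₀ hε.le hε1
  have hδq : consensusBound p₁ p₂ M P C = q * (√M / C) := by
    rw [consensusBound, Real.sqrt_mul (by positivity), hq]; ring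
  set δ := consensusBound p₁ p₂ M P C with hδ
  have hr0 : 0 ≤ √M / C := by positivity
  have hδ0 : 0 ≤ δ := by rw [hδq]; positivity
  have hBq : 0 ≤ B * q * (√M / C) := by positivity
  have hLq : 0 ≤ P.L * q * (√M / C) := by positivity
  have hqr : 0 ≤ q * (√M / C) := by positivity
  have hBr : 0 ≤ B * (√M / C) := by positivity
  have hexp : (12 * (B + 1) * (q + 1) + 2 * P.L * q) * (√M / C) =
      12 * (B * q * (√M / C)) + 12 * (B * (√M / C)) + 12 * (q * (√M / C)) + 12 * (√M / C) +
        2 * (P.L * q * (√M / C)) := by ring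
  rw [hexp] at hMC
  have hδ1 : δ ≤ 1 := by rw [hδq]; linarith
  have hBδ : B * δ ≤ ε ^ 2 / 12 := by rw [hδq, ← mul_assoc]; linarith
  have hLδ : P.L * δ ≤ ε ^ 2 / 2 := by rw [hδq, ← mul_assoc]; linarith
  have hS : DadamSetting P f 𝒟 μ s W hW t vt₀ m C (n + 1) :=
    { admissible := hP
      loss := hloss
      iid := ⟨fun q => hsm q.1 q.2.1 q.2.2, fun q => hsD q.1 q.2.1 q.2.2, hsi⟩
      stochastic := hd
      rate_lt := hρ
      rate_pow_le := mixingRate_pow_le hW hρ ht hC hlog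
      C_pos := hC
      start := hvt
      β₁₁_le := hβ.trans (div_le_one_of_le₀ (le_add_of_nonneg_right (Real.sqrt_nonneg _))
        (by positivity))
      z_le := by
        filter_upwards [hz] with ω hω k hk i
        exact hω (k + 1) (Finset.mem_Icc.2 ⟨by omega, by omega⟩) i
      one_le_M := hM
      one_le_m := fun k hk => hm (k + 1) (Finset.mem_Icc.2 ⟨by omega, by omega⟩) }
  have htot := hB M n Ω Ξ f 𝒟 μ s W hW t vt₀ m C hS hδ1
  set V := ∑ k ∈ Finset.range (n + 1), (1 / (M * m (k + 1)) : ℝ) with hV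
  have hV0 : 0 ≤ V := Finset.sum_nonneg fun k _ => by positivity
  have hN0 : (0 : ℝ) < (n + 1 : ℕ) := by positivity
  have hB1 : 12 * B ≤ 12 * (B + 1) * (q + 1) + 2 * P.L * q := by
    have : 0 ≤ B * q := by positivity
    have : 0 ≤ P.L * q := by positivity
    linarith
  have hBV : 12 * (B * V) ≤ ε ^ 2 * (n + 1 : ℕ) := by
    have := mul_le_mul_of_nonneg_right hB1 hV0
    linarith
  have hBN' : B ≤ ε ^ 2 * (n + 1 : ℕ) / 12 := by linarith
  have hBδN : B * ((n + 1 : ℕ) * δ) ≤ ε ^ 2 / 12 * (n + 1 : ℕ) := by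
    have := mul_le_mul_of_nonneg_right hBδ hN0.le
    linarith
  obtain ⟨k, hk, hkE⟩ : ∃ k ∈ Finset.range (n + 1), ∫ ω, ‖saddleGrad (expectedLoss f 𝒟)
      (nodeAvg (dadamPath P f W t vt₀ m s ω (k + 1)).z)‖ ^ 2 ∂μ ≤ ε ^ 2 / 4 := by
    refine Finset.exists_le_of_sum_le (by simp) ?_
    rw [Finset.sum_const, Finset.card_range, nsmul_eq_mul]
    linarith
  have hk' := Finset.mem_range.1 hk
  have hεsq := sq_nonneg ε
  refine ⟨k + 1, Finset.mem_Icc.2 ⟨by omega, by omega⟩,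
    ⟨hS.measurable_zbar k, hloss.integrable_sq_norm_comp hL (hS.measurable_zbar k),
      hkE.trans (by linarith)⟩, fun i => ⟨hS.measurable_z k i,
      hloss.integrable_sq_norm_comp hL (hS.measurable_z k i), ?_⟩⟩
  have hI := hloss.integrable_sq_norm_comp (μ := μ) hL (hS.measurable_zbar k)
  calc ∫ ω, ‖saddleGrad (expectedLoss f 𝒟) ((dadamPath P f W t vt₀ m s ω (k + 1)).z i)‖ ^ 2 ∂μ
      ≤ ∫ ω, (2 * ‖saddleGrad (expectedLoss f 𝒟)
          (nodeAvg (dadamPath P f W t vt₀ m s ω (k + 1)).z)‖ ^ 2 + 2 * (P.L * δ) ^ 2) ∂μ := by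
        refine integral_mono_ae (hloss.integrable_sq_norm_comp hL (hS.measurable_z k i))
          ((hI.const_mul 2).add (integrable_const _)) ?_
        filter_upwards [hS.ae_spread_le] with ω hω
        set a := saddleGrad (expectedLoss f 𝒟) ((dadamPath P f W t vt₀ m s ω (k + 1)).z i)
        set b := saddleGrad (expectedLoss f 𝒟)
          (nodeAvg (dadamPath P f W t vt₀ m s ω (k + 1)).z)
        have h1 : ‖a - b‖ ≤ P.L * δ := (hloss.lipschitz _ _).trans
          (mul_le_mul_of_nonneg_left ((norm_sub_nodeAvg_le_spread _ i).trans (hω k)) hL)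
        have h2 : ‖a‖ ≤ ‖b‖ + P.L * δ := by
          have := norm_add_le b (a - b)
          rw [add_sub_cancel] at this
          linarith
        have h3 := pow_le_pow_left₀ (norm_nonneg a) h2 2
        have h4 := sq_nonneg (‖b‖ - P.L * δ)
        linarith
    _ = 2 * ∫ ω, ‖saddleGrad (expectedLoss f 𝒟)
          (nodeAvg (dadamPath P f W t vt₀ m s ω (k + 1)).z)‖ ^ 2 ∂μ + 2 * (P.L * δ) ^ 2 := by
        rw [integral_add (hI.const_mul 2) (integrable_const _), integral_const_mul]
        simp
    _ ≤ ε ^ 2 := by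
        have h0 : 0 ≤ P.L * δ := by positivity
        have h1 : (P.L * δ) ^ 2 ≤ (ε ^ 2 / 2) ^ 2 := pow_le_pow_left₀ h0 hLδ 2
        have h2 : (ε ^ 2 / 2) ^ 2 ≤ ε ^ 2 / 4 := by
          have := mul_le_mul_of_nonneg_left hε2 hεsq
          linarith
        linarith

theorem sum_one_div_add_two_le (N : ℕ) {M : ℕ} (hM : 1 ≤ M) :
    ∑ k ∈ Finset.range N, (1 / (M * ((k + 1 + 1 : ℕ) : ℝ)) : ℝ) ≤ 1 + Real.log N := by
  have h := harmonic_le_one_add_log N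
  rw [harmonic] at h
  push_cast at h
  refine (Finset.sum_le_sum fun k _ => ?_).trans h
  have hM1 : (1 : ℝ) ≤ M := by exact_mod_cast hM
  rw [one_div]
  refine inv_anti₀ (by positivity) ?_
  push_cast
  nlinarith [(Nat.cast_nonneg k : (0 : ℝ) ≤ k)]

/-- `B (1 + log N) ≤ ε² N` once `N` is at least a multiple of `ε⁻² (1 + log (1 / ε))`. -/
theorem mul_one_add_log_le {B ε x : ℝ} (hB : 0 < B) (hε : 0 < ε) (hε1 : ε ≤ 1) (hx : 0 < x)
    (h : 2 * B * (|Real.log (2 * B)| + 2) * (1 + Real.log (1 / ε)) ≤ ε ^ 2 * x) :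
    B * (1 + Real.log x) ≤ ε ^ 2 * x := by
  have hℓ : 0 ≤ Real.log (1 / ε) := Real.log_nonneg (by rw [le_div_iff₀ hε]; linarith)
  -- The tangent to the logarithm at `a` gives `log x ≤ log a + x/a - 1`; this `a` makes `B x / a`
  -- exactly half of the right-hand side.
  set a := 2 * B / ε ^ 2 with ha
  have ha0 : 0 < a := by positivity
  have h1 : Real.log x ≤ Real.log a + x / a - 1 := by
    have := Real.log_le_sub_one_of_pos (div_pos hx ha0)
    rw [Real.log_div hx.ne' ha0.ne'] at this
    linarith
  have h2 : Real.log a = Real.log (2 * B) + 2 * Real.log (1 / ε) := by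
    rw [ha, Real.log_div (by positivity) (by positivity), Real.log_pow, one_div, Real.log_inv]
    push_cast
    ring
  have h3 : Real.log a ≤ (|Real.log (2 * B)| + 2) * (1 + Real.log (1 / ε)) := by
    rw [h2]
    have := le_abs_self (Real.log (2 * B))
    have := mul_nonneg (abs_nonneg (Real.log (2 * B))) hℓ
    linarith
  have h4 : B * (x / a) = ε ^ 2 * x / 2 := by
    rw [ha]; field_simp
  have h5 := mul_le_mul_of_nonneg_left h1 hB.le
  have h6 := mul_le_mul_of_nonneg_left h3 hB.le
  linarith

theorem one_le_one_add_log {ε : ℝ} (hε : 0 < ε) (hε1 : ε ≤ 1) : 1 ≤ 1 + Real.log (1 / ε) :=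
  le_add_of_nonneg_right (Real.log_nonneg (by rw [le_div_iff₀ hε]; linarith))

theorem le_sq_mul_of_div_le {K ε N : ℝ} (hK : 0 < K) (hε : 0 < ε) (hε1 : ε ≤ 1)
    (h : K / ε ^ 2 * (1 + Real.log (1 / ε)) ≤ N) : K ≤ ε ^ 2 * N ∧ 0 < N ∧
      K * (1 + Real.log (1 / ε)) ≤ ε ^ 2 * N := by
  have h1 := one_le_one_add_log hε hε1
  have h2 : 0 < K / ε ^ 2 * (1 + Real.log (1 / ε)) := by positivity
  rw [div_mul_eq_mul_div, div_le_iff₀ (by positivity)] at h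
  refine ⟨?_, ?_, by linarith⟩
  · nlinarith
  · have h3 : 0 < N * ε ^ 2 := lt_of_lt_of_le (by positivity) h
    exact (mul_pos_iff_of_pos_right (by positivity)).1 h3

end Rates

/-! ### The three parameter regimes. -/

theorem corollary2 (p₁ p₂ : ℕ) (P : DadamParams) (hP : P.Admissible) :
    -- (a) batch size of order `ε⁻²`, a bounded number of nodes, `C` of order `ε⁻²`
    (∀ M₀ : ℕ, ∃ K : ℝ, 0 < K ∧ ∀ ε : ℝ, 0 < ε → ε ≤ 1 →
      ∀ (M N : ℕ) (m : ℕ → ℕ) (C : ℝ), 1 ≤ M → M ≤ M₀ →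
        K / ε ^ 2 * (1 + Real.log (1 / ε)) ≤ N →
        (∀ k ∈ Finset.Icc 1 N, K / ε ^ 2 ≤ m k) →
        K / ε ^ 2 ≤ C →
        FindsSFNE.{u, v} p₁ p₂ P ε M N m C) ∧
    -- (b) batch size `k + 1` at iteration `k`, a bounded number of nodes, `C` of order `ε⁻²`
    (∀ M₀ : ℕ, ∃ K : ℝ, 0 < K ∧ ∀ ε : ℝ, 0 < ε → ε ≤ 1 →
      ∀ (M N : ℕ) (C : ℝ), 1 ≤ M → M ≤ M₀ →
        K / ε ^ 2 * (1 + Real.log (1 / ε)) ≤ N →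
        K / ε ^ 2 ≤ C →
        FindsSFNE.{u, v} p₁ p₂ P ε M N (fun k => k + 1) C) ∧
    -- (c) batch size of order `1`, a number of nodes of order `ε⁻²`, `C` of order `ε⁻⁴`
    (∃ A : ℝ, 0 < A ∧ ∀ A' : ℝ, A ≤ A' → ∃ K : ℝ, 0 < K ∧ ∀ ε : ℝ, 0 < ε → ε ≤ 1 →
      ∀ (M N : ℕ) (m : ℕ → ℕ) (C : ℝ), A / ε ^ 2 ≤ M → (M : ℝ) ≤ A' / ε ^ 2 →
        K / ε ^ 2 * (1 + Real.log (1 / ε)) ≤ N →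
        (∀ k ∈ Finset.Icc 1 N, 1 ≤ m k) →
        K / ε ^ 4 ≤ C →
        FindsSFNE.{u, v} p₁ p₂ P ε M N m C) := by
  obtain ⟨B, hB, hfind⟩ := exists_findsSFNE.{u, v} p₁ p₂ P hP
  -- the consensus error for a bounded number of nodes
  have hconsensus : ∀ {M₀ M : ℕ} {K ε C : ℝ}, 0 < ε → 0 < K → M ≤ M₀ → B * (1 + √M₀) ≤ K →
      K / ε ^ 2 ≤ C → 0 < C ∧ B * (√M / C) ≤ ε ^ 2 := by
    intro M₀ M K ε C hε hK hM hBK hC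
    have hC0 : 0 < C := lt_of_lt_of_le (by positivity) hC
    refine ⟨hC0, ?_⟩
    rw [div_le_iff₀ (by positivity)] at hC
    rw [← mul_div_assoc, div_le_iff₀ hC0]
    have h1 : √(M : ℝ) ≤ √M₀ := Real.sqrt_le_sqrt (by exact_mod_cast hM)
    have h2 := mul_le_mul_of_nonneg_left h1 hB.le
    linarith
  refine ⟨fun M₀ => ?_, fun M₀ => ?_, ?_⟩
  · refine ⟨B * (1 + √M₀), by positivity, ?_⟩
    intro ε hε hε1 M N m C hM hM₀ hN hm hC
    have hK : 0 < B * (1 + √(M₀ : ℝ)) := by positivity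
    have hBK : B ≤ B * (1 + √(M₀ : ℝ)) :=
      le_mul_of_one_le_right hB.le (le_add_of_nonneg_right (Real.sqrt_nonneg _))
    obtain ⟨hC0, hMC⟩ := hconsensus hε hK hM₀ le_rfl hC
    obtain ⟨hN1, hN0, -⟩ := le_sq_mul_of_div_le hK hε hε1 hN
    have hm1 : ∀ k ∈ Finset.Icc 1 N, 1 ≤ m k := fun k hk => by
      have : (0 : ℝ) < m k := lt_of_lt_of_le (by positivity) (hm k hk)
      exact_mod_cast this
    refine hfind ε hε hε1 M N m C hM (by exact_mod_cast hN0) hC0 hm1 hMC (hBK.trans hN1) ?_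
    have h1 : ∀ k ∈ Finset.range N, (1 / (M * m (k + 1)) : ℝ) ≤ ε ^ 2 / B := by
      intro k hk
      have hk' : k + 1 ∈ Finset.Icc 1 N := by
        have := Finset.mem_range.1 hk
        exact Finset.mem_Icc.2 ⟨by omega, by omega⟩
      have h2 := hm (k + 1) hk'
      rw [div_le_iff₀ (by positivity)] at h2
      have h3 : (0 : ℝ) < m (k + 1) := by exact_mod_cast hm1 (k + 1) hk'
      have h4 : (1 : ℝ) ≤ M := by exact_mod_cast hM
      rw [div_le_div_iff₀ (by positivity) hB]
      have h5 := le_mul_of_one_le_left (by positivity : 0 ≤ (m (k + 1) : ℝ) * ε ^ 2) h4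
      linarith
    refine (mul_le_mul_of_nonneg_left (Finset.sum_le_card_nsmul _ _ _ h1) hB.le).trans ?_
    rw [Finset.card_range, nsmul_eq_mul]
    exact le_of_eq (by field_simp)
  · set K := B * (1 + √(M₀ : ℝ)) + 2 * B * (|Real.log (2 * B)| + 2) with hKd
    -- The first summand of `K` serves consensus and the constant term; the second absorbs the
    -- logarithm of the harmonic sum `∑ 1 / (k + 1)`.
    refine ⟨K, by positivity, ?_⟩
    intro ε hε hε1 M N C hM hM₀ hN hC
    have hK : 0 < K := by positivity
    have hBK : B ≤ B * (1 + √(M₀ : ℝ)) :=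
      le_mul_of_one_le_right hB.le (le_add_of_nonneg_right (Real.sqrt_nonneg _))
    have hlog : 0 ≤ 2 * B * (|Real.log (2 * B)| + 2) := by positivity
    obtain ⟨hC0, hMC⟩ := hconsensus hε hK hM₀ (le_add_of_nonneg_right hlog) hC
    obtain ⟨hN1, hN0, hN2⟩ := le_sq_mul_of_div_le hK hε hε1 hN
    refine hfind ε hε hε1 M N _ C hM (by exact_mod_cast hN0) hC0 (fun k _ => by omega) hMC
      (by linarith) ?_
    refine (mul_le_mul_of_nonneg_left (sum_one_div_add_two_le N hM) hB.le).trans ?_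
    refine mul_one_add_log_le hB hε hε1 hN0 (le_trans ?_ hN2)
    refine mul_le_mul_of_nonneg_right ?_ (by linarith [one_le_one_add_log hε hε1])
    rw [hKd]
    exact le_add_of_nonneg_left (by positivity)
  -- With `A = B`, the number of nodes alone gives `1 / (M m) ≤ ε² / B`; the upper bound `A'` is
  -- used only for consensus.
  · refine ⟨B, hB, fun A' hA' => ⟨B * (1 + √A'), by positivity, ?_⟩⟩
    intro ε hε hε1 M N m C hAM hMA hN hm hC
    have hK : 0 < B * (1 + √A') := by positivity
    have hBK : B ≤ B * (1 + √A') :=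
      le_mul_of_one_le_right hB.le (le_add_of_nonneg_right (Real.sqrt_nonneg _))
    obtain ⟨hN1, hN0, -⟩ := le_sq_mul_of_div_le hK hε hε1 hN
    have hM0 : (0 : ℝ) < M := lt_of_lt_of_le (by positivity) hAM
    have hC0 : 0 < C := lt_of_lt_of_le (by positivity) hC
    have hε2 : ε ^ 2 ≤ ε := by nlinarith
    refine hfind ε hε hε1 M N m C (by exact_mod_cast hM0) (by exact_mod_cast hN0) hC0 hm ?_
      (hBK.trans hN1) ?_
    · have h1 : √(M : ℝ) ≤ √A' / ε := by
        rw [← Real.sqrt_sq hε.le, ← Real.sqrt_div' _ (sq_nonneg ε)]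
        exact Real.sqrt_le_sqrt hMA
      rw [div_le_iff₀ (by positivity)] at hC
      rw [← mul_div_assoc, div_le_iff₀ hC0]
      -- Since `√M` is of order `1 / ε`, a `C` of order `ε⁻³` would suffice; this weakening matches
      -- the order `ε⁻⁴`.
      have h2 : √A' / ε ≤ √A' / ε ^ 2 := by gcongr
      have h3 : B * √A' / ε ^ 2 ≤ ε ^ 2 * C := by
        rw [div_le_iff₀ (by positivity)]
        linarith
      calc B * √(M : ℝ) ≤ B * (√A' / ε ^ 2) :=
            mul_le_mul_of_nonneg_left (h1.trans h2) hB.le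
        _ = B * √A' / ε ^ 2 := by ring
        _ ≤ _ := h3
    · have h1 : ∀ k ∈ Finset.range N, (1 / (M * m (k + 1)) : ℝ) ≤ ε ^ 2 / B := by
        intro k hk
        have hk' : k + 1 ∈ Finset.Icc 1 N := by
          have := Finset.mem_range.1 hk
          exact Finset.mem_Icc.2 ⟨by omega, by omega⟩
        have h2 : (1 : ℝ) ≤ m (k + 1) := by exact_mod_cast hm (k + 1) hk'
        rw [div_le_iff₀ (by positivity)] at hAM
        rw [div_le_div_iff₀ (by positivity) hB]
        have h3 := le_mul_of_one_le_right (by positivity : 0 ≤ (M : ℝ) * ε ^ 2) h2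
        linarith
      refine (mul_le_mul_of_nonneg_left (Finset.sum_le_card_nsmul _ _ _ h1) hB.le).trans ?_
      rw [Finset.card_range, nsmul_eq_mul]
      exact le_of_eq (by field_simp)
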